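/- Let $1<p<\infty$ and $p'=p/(p-1)$. For $f\in L^1_{\rm loc}(\mathbb R^n)$ let $$(\mathcal M_nf)(x)=\sup_{B\ni x}\frac1{|B|}\int_B|f(y)|\,dy,\qquad (\mathcal N_nf)(x)=\sup_{a_i<x_i<b_i\ (1\le i\le n)}\ \prod_{i=1}^n\frac1{b_i-a_i}\int_{\prod_i[a_i,b_i]}|f(y)|\,dy,$$ where the first supremum is over all closed balls $B$ (of positive radius) that contain $x$. For $T=\mathcal M_n$ or $\mathcal N_n$ let $\|T\|_{p}$ be the operator norm on $L^p(\mathbb R^n)$, i.e. the least $C\in[0,\infty]$ with $\|Tf\|_{L^p}\le C\|f\|_{L^p}$ for all $f\in L^p(\mathbb R^n)$. Say that a sequence $(a_n)$ grows exponentially if there are $b>1$, $c>0$ and $B,C\in\mathbb R$ with $c\,b^n\le a_n\le C\,B^n$ for all large $n$. Let $\omega_k=|S^k|$ be the surface measure of the unit sphere of $\mathbb R^{k+1}$, let $B(\cdot,\cdot)$ be Euler's Beta function, and for $n\ge2$ put $$E_n=2^{n-1}p'\,\frac{\omega_{n-2}}{\omega_{n-1}}\,B\Big(\frac n{2p'}+\frac12,\frac{n-1}2\Big),\qquad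 h_{\varepsilon,N}(x)=|x|^{-n/p}\chi_{[\varepsilon,N]}(|x|)\quad(x\in\mathbb R^n).$$ Then: 1. $\|\mathcal M_n\|_{p}$ grows exponentially as $n\to\infty$. 2. For every $n\ge2$: $0<\|h_{\varepsilon,N}\|_{L^p}<\infty$ for all $0<\varepsilon<N$; the limit of $\|\mathcal M_nh_{\varepsilon,N}\|_{L^p}/\|h_{\varepsilon,N}\|_{L^p}$ as $\varepsilon\to0^+$ and $N\to\infty$ exists and is at least $E_n$; consequently $\|\mathcal M_n\|_{p}\ge E_n$. Moreover $$E_n=2^np'\,\frac{\omega_{n-2}}{\omega_{n-1}}\int_0^1s^{n/p'}(1-s^2)^{(n-3)/2}\,ds .$$ 3. As $n\to\infty$, $E_n$ is asymptotic to $$p'\sqrt{\frac{1+1/p'}2}\ \left\{\frac{4\,(1/p')^{1/p'}}{(1/p'+1)^{1/p'+1}}\right\}^{n/2}$$ (the quotient tends to $1$), and the number in braces is greater than $1$. 4. The equation $(p-1)x^p-p\,x^{p-1}-1=0$ has exactly one positive solution $c_p$, and $\frac p{p-1}<c_p<\frac{2p}{p-1}$. For every $n\ge1$, $\big(\frac p{p-1}\big)^n<\|\mathcal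 N_n\|_{p}<\big(\frac{2p}{p-1}\big)^n$; in particular $\|\mathcal N_n\|_{p}$ grows exponentially as $n\to\infty$. -/

import Mathlib

open MeasureTheory Filter Topology Asymptotics
open scoped ENNReal

noncomputable section

namespace UncenteredMaximal

/-- The uncentered Hardy–Littlewood maximal function over balls on `ℝⁿ`: the supremum, over all
closed balls of positive radius that contain `x`, of the average of `|f|`. -/
def ballMaximal (n : ℕ) (f : EuclideanSpace ℝ (Fin n) → ℝ) (x : EuclideanSpace ℝ (Fin n)) :
    ℝ≥0∞ :=
  ⨆ (z : EuclideanSpace ℝ (Fin n)) (r : ℝ) (_ : 0 < r) (_ : x ∈ Metric.closedBall z r),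
    (volume (Metric.closedBall z r))⁻¹ * ∫⁻ y in Metric.closedBall z r, ‖f y‖ₑ

/-- The strong maximal function on `ℝⁿ`: the supremum, over all boxes `∏ [aᵢ, bᵢ]` with
`aᵢ < xᵢ < bᵢ`, of the average of `|f|`. Only the Lebesgue measure of `ℝⁿ` matters here, so its
points are plain functions `Fin n → ℝ`, and `Set.Icc a b` is the box. -/
def strongMaximal (n : ℕ) (f : (Fin n → ℝ) → ℝ) (x : Fin n → ℝ) : ℝ≥0∞ :=
  ⨆ (a : Fin n → ℝ) (b : Fin n → ℝ) (_ : ∀ i, a i < x i) (_ : ∀ i, x i < b i),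
    (∏ i, ENNReal.ofReal (b i - a i))⁻¹ * ∫⁻ y in Set.Icc a b, ‖f y‖ₑ

/-- The operator norm on `Lᵖ` of a (not necessarily linear) operator `T` with values in
nonnegative extended functions: the least `C` with `‖T f‖_p ≤ C ‖f‖_p` for all `f ∈ Lᵖ`. -/
def opNorm {X : Type*} [MeasureSpace X] (p : ℝ) (T : (X → ℝ) → X → ℝ≥0∞) : ℝ≥0∞ :=
  sInf {C : ℝ≥0∞ | ∀ f : X → ℝ, MemLp f (ENNReal.ofReal p) volume →
    eLpNorm (T f) (ENNReal.ofReal p) volume ≤ C * eLpNorm f (ENNReal.ofReal p) volume}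

/-- Exponential growth of a sequence: for large `n` it lies between `c bⁿ` and `C Bⁿ`,
where `c > 0` and `b > 1`. -/
def GrowsExponentially (a : ℕ → ℝ≥0∞) : Prop :=
  ∃ b c B C : ℝ, 1 < b ∧ 0 < c ∧
    ∀ᶠ n : ℕ in atTop, ENNReal.ofReal (c * b ^ n) ≤ a n ∧ a n ≤ ENNReal.ofReal (C * B ^ n)

/-- The test function `|x|^{-n/p} χ_{[ε, N]}(|x|)` on `ℝⁿ`. -/
def testFun (n : ℕ) (p ε N : ℝ) (x : EuclideanSpace ℝ (Fin n)) : ℝ :=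
  ‖x‖ ^ (-((n : ℝ) / p)) * (Set.Icc ε N).indicator 1 ‖x‖

/-- `ω_k`, the surface measure of the unit sphere `S^k` of `ℝ^{k+1}`. -/
def sphereArea (k : ℕ) : ℝ :=
  (volume : Measure (EuclideanSpace ℝ (Fin (k + 1)))).toSphere.real Set.univ

/-- The conjugate exponent `p' = p / (p - 1)`. -/
def conj (p : ℝ) : ℝ := p / (p - 1)

/-- The explicit lower bound
`2^{n-1} p' (ω_{n-2} / ω_{n-1}) B(n / (2 p') + 1/2, (n - 1) / 2)`, meant for `n ≥ 2`. -/
def betaBound (p : ℝ) (n : ℕ) : ℝ :=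
  2 ^ (n - 1) * conj p * (sphereArea (n - 2) / sphereArea (n - 1)) *
    ProbabilityTheory.beta ((n : ℝ) / (2 * conj p) + 1 / 2) (((n : ℝ) - 1) / 2)

/-- The number `4 (1/p')^{1/p'} / (1/p' + 1)^{1/p' + 1}`. -/
def growthBase (p : ℝ) : ℝ :=
  4 * (1 / conj p) ^ (1 / conj p) / (1 / conj p + 1) ^ (1 / conj p + 1)

end UncenteredMaximal

end

/-!
Maximal functions over balls. The operator commutes with rotations and dilations, so it multiplies
`|x| ^ (-n / p)` by a constant. For the truncations to `ε ≤ |x| ≤ N`, the integral of the `p`-th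
power of the function is `ω_{n-1} log (N / ε)`, and that of its maximal function is the `p`-th power
of the constant times `ω_{n-1} log (N / ε)`, up to a relatively small error; hence the constant is
the limit of the quotients. It is at least the average of `|x| ^ (-n / p)` over the ball with
diameter `[0, e]`, where `|e| = 1`. In polar coordinates that ball is `r ≤ ⟨θ, e⟩`, which turns the
average into the Beta function, whose growth is given by Stirling's formula. The Vitali covering
lemma yields the upper bound `p' 5 ^ n`.

The strong maximal function. On the line, a finite family of intervals has a subfamily with the same
union that covers no point more than twice. For the maximal function `M f` over intervals this gives
`t |{M f > t}| + t |{f > t}| ≤ ∫_{M f > t} f + ∫_{f > t} f`. Integrating against `t ^ (p - 2)` and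
applying Hölder's inequality shows that `x = ‖M f‖ / ‖f‖` satisfies
`(p - 1) x ^ p - p x ^ (p - 1) - 1 ≤ 0`, that is `x ≤ c_p`; one variable at a time, this gives the
bound `c_p ^ n`. For the lower bound take a product of the functions `|t| ^ β` on `[-1, 1]` with `β`
slightly larger than `-1 / p`: the interval from `0` to `t` gives a factor close to `p'`, and the
one from `-t / 2` to `t` gives strictly more.
-/

noncomputable section

namespace UncenteredMaximal

theorem one_lt_conj {p : ℝ} (hp : 1 < p) : 1 < conj p := by
  rw [conj, lt_div_iff₀ (by linarith)]
  linarith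

theorem conj_pos {p : ℝ} (hp : 1 < p) : 0 < conj p :=
  zero_lt_one.trans (one_lt_conj hp)

theorem one_div_conj {p : ℝ} (hp : p ≠ 0) : 1 / conj p = 1 - 1 / p := by
  rw [conj, one_div_div, sub_div, div_self hp]

theorem neg_div_eq_div_conj_sub {p : ℝ} (hp : p ≠ 0) (t : ℝ) : -(t / p) = t / conj p - t := by
  rw [div_eq_mul_one_div t (conj p), one_div_conj hp]
  ring

/-! ### The sharp constant of the one-dimensional maximal inequality -/

/-- The function `(p - 1) x ^ p - p x ^ (p - 1) - 1`, whose positive zero `c_p` bounds the norm on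
`Lᵖ(ℝ)` of the uncentered maximal operator. -/
def sharpPoly (p x : ℝ) : ℝ := (p - 1) * x ^ p - p * x ^ (p - 1) - 1

theorem sharpPoly_eq_rpow_mul {p x : ℝ} (hx : 0 < x) :
    sharpPoly p x = x ^ (p - 1) * ((p - 1) * x - p) - 1 := by
  have hxp : x ^ p = x ^ (p - 1) * x := by
    rw [← Real.rpow_add_one hx.ne', sub_add_cancel]
  rw [sharpPoly, hxp]
  ring

theorem conj_lt_of_sharpPoly_nonneg {p x : ℝ} (hp : 1 < p) (hx : 0 < x)
    (h : 0 ≤ sharpPoly p x) : conj p < x := by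
  rw [sharpPoly_eq_rpow_mul hx] at h
  by_contra! hle
  rw [conj, le_div_iff₀ (by linarith)] at hle
  have := mul_nonneg (Real.rpow_nonneg hx.le (p - 1)) (by linarith : 0 ≤ p - (p - 1) * x)
  linarith

theorem strictMonoOn_sharpPoly {p : ℝ} (hp : 1 < p) :
    StrictMonoOn (sharpPoly p) (Set.Ici (conj p)) := by
  intro x hx y _ hxy
  have hx0 : 0 < x := (conj_pos hp).trans_le hx
  have hfactor : 0 ≤ (p - 1) * x - p := by
    rw [Set.mem_Ici, conj, div_le_iff₀ (by linarith)] at hx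
    linarith
  rw [sharpPoly_eq_rpow_mul hx0, sharpPoly_eq_rpow_mul (hx0.trans hxy)]
  gcongr ?_ - 1
  exact mul_lt_mul'' (Real.rpow_lt_rpow hx0.le hxy (by linarith))
    (by gcongr) (Real.rpow_nonneg hx0.le _) hfactor

theorem sharpPoly_two_mul_conj_pos {p : ℝ} (hp : 1 < p) : 0 < sharpPoly p (2 * conj p) := by
  have hc := one_lt_conj hp
  have hfactor : (p - 1) * (2 * conj p) - p = p := by
    rw [conj, mul_left_comm, mul_div_cancel₀ _ (sub_ne_zero.2 hp.ne')]
    ring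
  have hpow : 1 ≤ (2 * conj p) ^ (p - 1) := Real.one_le_rpow (by linarith) (by linarith)
  rw [sharpPoly_eq_rpow_mul (by linarith), hfactor]
  nlinarith

theorem le_of_sharpPoly_nonpos {p c x : ℝ} (hp : 1 < p) (hc : 0 < c) (hc0 : sharpPoly p c = 0)
    (hx : sharpPoly p x ≤ 0) : x ≤ c := by
  have hconj := conj_lt_of_sharpPoly_nonneg hp hc hc0.ge
  by_contra! hlt
  have := strictMonoOn_sharpPoly hp hconj.le (hconj.trans hlt).le hlt
  linarith

theorem exists_sharpPoly_eq_zero {p : ℝ} (hp : 1 < p) :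
    ∃ c, sharpPoly p c = 0 ∧ conj p < c ∧ c < 2 * conj p := by
  have hconj := conj_pos hp
  have hcont : ContinuousOn (sharpPoly p) (Set.Icc (conj p) (2 * conj p)) := by
    intro x hx
    have hx0 : x ≠ 0 := (hconj.trans_le hx.1).ne'
    have hpow (q : ℝ) : ContinuousAt (fun x : ℝ => x ^ q) x :=
      Real.continuousAt_rpow_const _ _ (Or.inl hx0)
    exact ((((hpow p).const_mul _).sub ((hpow (p - 1)).const_mul _)).sub
      continuousAt_const).continuousWithinAt
  have hleft : sharpPoly p (conj p) < 0 := by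
    by_contra! h
    exact (conj_lt_of_sharpPoly_nonneg hp hconj h).false
  obtain ⟨c, hc, hc0⟩ := intermediate_value_Ioo (by linarith) hcont
    ⟨hleft, sharpPoly_two_mul_conj_pos hp⟩
  exact ⟨c, hc0, hc.1, hc.2⟩

theorem eq_of_sharpPoly_eq_zero {p x y : ℝ} (hp : 1 < p) (hx : 0 < x) (hy : 0 < y)
    (hx0 : sharpPoly p x = 0) (hy0 : sharpPoly p y = 0) : x = y :=
  (le_of_sharpPoly_nonpos hp hy hy0 hx0.le).antisymm (le_of_sharpPoly_nonpos hp hx hx0 hy0.le)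

/-! ### Stirling's formula -/

/-- The logarithm of the factor `x ^ (x - 1/2) e ^ (-x)` in Stirling's formula
`Γ(x) ~ √(2π) x ^ (x - 1/2) e ^ (-x)`. -/
def stirlingExponent (x : ℝ) : ℝ := (x - 1 / 2) * Real.log x - x

theorem abs_stirlingExponent_add_sub_le {x t : ℝ} (hx : 1 / 2 ≤ x) (ht0 : 0 ≤ t) (ht1 : t ≤ 1) :
    |stirlingExponent (x + t) - stirlingExponent x - t * Real.log x| ≤ 1 / x := by
  have hx0 : 0 < x := by linarith
  have hxt : 0 < x + t := by linarith
  set δ := Real.log (x + t) - Real.log x with hδ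
  have hδ_le : δ ≤ t / x := by
    have := Real.log_le_sub_one_of_pos (div_pos hxt hx0)
    rwa [Real.log_div hxt.ne' hx0.ne', add_div, div_self hx0.ne', add_sub_cancel_left] at this
  have le_hδ : t / (x + t) ≤ δ := by
    have := Real.one_sub_inv_le_log_of_pos (div_pos hxt hx0)
    rwa [Real.log_div hxt.ne' hx0.ne', inv_div, one_sub_div hxt.ne', add_sub_cancel_left] at this
  have hsub : stirlingExponent (x + t) - stirlingExponent x - t * Real.log x =
      (x + t - 1 / 2) * δ - t := by
    simp only [stirlingExponent, hδ]
    ring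
  rw [hsub, abs_le]
  constructor
  · calc -(1 / x) ≤ -(t / 2 * (1 / (x + t))) := by
          gcongr
          refine (mul_le_mul (by linarith) ?_ (by positivity) zero_le_one).trans_eq (one_mul _)
          exact one_div_le_one_div_of_le hx0 (by linarith)
      _ = (x + t - 1 / 2) * (t / (x + t)) - t := by field_simp; ring
      _ ≤ (x + t - 1 / 2) * δ - t := by gcongr; linarith
  · calc (x + t - 1 / 2) * δ - t ≤ (x + t - 1 / 2) * (t / x) - t := by gcongr; linarith
      _ = t * (t - 1 / 2) * (1 / x) := by field_simp; ring
      _ ≤ 1 / x := mul_le_of_le_one_left (by positivity) (by nlinarith)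

theorem log_Gamma_nat_add_mem_Icc {n : ℕ} (hn : 2 ≤ n) {t : ℝ} (ht0 : 0 ≤ t) (ht1 : t ≤ 1) :
    Real.log (Real.Gamma (n + t)) ∈ Set.Icc (Real.log (Real.Gamma n) + t * Real.log (n - 1))
      (Real.log (Real.Gamma n) + t * Real.log n) := by
  rcases ht0.eq_or_lt with rfl | ht
  · simp
  have log_Gamma_add_one {y : ℝ} (hy : 0 < y) :
      (Real.log ∘ Real.Gamma) (y + 1) = (Real.log ∘ Real.Gamma) y + Real.log y := by
    simp only [Function.comp, Real.Gamma_add_one hy.ne',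
      Real.log_mul hy.ne' (Real.Gamma_pos_of_pos hy).ne', add_comm]
  exact ⟨Real.BohrMollerup.f_add_nat_ge Real.convexOn_log_Gamma log_Gamma_add_one hn ht,
    Real.BohrMollerup.f_add_nat_le Real.convexOn_log_Gamma log_Gamma_add_one (by omega) ht ht1⟩

theorem log_sub_log_sub_one_le {x : ℝ} (hx : 1 < x) :
    Real.log x - Real.log (x - 1) ≤ 1 / (x - 1) := by
  have hx1 : 0 < x - 1 := by linarith
  have := Real.log_le_sub_one_of_pos (div_pos (by linarith : 0 < x) hx1)
  rwa [Real.log_div (by linarith) hx1.ne', div_sub_one hx1.ne', sub_sub_cancel] at this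

theorem abs_log_Gamma_sub_stirlingExponent_add_sub_le {n : ℕ} (hn : 2 ≤ n) {t : ℝ} (ht0 : 0 ≤ t)
    (ht1 : t ≤ 1) :
    |(Real.log (Real.Gamma (n + t)) - stirlingExponent (n + t)) -
      (Real.log (Real.Gamma n) - stirlingExponent n)| ≤ 2 / ((n : ℝ) - 1) := by
  have hn2 : (2 : ℝ) ≤ n := by exact_mod_cast hn
  obtain ⟨hlow, hupp⟩ := log_Gamma_nat_add_mem_Icc hn ht0 ht1
  obtain ⟨hS_low, hS_upp⟩ :=
    abs_le.1 (abs_stirlingExponent_add_sub_le (by linarith : 1 / 2 ≤ (n : ℝ)) ht0 ht1)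
  have hinv : 1 / (n : ℝ) ≤ 1 / (n - 1) := one_div_le_one_div_of_le (by linarith) (by linarith)
  have hlog : t * (Real.log n - Real.log (n - 1)) ≤ 1 / (n - 1) :=
    (mul_le_of_le_one_left (sub_nonneg.2 (Real.log_le_log (by linarith) (by linarith))) ht1).trans
      (log_sub_log_sub_one_le (by linarith))
  have htwo : 2 / ((n : ℝ) - 1) = 1 / (n - 1) + 1 / (n - 1) := by ring
  rw [abs_le, htwo]
  constructor <;> linarith

theorem tendsto_log_Gamma_nat_sub_stirlingExponent :
    Tendsto (fun n : ℕ => Real.log (Real.Gamma n) - stirlingExponent n) atTop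
      (𝓝 (Real.log (2 * Real.pi) / 2)) := by
  have hlim : Real.log (2 * Real.pi) / 2 = Real.log √Real.pi + Real.log 2 / 2 := by
    rw [Real.log_sqrt Real.pi_pos.le, Real.log_mul two_ne_zero Real.pi_pos.ne']
    ring
  have hlog := (Real.continuousAt_log (Real.sqrt_pos.2 Real.pi_pos).ne').tendsto.comp
    Stirling.tendsto_stirlingSeq_sqrt_pi
  rw [hlim]
  refine (hlog.add_const (Real.log 2 / 2)).congr' ?_
  filter_upwards [eventually_ge_atTop 1] with n hn
  have hn0 : (0 : ℝ) < n := by exact_mod_cast hn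
  have hfactorial : Real.log (n.factorial : ℝ) = Real.log (Real.Gamma n) + Real.log n := by
    rw [← Real.Gamma_nat_eq_factorial, Real.Gamma_add_one hn0.ne',
      Real.log_mul hn0.ne' (Real.Gamma_pos_of_pos hn0).ne', add_comm]
  simp only [Function.comp, Stirling.log_stirlingSeq_formula, stirlingExponent, hfactorial]
  rw [Real.log_mul two_ne_zero hn0.ne', Real.log_div hn0.ne' (Real.exp_pos 1).ne', Real.log_exp]
  ring

theorem tendsto_log_Gamma_sub_stirlingExponent :
    Tendsto (fun x => Real.log (Real.Gamma x) - stirlingExponent x) atTop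
      (𝓝 (Real.log (2 * Real.pi) / 2)) := by
  set D : ℝ → ℝ := fun x => Real.log (Real.Gamma x) - stirlingExponent x
  have hbound : Tendsto (fun x : ℝ => 2 / ((⌊x⌋₊ : ℝ) - 1)) atTop (𝓝 0) :=
    tendsto_const_nhds.div_atTop (tendsto_atTop_add_const_right _ _
      (tendsto_natCast_atTop_atTop.comp tendsto_nat_floor_atTop))
  have hdiff : Tendsto (fun x : ℝ => D x - D ⌊x⌋₊) atTop (𝓝 0) := by
    refine squeeze_zero_norm' ?_ hbound
    filter_upwards [eventually_ge_atTop 2] with x hx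
    have hlow := Nat.floor_le (by linarith : 0 ≤ x)
    have hupp := Nat.lt_floor_add_one x
    simpa only [D, add_sub_cancel, Real.norm_eq_abs] using
      abs_log_Gamma_sub_stirlingExponent_add_sub_le (Nat.le_floor (by exact_mod_cast hx) :
        2 ≤ ⌊x⌋₊) (sub_nonneg.2 hlow) (by linarith)
  simpa [D] using
    hdiff.add (tendsto_log_Gamma_nat_sub_stirlingExponent.comp tendsto_nat_floor_atTop)

theorem Gamma_isEquivalent :
    Real.Gamma ~[atTop] fun x => √(2 * Real.pi) * (x ^ (x - 1 / 2) * Real.exp (-x)) := by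
  rw [isEquivalent_iff_tendsto_one]
  · have hexp := (Real.continuous_exp.tendsto 0).comp
      (tendsto_sub_nhds_zero_iff.2 tendsto_log_Gamma_sub_stirlingExponent)
    rw [Real.exp_zero] at hexp
    refine hexp.congr' ?_
    filter_upwards [eventually_gt_atTop 0] with x hx
    have hstirling : Real.exp (stirlingExponent x) = x ^ (x - 1 / 2) * Real.exp (-x) := by
      rw [stirlingExponent, sub_eq_add_neg, Real.exp_add, mul_comm (x - 1 / 2),
        Real.rpow_def_of_pos hx]
    simp only [Function.comp, Pi.div_apply]
    rw [sub_sub, Real.exp_sub, Real.exp_add, hstirling, Real.exp_log (Real.Gamma_pos_of_pos hx),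
      ← Real.log_sqrt (by positivity), Real.exp_log (by positivity), mul_comm √_]
  · filter_upwards [eventually_gt_atTop 0] with x hx
    positivity

theorem Gamma_add_half_isEquivalent :
    (fun x : ℝ => Real.Gamma (x + 1 / 2)) ~[atTop]
      fun x => √(2 * Real.pi) * (x ^ x * Real.exp (-x)) := by
  have hpow : (fun x : ℝ => (1 + 1 / 2 / x) ^ x) ~[atTop] fun _ => Real.exp (1 / 2) :=
    (isEquivalent_const_iff_tendsto (Real.exp_pos _).ne').2
      (Real.tendsto_one_add_div_rpow_exp (1 / 2))
  have hshift := Gamma_isEquivalent.comp_tendsto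
    (tendsto_atTop_add_const_right atTop (1 / 2) tendsto_id)
  have hmul := (IsEquivalent.refl (u := fun x : ℝ =>
    √(2 * Real.pi) * (x ^ x * Real.exp (-(x + 1 / 2))))).mul hpow
  refine hshift.trans ((hmul.congr_left ?_).congr_right ?_)
  · filter_upwards [eventually_gt_atTop 0] with x hx
    have hfactor : x + 1 / 2 = x * (1 + 1 / 2 / x) := by field_simp
    have hrpow : (x + 1 / 2) ^ x = x ^ x * (1 + 1 / 2 / x) ^ x := by
      rw [hfactor, Real.mul_rpow hx.le (by positivity)]
    simp only [Pi.mul_apply, Function.comp, id, add_sub_cancel_right, hrpow]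
    ring
  · refine Eventually.of_forall fun x => ?_
    simp only [Pi.mul_apply]
    rw [neg_add, Real.exp_add, Real.exp_neg (1 / 2)]
    field_simp

theorem Gamma_mul_Gamma_div_Gamma_isEquivalent {q : ℝ} (hq : 0 < q) :
    (fun x => Real.Gamma x * Real.Gamma (x * q + 1 / 2) / Real.Gamma (x * (q + 1))) ~[atTop]
      fun x => √(2 * Real.pi) * (√(q + 1) * (q ^ q / (q + 1) ^ (q + 1)) ^ x) := by
  have hq1 : 0 < q + 1 := by positivity
  have hstirling := (Gamma_isEquivalent.mul (Gamma_add_half_isEquivalent.comp_tendsto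
    (tendsto_id.atTop_mul_const hq))).div
      (Gamma_isEquivalent.comp_tendsto (tendsto_id.atTop_mul_const hq1))
  refine hstirling.congr_right ?_
  filter_upwards [eventually_gt_atTop 0] with x hx
  have hx_pow : x ^ (x * (q + 1) - 1 / 2) = x ^ (x - 1 / 2) * x ^ (x * q) := by
    rw [← Real.rpow_add hx]
    ring_nf
  have hq1_pow : (q + 1) ^ (x * (q + 1) - 1 / 2) * √(q + 1) = ((q + 1) ^ (q + 1)) ^ x := by
    rw [Real.sqrt_eq_rpow, ← Real.rpow_add hq1, ← Real.rpow_mul hq1.le]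
    ring_nf
  have hq_pow : q ^ (x * q) = (q ^ q) ^ x := by rw [← Real.rpow_mul hq.le, mul_comm]
  have hexp : Real.exp (-(x * (q + 1))) = Real.exp (-x) * Real.exp (-(x * q)) := by
    rw [← Real.exp_add]
    ring_nf
  simp only [Pi.mul_apply, Pi.div_apply, Function.comp, id]
  rw [Real.mul_rpow hx.le hq.le, Real.mul_rpow hx.le hq1.le, hx_pow, hq_pow, hexp,
    Real.div_rpow (by positivity) (by positivity), ← hq1_pow]
  field_simp

/-! ### The explicit lower bound -/

theorem strictAntiOn_mul_log_sub_add_one_mul_log :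
    StrictAntiOn (fun x : ℝ => x * Real.log x - (x + 1) * Real.log (x + 1)) (Set.Ici 0) := by
  refine strictAntiOn_of_deriv_neg (convex_Ici 0) ?_ fun x hx => ?_
  · exact (Real.continuous_mul_log.sub
      (Real.continuous_mul_log.comp (continuous_add_const 1))).continuousOn
  · rw [interior_Ici] at hx
    have hx0 : 0 < x := hx
    have hderiv : HasDerivAt (fun x : ℝ => x * Real.log x - (x + 1) * Real.log (x + 1))
        (Real.log x + 1 - (Real.log (x + 1) + 1)) x :=
      (Real.hasDerivAt_mul_log hx0.ne').sub
        ((Real.hasDerivAt_mul_log (by linarith : x + 1 ≠ 0)).comp_add_const x 1)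
    rw [hderiv.deriv, add_sub_add_right_eq_sub, sub_neg]
    exact Real.log_lt_log hx0 (lt_add_one x)

theorem one_lt_growthBase {p : ℝ} (hp : 1 < p) : 1 < growthBase p := by
  have hq0 : 0 < 1 / conj p := one_div_pos.2 (conj_pos hp)
  have hq1 : 1 / conj p < 1 := (div_lt_one (conj_pos hp)).2 (one_lt_conj hp)
  rw [growthBase]
  generalize 1 / conj p = q at hq0 hq1
  have hlog_four : Real.log 4 = 2 * Real.log 2 := by
    rw [show (4 : ℝ) = 2 ^ 2 by norm_num, Real.log_pow, Nat.cast_ofNat]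
  -- The right-hand side is the value of the antitone function at `q = 1`.
  have hentropy : -(2 * Real.log 2) < q * Real.log q - (q + 1) * Real.log (q + 1) := by
    have := strictAntiOn_mul_log_sub_add_one_mul_log (Set.mem_Ici.2 hq0.le)
      (Set.mem_Ici.2 zero_le_one) hq1
    norm_num at this
    linarith
  rw [← Real.log_pos_iff (by positivity), Real.log_div (by positivity) (by positivity),
    Real.log_mul (by norm_num) (by positivity), Real.log_rpow hq0, Real.log_rpow (by linarith)]
  linarith

theorem sphereArea_eq (k : ℕ) :
    sphereArea k = 2 * Real.pi ^ (((k : ℝ) + 1) / 2) / Real.Gamma (((k : ℝ) + 1) / 2) := by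
  have hk : (0 : ℝ) < ((k : ℝ) + 1) / 2 := by positivity
  have hsqrt : √Real.pi ^ (k + 1) = Real.pi ^ (((k : ℝ) + 1) / 2) := by
    rw [Real.sqrt_eq_rpow, ← Real.rpow_natCast, ← Real.rpow_mul Real.pi_pos.le]
    congr 1
    push_cast
    ring
  rw [sphereArea, Measure.toSphere_real_apply_univ, finrank_euclideanSpace_fin, measureReal_def,
    EuclideanSpace.volume_ball, Fintype.card_fin, hsqrt, ENNReal.ofReal_one, one_pow, one_mul,
    ENNReal.toReal_ofReal (by positivity)]
  push_cast
  rw [Real.Gamma_add_one hk.ne']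
  field_simp

theorem sphereArea_div_sphereArea_succ (k : ℕ) :
    sphereArea k / sphereArea (k + 1) = Real.Gamma (((k : ℝ) + 2) / 2) /
      (√Real.pi * Real.Gamma (((k : ℝ) + 1) / 2)) := by
  have hpi : Real.pi ^ (((k : ℝ) + 2) / 2) = Real.pi ^ (((k : ℝ) + 1) / 2) * √Real.pi := by
    rw [Real.sqrt_eq_rpow, ← Real.rpow_add Real.pi_pos]
    ring_nf
  rw [sphereArea_eq, sphereArea_eq]
  push_cast
  rw [add_assoc, one_add_one_eq_two, hpi]
  field_simp

theorem betaBound_eq_Gamma {p : ℝ} (hp : 1 < p) {n : ℕ} (hn : 2 ≤ n) :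
    betaBound p n = 2 ^ (n - 1) * conj p / √Real.pi *
      (Real.Gamma ((n : ℝ) / 2) * Real.Gamma ((n : ℝ) / 2 * (1 / conj p) + 1 / 2) /
        Real.Gamma ((n : ℝ) / 2 * (1 / conj p + 1))) := by
  have hc := conj_pos hp
  obtain ⟨k, rfl⟩ := Nat.exists_eq_add_of_le' hn
  have hadd : ((k + 2 : ℕ) : ℝ) / 2 * (1 / conj p) + 1 / 2 + (((k + 2 : ℕ) : ℝ) - 1) / 2 =
      ((k + 2 : ℕ) : ℝ) / 2 * (1 / conj p + 1) := by ring
  rw [betaBound, ProbabilityTheory.beta, show k + 2 - 1 = k + 1 from rfl,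
    Nat.add_sub_cancel, sphereArea_div_sphereArea_succ,
    show ((k + 2 : ℕ) : ℝ) / (2 * conj p) = ((k + 2 : ℕ) : ℝ) / 2 * (1 / conj p) by field_simp,
    hadd]
  push_cast
  rw [show (k : ℝ) + 2 - 1 = k + 1 by ring]
  field_simp

theorem betaBound_isEquivalent {p : ℝ} (hp : 1 < p) :
    betaBound p ~[atTop] fun n : ℕ =>
      conj p * √((1 + 1 / conj p) / 2) * growthBase p ^ ((n : ℝ) / 2) := by
  have hc := conj_pos hp
  have hq : 0 < 1 / conj p := one_div_pos.2 hc
  have hhalf : Tendsto (fun n : ℕ => (n : ℝ) / 2) atTop atTop :=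
    tendsto_natCast_atTop_atTop.atTop_div_const two_pos
  have hGamma := (IsEquivalent.refl (u := fun n : ℕ => 2 ^ (n - 1) * conj p / √Real.pi)).mul
    ((Gamma_mul_Gamma_div_Gamma_isEquivalent hq).comp_tendsto hhalf)
  refine (hGamma.congr_left ?_).congr_right ?_
  · filter_upwards [eventually_ge_atTop 2] with n hn
    exact (betaBound_eq_Gamma hp hn).symm
  · filter_upwards [eventually_ge_atTop 1] with n hn
    have htwo : (2 : ℝ) ^ (n - 1) = 4 ^ ((n : ℝ) / 2) / 2 := by
      rw [show (4 : ℝ) = 2 ^ (2 : ℝ) by norm_num, ← Real.rpow_mul zero_le_two, mul_div_cancel₀ _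
        two_ne_zero, Real.rpow_natCast, eq_div_iff two_ne_zero, ← pow_succ, Nat.sub_add_cancel hn]
    have hsqrt : √(2 * Real.pi) * √(1 / conj p + 1) = 2 * √Real.pi * √((1 + 1 / conj p) / 2) := by
      rw [← Real.sqrt_mul (by positivity), mul_assoc _ √Real.pi, ← Real.sqrt_mul Real.pi_pos.le,
        show 2 * Real.pi * (1 / conj p + 1) = 2 ^ 2 * (Real.pi * ((1 + 1 / conj p) / 2)) by ring,
        Real.sqrt_mul (by positivity), Real.sqrt_sq zero_le_two]
    simp only [Pi.mul_apply, Function.comp]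
    rw [htwo, ← mul_assoc √(2 * Real.pi), hsqrt, growthBase, mul_div_assoc (4 : ℝ),
      Real.mul_rpow (by norm_num) (by positivity)]
    field_simp

theorem beta_eq_integral {a b : ℝ} (ha : 0 < a) (hb : 0 < b) :
    ProbabilityTheory.beta a b = ∫ x in (0 : ℝ)..1, x ^ (a - 1) * (1 - x) ^ (b - 1) := by
  have hreal : ∀ x ∈ Set.uIcc (0 : ℝ) 1, (x : ℂ) ^ ((a : ℂ) - 1) * (1 - (x : ℂ)) ^ ((b : ℂ) - 1) =
      ((x ^ (a - 1) * (1 - x) ^ (b - 1) : ℝ) : ℂ) := by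
    intro x hx
    rw [Set.uIcc_of_le zero_le_one] at hx
    rw [Complex.ofReal_mul, Complex.ofReal_cpow hx.1, Complex.ofReal_cpow (by linarith [hx.2])]
    push_cast
    rfl
  rw [ProbabilityTheory.beta_eq_betaIntegralReal a b ha hb, Complex.betaIntegral,
    intervalIntegral.integral_congr hreal, intervalIntegral.integral_ofReal, Complex.ofReal_re]

theorem beta_eq_two_mul_integral {a b : ℝ} (ha : 0 < a) (hb : 0 < b) :
    ProbabilityTheory.beta a b =
      2 * ∫ s in (0 : ℝ)..1, s ^ (2 * a - 1) * (1 - s ^ 2) ^ (b - 1) := by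
  have himage : (fun s : ℝ => s ^ 2) '' Set.Ioo 0 1 = Set.Ioo 0 1 := by
    ext x
    refine ⟨?_, fun hx => ⟨√x, ?_, Real.sq_sqrt hx.1.le⟩⟩
    · rintro ⟨s, hs, rfl⟩
      exact ⟨pow_pos hs.1 2, pow_lt_one₀ hs.1.le hs.2 two_ne_zero⟩
    · exact ⟨Real.sqrt_pos.2 hx.1, (Real.sqrt_lt' one_pos).2 (by simpa using hx.2)⟩
  have hinj : Set.InjOn (fun s : ℝ => s ^ 2) (Set.Ioo 0 1) := fun s hs t ht hst =>
    (pow_left_inj₀ hs.1.le ht.1.le two_ne_zero).1 hst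
  rw [beta_eq_integral ha hb, intervalIntegral.integral_of_le zero_le_one,
    intervalIntegral.integral_of_le zero_le_one, integral_Ioc_eq_integral_Ioo,
    integral_Ioc_eq_integral_Ioo, ← integral_const_mul]
  conv_lhs => rw [← himage]
  rw [integral_image_eq_integral_abs_deriv_smul measurableSet_Ioo
    (fun s _ => (hasDerivAt_pow 2 s).hasDerivWithinAt) hinj]
  refine setIntegral_congr_fun measurableSet_Ioo fun s hs => ?_
  have hpow : s ^ (2 * a - 1) = s * (s ^ 2) ^ (a - 1) := by
    rw [← Real.rpow_natCast, ← Real.rpow_mul hs.1.le, mul_comm s, ← Real.rpow_add_one hs.1.ne']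
    congr 1
    push_cast
    ring
  have habs : |((2 : ℕ) : ℝ) * s ^ (2 - 1)| = 2 * s := by
    simp [abs_of_pos hs.1]
  simp only [habs, hpow, smul_eq_mul]
  ring

theorem betaBound_eq_integral {p : ℝ} (hp : 1 < p) {n : ℕ} (hn : 2 ≤ n) :
    betaBound p n = 2 ^ n * conj p * (sphereArea (n - 2) / sphereArea (n - 1)) *
      ∫ s in (0 : ℝ)..1, s ^ ((n : ℝ) / conj p) * (1 - s ^ 2) ^ (((n : ℝ) - 3) / 2) := by
  have hn2 : (2 : ℝ) ≤ n := by exact_mod_cast hn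
  have hc := conj_pos hp
  have hs : 2 * ((n : ℝ) / (2 * conj p) + 1 / 2) - 1 = n / conj p := by
    field_simp
    ring
  have hone : ((n : ℝ) - 1) / 2 - 1 = (n - 3) / 2 := by ring
  have htwo : (2 : ℝ) ^ n = 2 ^ (n - 1) * 2 := by rw [← pow_succ, Nat.sub_add_cancel (by omega)]
  rw [betaBound, beta_eq_two_mul_integral (by positivity) (by linarith), hs, hone, htwo]
  ring

section LayerCake

variable {α : Type*} [MeasurableSpace α] {μ : Measure α} {p : ℝ} {f h : α → ℝ≥0∞}

theorem rpow_eq_mul_rpow_sub_one (hp : 1 ≤ p) (a : ℝ≥0∞) : a ^ p = a * a ^ (p - 1) := by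
  conv_lhs => rw [← add_sub_cancel 1 p,
    ENNReal.rpow_add_of_nonneg _ _ zero_le_one (sub_nonneg.2 hp), ENNReal.rpow_one]

theorem ae_ne_top_of_lintegral_rpow_ne_top (hp : 0 < p) (hf : Measurable f)
    (hfp : ∫⁻ x, f x ^ p ∂μ ≠ ∞) : ∀ᵐ x ∂μ, f x ≠ ∞ := by
  filter_upwards [ae_lt_top (hf.pow_const p) hfp] with x hx
  exact ((ENNReal.rpow_lt_top_iff_of_pos hp).1 hx).ne

theorem lintegral_rpow_eq_lintegral_measure_lt (hh : Measurable h) (hfin : ∀ᵐ x ∂μ, h x ≠ ∞)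
    (hp : 0 < p) :
    ∫⁻ x, h x ^ p ∂μ = ENNReal.ofReal p * ∫⁻ t in Set.Ioi (0 : ℝ),
      μ {x | ENNReal.ofReal t < h x} * ENNReal.ofReal (t ^ (p - 1)) := by
  calc ∫⁻ x, h x ^ p ∂μ = ∫⁻ x, ENNReal.ofReal ((h x).toReal ^ p) ∂μ := by
        refine lintegral_congr_ae ?_
        filter_upwards [hfin] with x hx
        rw [← ENNReal.ofReal_rpow_of_nonneg ENNReal.toReal_nonneg hp.le, ENNReal.ofReal_toReal hx]
    _ = ENNReal.ofReal p * ∫⁻ t in Set.Ioi (0 : ℝ),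
          μ {x | t < (h x).toReal} * ENNReal.ofReal (t ^ (p - 1)) :=
        lintegral_rpow_eq_lintegral_meas_lt_mul μ
          (Eventually.of_forall fun _ => ENNReal.toReal_nonneg) hh.ennreal_toReal.aemeasurable hp
    _ = _ := by
        congr 1
        refine setLIntegral_congr_fun measurableSet_Ioi fun t ht => ?_
        congr 1
        refine measure_congr ?_
        filter_upwards [hfin] with x hx
        exact propext (ENNReal.ofReal_lt_iff_lt_toReal (Set.mem_Ioi.1 ht).le hx).symm

theorem lintegral_rpow_eq_lintegral_mul_measure_lt (hh : Measurable h)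
    (hfin : ∀ᵐ x ∂μ, h x ≠ ∞) (hp : 0 < p) :
    ∫⁻ x, h x ^ p ∂μ = ENNReal.ofReal p * ∫⁻ t in Set.Ioi (0 : ℝ),
      ENNReal.ofReal t * μ {x | ENNReal.ofReal t < h x} * ENNReal.ofReal (t ^ (p - 1 - 1)) := by
  rw [lintegral_rpow_eq_lintegral_measure_lt hh hfin hp]
  congr 1
  refine setLIntegral_congr_fun measurableSet_Ioi fun t (ht : 0 < t) => ?_
  have hpow : t ^ (p - 1) = t * t ^ (p - 1 - 1) := by
    rw [Real.rpow_sub_one ht.ne' (p - 1), mul_div_cancel₀ _ ht.ne']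
  simp only [hpow, ENNReal.ofReal_mul ht.le]
  ring

theorem lintegral_mul_rpow_eq_lintegral_setLIntegral (hf : Measurable f) (hh : Measurable h)
    (hfin : ∀ᵐ x ∂μ, h x ≠ ∞) (hp : 0 < p) :
    ∫⁻ x, f x * h x ^ p ∂μ = ENNReal.ofReal p * ∫⁻ t in Set.Ioi (0 : ℝ),
      (∫⁻ x in {x | ENNReal.ofReal t < h x}, f x ∂μ) * ENNReal.ofReal (t ^ (p - 1)) := by
  have hlayer := lintegral_rpow_eq_lintegral_measure_lt (μ := μ.withDensity f) hh
    ((withDensity_absolutelyContinuous μ f).ae_le hfin) hp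
  rw [lintegral_withDensity_eq_lintegral_mul _ hf (hh.pow_const _)] at hlayer
  simpa only [Pi.mul_apply, withDensity_apply f (measurableSet_lt measurable_const hh)] using hlayer

theorem measurable_measure_lt (μ : Measure α) (h : α → ℝ≥0∞) :
    Measurable fun t : ℝ => μ {x | ENNReal.ofReal t < h x} :=
  Antitone.measurable fun _ _ hst => measure_mono fun _ hx =>
    (ENNReal.ofReal_le_ofReal hst).trans_lt hx

theorem measurable_setLIntegral_lt (f : α → ℝ≥0∞) (hh : Measurable h) :
    Measurable fun t : ℝ => ∫⁻ x in {x | ENNReal.ofReal t < h x}, f x ∂μ := by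
  simpa only [withDensity_apply f (measurableSet_lt measurable_const hh)] using
    measurable_measure_lt (μ.withDensity f) h

theorem setLIntegral_mul_add_le {s : Set α} (hs : MeasurableSet s) {K K' : ℝ≥0∞} (hK : K ≠ ∞)
    (hK' : K' ≠ ∞) {A B C D w : α → ℝ≥0∞} (hA : Measurable A) (hC : Measurable C)
    (hw : Measurable w) (h : ∀ x ∈ s, A x + K' * B x ≤ K * C x + K' * D x) :
    (∫⁻ x in s, A x * w x ∂μ) + K' * ∫⁻ x in s, B x * w x ∂μ ≤
      (K * ∫⁻ x in s, C x * w x ∂μ) + K' * ∫⁻ x in s, D x * w x ∂μ := by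
  have hAw : Measurable fun x => A x * w x := hA.mul hw
  have hCw : Measurable fun x => K * (C x * w x) := (hC.mul hw).const_mul K
  rw [← lintegral_const_mul' _ _ hK', ← lintegral_const_mul' _ _ hK',
    ← lintegral_const_mul' _ _ hK, ← lintegral_add_left hAw, ← lintegral_add_left hCw]
  refine setLIntegral_mono' hs fun x hx => ?_
  simpa only [add_mul, mul_assoc] using mul_le_mul_left (h x hx) (w x)

theorem lintegral_rpow_le_of_weak_type (hp : 1 < p) {K K' : ℝ≥0∞} (hK : K ≠ ∞)
    (hK' : K' ≠ ∞) (hf : Measurable f) (hh : Measurable h)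
    (hfp : ∫⁻ x, f x ^ p ∂μ ≠ ∞) (hhp : ∫⁻ x, h x ^ p ∂μ ≠ ∞)
    (hweak : ∀ t : ℝ, 0 < t →
      ENNReal.ofReal t * μ {x | ENNReal.ofReal t < h x} +
          K' * (ENNReal.ofReal t * μ {x | ENNReal.ofReal t < f x}) ≤
        K * ∫⁻ x in {x | ENNReal.ofReal t < h x}, f x ∂μ +
          K' * ∫⁻ x in {x | ENNReal.ofReal t < f x}, f x ∂μ) :
    ENNReal.ofReal (p - 1) * (∫⁻ x, h x ^ p ∂μ + K' * ∫⁻ x, f x ^ p ∂μ) ≤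
      ENNReal.ofReal p *
        (K * ∫⁻ x, f x * h x ^ (p - 1) ∂μ + K' * ∫⁻ x, f x ^ p ∂μ) := by
  have hp0 : 0 < p := one_pos.trans hp
  let w : ℝ → ℝ≥0∞ := fun t => ENNReal.ofReal (t ^ (p - 1 - 1))
  have hw : Measurable w := (measurable_id.pow_const _).ennreal_ofReal
  have hlayer {g : α → ℝ≥0∞} (hg : Measurable g) (hgp : ∫⁻ x, g x ^ p ∂μ ≠ ∞) :=
    lintegral_rpow_eq_lintegral_mul_measure_lt hg
      (ae_ne_top_of_lintegral_rpow_ne_top hp0 hg hgp) hp0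
  have hlayer_mul {g : α → ℝ≥0∞} (hg : Measurable g) (hgp : ∫⁻ x, g x ^ p ∂μ ≠ ∞) :=
    lintegral_mul_rpow_eq_lintegral_setLIntegral hf hg
      (ae_ne_top_of_lintegral_rpow_ne_top hp0 hg hgp) (sub_pos.2 hp)
  have hmeas : Measurable fun t : ℝ => ENNReal.ofReal t * μ {x | ENNReal.ofReal t < h x} :=
    ENNReal.measurable_ofReal.mul (measurable_measure_lt μ h)
  have hint := setLIntegral_mul_add_le measurableSet_Ioi hK hK' hmeas
    (measurable_setLIntegral_lt f hh) hw hweak (μ := volume)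
  have hff : ∫⁻ x, f x ^ p ∂μ = ∫⁻ x, f x * f x ^ (p - 1) ∂μ :=
    lintegral_congr fun x => rpow_eq_mul_rpow_sub_one hp.le _
  calc ENNReal.ofReal (p - 1) * (∫⁻ x, h x ^ p ∂μ + K' * ∫⁻ x, f x ^ p ∂μ)
      = ENNReal.ofReal (p - 1) * ENNReal.ofReal p * _ := by
        rw [hlayer hh hhp, hlayer hf hfp, mul_left_comm K', ← mul_add, ← mul_assoc]
    _ ≤ ENNReal.ofReal (p - 1) * ENNReal.ofReal p * _ := mul_le_mul_right hint _
    _ = _ := by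
        rw [hff, hlayer_mul hh hhp, hlayer_mul hf hfp]
        ring

theorem lintegral_mul_rpow_le (hp : 1 < p) (hf : Measurable f) (hh : Measurable h) :
    ∫⁻ x, f x * h x ^ (p - 1) ∂μ ≤
      (∫⁻ x, f x ^ p ∂μ) ^ (1 / p) * (∫⁻ x, h x ^ p ∂μ) ^ (1 - 1 / p) := by
  have hp0 : p ≠ 0 := (one_pos.trans hp).ne'
  have hp1 : p - 1 ≠ 0 := (sub_pos.2 hp).ne'
  have hholder := ENNReal.lintegral_mul_le_Lp_mul_Lq μ
    (Real.HolderConjugate.conjExponent hp) hf.aemeasurable (hh.pow_const (p - 1)).aemeasurable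
  have hexponent : 1 / (p / (p - 1)) = 1 - 1 / p := by field_simp
  simpa only [Real.conjExponent, Pi.mul_apply, ← ENNReal.rpow_mul, mul_div_cancel₀ p hp1,
    hexponent] using hholder

end LayerCake

/-! ### Maximal functions over families of sets -/

section FamilyMax

variable {α : Type*} [MeasurableSpace α] {μ : Measure α} {p : ℝ} {f : α → ℝ≥0∞}
  {ι : Type*} {I : ι → Set α}

/-- The average of `f` over the set `I i` (equal to `0` when `I i` has infinite measure). -/
def famAvg (μ : Measure α) (I : ι → Set α) (f : α → ℝ≥0∞) (i : ι) : ℝ≥0∞ :=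
  (μ (I i))⁻¹ * ∫⁻ y in I i, f y ∂μ

/-- The maximal function over the sets `I i` with `i ∈ S`, which lets the operator over a countable
family be reached from its finite subfamilies. -/
def familyMax (μ : Measure α) (I : ι → Set α) (S : Set ι) (f : α → ℝ≥0∞) (x : α) : ℝ≥0∞ :=
  ⨆ i ∈ S, (I i).indicator (fun _ => famAvg μ I f i) x

theorem familyMax_mono {S T : Set ι} (hST : S ⊆ T) (x : α) :
    familyMax μ I S f x ≤ familyMax μ I T f x :=
  biSup_mono hST

theorem familyMax_univ_eq_iSup_finset (x : α) :
    familyMax μ I Set.univ f x = ⨆ S : Finset ι, familyMax μ I S f x := by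
  refine le_antisymm (iSup₂_le fun i _ => le_iSup_of_le {i} ?_)
    (iSup_le fun S => familyMax_mono (Set.subset_univ _) x)
  simp [familyMax]

theorem measurable_familyMax (hI : ∀ i, MeasurableSet (I i)) {S : Set ι} (hS : S.Countable)
    (f : α → ℝ≥0∞) : Measurable (familyMax μ I S f) :=
  Measurable.biSup S hS fun i _ => measurable_const.indicator (hI i)

theorem setOf_lt_familyMax (S : Set ι) (f : α → ℝ≥0∞) (t : ℝ≥0∞) :
    {x | t < familyMax μ I S f x} = ⋃ i ∈ {i ∈ S | t < famAvg μ I f i}, I i := by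
  ext x
  simp only [familyMax, lt_iSup_iff, Set.mem_ofPred_eq, Set.mem_iUnion, exists_prop]
  refine exists_congr fun i => ?_
  by_cases hx : x ∈ I i <;> simp [hx]

theorem le_famAvg_iff {i : ι} (h0 : μ (I i) ≠ 0) (htop : μ (I i) ≠ ∞) {t : ℝ≥0∞} :
    t ≤ famAvg μ I f i ↔ t * μ (I i) ≤ ∫⁻ y in I i, f y ∂μ := by
  rw [famAvg, mul_comm _ (∫⁻ y in I i, f y ∂μ), ← div_eq_mul_inv,
    ENNReal.le_div_iff_mul_le (Or.inl h0) (Or.inl htop)]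

theorem setLIntegral_ne_top_of_rpow (hp : 1 ≤ p) (hfp : ∫⁻ x, f x ^ p ∂μ ≠ ∞) {s : Set α}
    (hs : μ s ≠ ∞) : ∫⁻ y in s, f y ∂μ ≠ ∞ := by
  have hbound (y : α) : f y ≤ 1 + f y ^ p := by
    rcases le_total (f y) 1 with hy | hy
    · exact hy.trans le_self_add
    · exact (ENNReal.le_rpow_self_of_one_le hy hp).trans le_add_self
  refine ne_top_of_le_ne_top ?_ (lintegral_mono hbound)
  rw [lintegral_add_left measurable_const, setLIntegral_one]
  exact ENNReal.add_ne_top.2 ⟨hs, ne_top_of_le_ne_top hfp (setLIntegral_le_lintegral _ _)⟩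

theorem lintegral_familyMax_rpow_ne_top (hp : 1 ≤ p) (hI : ∀ i, MeasurableSet (I i))
    (h0 : ∀ i, μ (I i) ≠ 0) (htop : ∀ i, μ (I i) ≠ ∞) (hfp : ∫⁻ x, f x ^ p ∂μ ≠ ∞)
    (S : Finset ι) : ∫⁻ x, familyMax μ I S f x ^ p ∂μ ≠ ∞ := by
  have hp0 : 0 < p := one_pos.trans_le hp
  have havg (i : ι) : famAvg μ I f i ≠ ∞ :=
    ENNReal.mul_ne_top (ENNReal.inv_ne_top.2 (h0 i)) (setLIntegral_ne_top_of_rpow hp hfp (htop i))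
  have hbound (x : α) : familyMax μ I S f x ^ p ≤
      ∑ i ∈ S, (I i).indicator (fun _ => famAvg μ I f i ^ p) x := by
    rw [← ENNReal.le_rpow_inv_iff hp0]
    refine iSup₂_le fun i hi => ?_
    rw [ENNReal.le_rpow_inv_iff hp0]
    refine le_trans ?_ (Finset.single_le_sum
      (f := fun i => (I i).indicator (fun _ => famAvg μ I f i ^ p) x) (fun _ _ => zero_le) hi)
    by_cases hx : x ∈ I i <;> simp [hx, hp0]
  refine ne_top_of_le_ne_top ?_ (lintegral_mono hbound)
  rw [lintegral_finsetSum _ fun i _ => measurable_const.indicator (hI i)]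
  refine ENNReal.sum_ne_top.2 fun i _ => ?_
  rw [lintegral_indicator_const (hI i)]
  exact ENNReal.mul_ne_top (ENNReal.rpow_ne_top_of_nonneg hp0.le (havg i)) (htop i)

theorem lintegral_familyMax_rpow_le_of_covering (hp : 1 < p) {K K' : ℝ≥0∞} (hK : K ≠ ∞)
    (hK' : K' ≠ ∞) (hf : Measurable f) (hI : ∀ i, MeasurableSet (I i)) (h0 : ∀ i, μ (I i) ≠ 0)
    (htop : ∀ i, μ (I i) ≠ ∞) (hfp : ∫⁻ x, f x ^ p ∂μ ≠ ∞)
    (hcov : ∀ (T : Finset ι) (t : ℝ≥0∞),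
      (∀ i ∈ T, t * μ (I i) ≤ ∫⁻ y in I i, f y ∂μ) →
      t * μ (⋃ i ∈ T, I i) + K' * (t * μ {x | t < f x}) ≤
        K * ∫⁻ x in ⋃ i ∈ T, I i, f x ∂μ + K' * ∫⁻ x in {x | t < f x}, f x ∂μ)
    (S : Finset ι) :
    ENNReal.ofReal (p - 1) * (∫⁻ x, familyMax μ I S f x ^ p ∂μ + K' * ∫⁻ x, f x ^ p ∂μ) ≤
      ENNReal.ofReal p * (K * ((∫⁻ x, f x ^ p ∂μ) ^ (1 / p) *
        (∫⁻ x, familyMax μ I S f x ^ p ∂μ) ^ (1 - 1 / p)) + K' * ∫⁻ x, f x ^ p ∂μ) := by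
  classical
  have hmax := measurable_familyMax (μ := μ) hI S.finite_toSet.countable f
  refine (lintegral_rpow_le_of_weak_type hp hK hK' hf hmax hfp
    (lintegral_familyMax_rpow_ne_top hp.le hI h0 htop hfp S) fun t _ => ?_).trans ?_
  · rw [setOf_lt_familyMax]
    have hweak := hcov {i ∈ S | ENNReal.ofReal t < famAvg μ I f i} (ENNReal.ofReal t)
      fun i hi => (le_famAvg_iff (h0 i) (htop i)).1 (Finset.mem_filter.1 hi).2.le
    simpa only [Finset.mem_filter, Set.mem_ofPred_eq, Finset.mem_coe] using hweak
  · gcongr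
    exact lintegral_mul_rpow_le hp hf hmax

theorem lintegral_familyMax_univ_rpow_le [Countable ι] (hp : 0 < p)
    (hI : ∀ i, MeasurableSet (I i)) {C : ℝ≥0∞}
    (hC : ∀ S : Finset ι, ∫⁻ x, familyMax μ I S f x ^ p ∂μ ≤ C) :
    ∫⁻ x, familyMax μ I Set.univ f x ^ p ∂μ ≤ C := by
  classical
  have hsup (x : α) : familyMax μ I Set.univ f x ^ p = ⨆ S : Finset ι, familyMax μ I S f x ^ p := by
    rw [familyMax_univ_eq_iSup_finset]
    exact (ENNReal.orderIsoRpow p hp).map_iSup _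
  simp_rw [hsup]
  rw [lintegral_iSup_directed
    fun S => ((measurable_familyMax hI S.finite_toSet.countable f).pow_const p).aemeasurable]
  · exact iSup_le hC
  · exact fun S T => ⟨S ∪ T, fun x => ENNReal.rpow_le_rpow (familyMax_mono (by simp) x) hp.le,
      fun x => ENNReal.rpow_le_rpow (familyMax_mono (by simp) x) hp.le⟩

end FamilyMax

/-! ### The sharp maximal inequality on the line -/

theorem mul_add_mul_le_of_overlap_le_two {m : ℕ} (hm : m ≤ 2) (t a : ℝ≥0∞) :
    (if m = 0 then 0 else t) + (if t < a then t else 0) + a * m ≤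
      (if m = 0 then 0 else a) + (if t < a then a else 0) + t * m := by
  rcases lt_or_ge t a with hta | hat
  · simp only [if_pos hta]
    interval_cases m
    · simpa using hta.le
    · calc t + t + a * (1 : ℕ) = t + a + t := by push_cast; ring
        _ ≤ a + a + t := by gcongr
        _ = a + a + t * (1 : ℕ) := by simp
    · exact le_of_eq (by push_cast; ring)
  · simp only [if_neg hat.not_gt]
    interval_cases m
    · simp
    · simp [add_comm]
    · calc t + 0 + a * (2 : ℕ) = a + a + t := by push_cast; ring
        _ ≤ a + t + t := by gcongr
        _ = a + 0 + t * (2 : ℕ) := by push_cast; ring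

theorem lintegral_mul_sum_indicator_one {α ι : Type*} [MeasurableSpace α] {μ : Measure α}
    {I : ι → Set α} (hI : ∀ i, MeasurableSet (I i)) {f : α → ℝ≥0∞} (hf : Measurable f)
    (T : Finset ι) :
    ∫⁻ x, f x * (∑ i ∈ T, (I i).indicator 1 x) ∂μ = ∑ i ∈ T, ∫⁻ x in I i, f x ∂μ := by
  have hmeas : ∀ i ∈ T, Measurable fun x => f x * (I i).indicator (1 : α → ℝ≥0∞) x :=
    fun i _ => hf.mul (measurable_one.indicator (hI i))
  simp only [Finset.mul_sum]
  rw [lintegral_finsetSum _ hmeas]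
  refine Finset.sum_congr rfl fun i _ => ?_
  rw [← lintegral_indicator (hI i)]
  refine lintegral_congr fun x => ?_
  by_cases hx : x ∈ I i <;> simp [hx]

theorem mul_measure_biUnion_add_le_of_overlap_le_two {α ι : Type*} [MeasurableSpace α]
    {μ : Measure α} {I : ι → Set α} (hI : ∀ i, MeasurableSet (I i)) {f : α → ℝ≥0∞}
    (hf : Measurable f) {T : Finset ι} (hfin : ∀ i ∈ T, ∫⁻ y in I i, f y ∂μ ≠ ∞)
    (hoverlap : ∀ x, ∑ i ∈ T, (I i).indicator (1 : α → ℕ) x ≤ 2) {t : ℝ≥0∞}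
    (hT : ∀ i ∈ T, t * μ (I i) ≤ ∫⁻ y in I i, f y ∂μ) :
    t * μ (⋃ i ∈ T, I i) + t * μ {x | t < f x} ≤
      ∫⁻ x in ⋃ i ∈ T, I i, f x ∂μ + ∫⁻ x in {x | t < f x}, f x ∂μ := by
  classical
  set U := ⋃ i ∈ T, I i with hU
  let g : α → ℝ≥0∞ := fun x => ∑ i ∈ T, (I i).indicator 1 x
  have hU_meas : MeasurableSet U := Finset.measurableSet_biUnion _ fun i _ => hI i
  have hlt_meas : MeasurableSet {x | t < f x} := measurableSet_lt measurable_const hf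
  have hpoint (x : α) : U.indicator (fun _ => t) x + {x | t < f x}.indicator (fun _ => t) x +
      f x * g x ≤ U.indicator f x + {x | t < f x}.indicator f x + t * g x := by
    have hgx : g x = ((∑ i ∈ T, (I i).indicator (1 : α → ℕ) x : ℕ) : ℝ≥0∞) := by
      simp [g, Set.indicator_apply]
    have hUx : x ∈ U ↔ ∑ i ∈ T, (I i).indicator (1 : α → ℕ) x ≠ 0 := by
      simp [hU, Set.indicator_apply]
    rw [hgx]
    simpa only [Set.indicator_apply, hUx, ite_not, Set.mem_ofPred_eq, Pi.one_apply] using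
      mul_add_mul_le_of_overlap_le_two (hoverlap x) t (f x)
  have hfg : ∫⁻ x, f x * g x ∂μ = ∑ i ∈ T, ∫⁻ x in I i, f x ∂μ :=
    lintegral_mul_sum_indicator_one hI hf T
  have htg : ∫⁻ x, t * g x ∂μ = ∑ i ∈ T, t * μ (I i) := by
    simpa only [setLIntegral_const] using
      lintegral_mul_sum_indicator_one hI (measurable_const (a := t)) T
  have hconst_meas : Measurable (U.indicator fun _ => t) := measurable_const.indicator hU_meas
  have hconst_add_meas : Measurable fun x =>
      U.indicator (fun _ => t) x + {x | t < f x}.indicator (fun _ => t) x :=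
    hconst_meas.add (measurable_const.indicator hlt_meas)
  have hf_add_meas : Measurable fun x => U.indicator f x + {x | t < f x}.indicator f x :=
    (hf.indicator hU_meas).add (hf.indicator hlt_meas)
  have hint := lintegral_mono (μ := μ) hpoint
  rw [lintegral_add_left hconst_add_meas, lintegral_add_left hconst_meas,
    lintegral_add_left hf_add_meas, lintegral_add_left (hf.indicator hU_meas),
    lintegral_indicator_const hU_meas, lintegral_indicator_const hlt_meas,
    lintegral_indicator hU_meas, lintegral_indicator hlt_meas, hfg, htg] at hint
  refine (ENNReal.add_le_add_iff_right (ENNReal.sum_ne_top.2 hfin)).1 (hint.trans ?_)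
  gcongr with i hi
  exact hT i hi

section Interval

variable {R : Type*} [LinearOrder R]

theorem Ioo_subset_Ioo_union_Ioo {a b a₁ b₁ a₂ b₂ x : R} (ha : a₁ ≤ a) (hb : b ≤ b₂)
    (hx₁ : x ∈ Set.Ioo a₁ b₁) (hx₂ : x ∈ Set.Ioo a₂ b₂) :
    Set.Ioo a b ⊆ Set.Ioo a₁ b₁ ∪ Set.Ioo a₂ b₂ := by
  intro y hy
  rcases le_or_gt y x with hyx | hxy
  · exact Or.inl ⟨ha.trans_lt hy.1, hyx.trans_lt hx₁.2⟩
  · exact Or.inr ⟨hx₂.1.trans hxy, hy.2.trans_le hb⟩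

theorem exists_mem_biUnion_erase_Ioo_eq {ι : Type*} [DecidableEq ι] {l r : ι → R}
    {T : Finset ι} {x : R} (hx : 2 < ({i ∈ T | x ∈ Set.Ioo (l i) (r i)} : Finset ι).card) :
    ∃ k ∈ T, ⋃ i ∈ T.erase k, Set.Ioo (l i) (r i) = ⋃ i ∈ T, Set.Ioo (l i) (r i) := by
  set X : Finset ι := {i ∈ T | x ∈ Set.Ioo (l i) (r i)}
  have hX : X.Nonempty := Finset.card_pos.1 (pos_of_gt hx)
  obtain ⟨i, hi, hi_min⟩ := Finset.exists_min_image X l hX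
  obtain ⟨j, hj, hj_max⟩ := Finset.exists_max_image X r hX
  obtain ⟨k, hk, hk_ne⟩ := Finset.exists_mem_notMem_of_card_lt_card
    (Finset.card_le_two (a := i) (b := j) |>.trans_lt hx)
  simp only [Finset.mem_insert, Finset.mem_singleton, not_or] at hk_ne
  simp only [X, Finset.mem_filter] at hi hj hk
  have hk_subset := Ioo_subset_Ioo_union_Ioo (hi_min k (Finset.mem_filter.2 hk))
    (hj_max k (Finset.mem_filter.2 hk)) hi.2 hj.2
  refine ⟨k, hk.1, subset_antisymm
    (Set.biUnion_subset_biUnion_left fun m hm => Finset.mem_of_mem_erase hm)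
    (Set.iUnion₂_subset fun m hm => ?_)⟩
  have hsubset {n : ι} (hn : n ∈ T) (hnk : n ≠ k) :
      Set.Ioo (l n) (r n) ⊆ ⋃ i ∈ T.erase k, Set.Ioo (l i) (r i) :=
    Set.subset_biUnion_of_mem (u := fun i => Set.Ioo (l i) (r i)) (Finset.mem_erase.2 ⟨hnk, hn⟩)
  rcases eq_or_ne m k with rfl | hmk
  · exact hk_subset.trans
      (Set.union_subset (hsubset hi.1 (Ne.symm hk_ne.1)) (hsubset hj.1 (Ne.symm hk_ne.2)))
  · exact hsubset hm hmk

theorem exists_subfamily_overlap_le_two {ι : Type*} (l r : ι → R) (T : Finset ι) :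
    ∃ T' ⊆ T, ⋃ i ∈ T', Set.Ioo (l i) (r i) = ⋃ i ∈ T, Set.Ioo (l i) (r i) ∧
      ∀ x, ({i ∈ T' | x ∈ Set.Ioo (l i) (r i)} : Finset ι).card ≤ 2 := by
  classical
  -- A subfamily of minimal cardinality with the same union works.
  obtain ⟨T', hT', hmin⟩ := Finset.exists_min_image
    {T' ∈ T.powerset | ⋃ i ∈ T', Set.Ioo (l i) (r i) = ⋃ i ∈ T, Set.Ioo (l i) (r i)}
    Finset.card ⟨T, by simp⟩
  simp only [Finset.mem_filter, Finset.mem_powerset] at hT' hmin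
  refine ⟨T', hT'.1, hT'.2, fun x => ?_⟩
  by_contra! hcard
  obtain ⟨k, hk, hunion⟩ := exists_mem_biUnion_erase_Ioo_eq hcard
  exact (hmin (T'.erase k) ⟨(Finset.erase_subset _ _).trans hT'.1, hunion.trans hT'.2⟩).not_gt
    (Finset.card_erase_lt_of_mem hk)

end Interval

theorem mul_volume_biUnion_Ioo_add_le {ι : Type*} (l r : ι → ℝ) {f : ℝ → ℝ≥0∞}
    (hf : Measurable f) {T : Finset ι} (hfin : ∀ i ∈ T, ∫⁻ y in Set.Ioo (l i) (r i), f y ≠ ∞)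
    {t : ℝ≥0∞}
    (hT : ∀ i ∈ T, t * volume (Set.Ioo (l i) (r i)) ≤ ∫⁻ y in Set.Ioo (l i) (r i), f y) :
    t * volume (⋃ i ∈ T, Set.Ioo (l i) (r i)) + t * volume {x | t < f x} ≤
      (∫⁻ x in ⋃ i ∈ T, Set.Ioo (l i) (r i), f x) + ∫⁻ x in {x | t < f x}, f x := by
  classical
  obtain ⟨T', hT', hunion, hoverlap⟩ := exists_subfamily_overlap_le_two l r T
  rw [← hunion]
  refine mul_measure_biUnion_add_le_of_overlap_le_two (fun _ => measurableSet_Ioo) hf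
    (fun i hi => hfin i (hT' hi)) (fun x => ?_) fun i hi => hT i (hT' hi)
  simpa only [Set.indicator_apply, Pi.one_apply, Finset.card_filter] using hoverlap x

/-- Index set for the bounded open intervals with rational endpoints. They form a countable family
over which the maximal function of the line may be computed. -/
abbrev RatInterval : Type := {q : ℚ × ℚ // q.1 < q.2}

namespace RatInterval

/-- The open interval of the real line with given rational endpoints. -/
def toSet (i : RatInterval) : Set ℝ := Set.Ioo (i.1.1 : ℝ) (i.1.2 : ℝ)

theorem measurableSet_toSet (i : RatInterval) : MeasurableSet i.toSet := measurableSet_Ioo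

theorem volume_toSet (i : RatInterval) :
    volume i.toSet = ENNReal.ofReal ((i.1.2 : ℝ) - i.1.1) := Real.volume_Ioo

theorem volume_toSet_ne_zero (i : RatInterval) : volume i.toSet ≠ 0 := by
  rw [volume_toSet, ENNReal.ofReal_ne_zero_iff, sub_pos]
  exact_mod_cast i.2

theorem volume_toSet_ne_top (i : RatInterval) : volume i.toSet ≠ ∞ := by
  rw [volume_toSet]
  exact ENNReal.ofReal_ne_top

end RatInterval

/-- The maximal function on the line over the intervals with rational endpoints. -/
abbrev intervalMax (f : ℝ → ℝ≥0∞) : ℝ → ℝ≥0∞ :=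
  familyMax volume RatInterval.toSet Set.univ f

theorem le_mul_of_sharpPoly_eq_zero {p c a b : ℝ} (hp : 1 < p) (hc : 0 < c)
    (hc0 : sharpPoly p c = 0) (ha : 0 ≤ a) (hb : 0 ≤ b)
    (hab : (p - 1) * (a ^ p + b ^ p) ≤ p * (b * a ^ (p - 1) + b ^ p)) : a ≤ c * b := by
  have hp0 : 0 < p := one_pos.trans hp
  rcases hb.eq_or_lt with rfl | hb
  · rw [Real.zero_rpow hp0.ne', add_zero, add_zero, zero_mul, mul_zero] at hab
    have ha_pow : a ^ p = 0 := le_antisymm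
      (nonpos_of_mul_nonpos_right hab (sub_pos.2 hp)) (Real.rpow_nonneg ha p)
    rw [mul_zero, (Real.rpow_eq_zero ha hp0.ne').1 ha_pow]
  · refine (div_le_iff₀ hb).1 (le_of_sharpPoly_nonpos hp hc hc0 ?_)
    have hdiv : sharpPoly p (a / b) =
        ((p - 1) * (a ^ p + b ^ p) - p * (b * a ^ (p - 1) + b ^ p)) / b ^ p := by
      have hbp : b ^ p ≠ 0 := (Real.rpow_pos_of_pos hb p).ne'
      rw [sharpPoly, Real.div_rpow ha hb.le, Real.div_rpow ha hb.le, Real.rpow_sub_one hb.ne' p]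
      field_simp
      ring
    rw [hdiv]
    exact div_nonpos_of_nonpos_of_nonneg (sub_nonpos.2 hab) (Real.rpow_nonneg hb.le p)

theorem le_ofReal_rpow_mul_of_sharpPoly_eq_zero {p c : ℝ} (hp : 1 < p) (hc : 0 < c)
    (hc0 : sharpPoly p c = 0) {A F : ℝ≥0∞} (hA : A ≠ ∞) (hF : F ≠ ∞)
    (hAF : ENNReal.ofReal (p - 1) * (A + F) ≤
      ENNReal.ofReal p * (F ^ (1 / p) * A ^ (1 - 1 / p) + F)) :
    A ≤ ENNReal.ofReal c ^ p * F := by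
  have hp0 : 0 < p := one_pos.trans hp
  set a : ℝ := (A ^ (1 / p)).toReal with ha
  set b : ℝ := (F ^ (1 / p)).toReal with hb
  have hroot {x : ℝ≥0∞} (hx : x ≠ ∞) : x = ENNReal.ofReal ((x ^ (1 / p)).toReal ^ p) := by
    rw [ENNReal.toReal_rpow, ← ENNReal.rpow_mul, one_div_mul_cancel hp0.ne', ENNReal.rpow_one,
      ENNReal.ofReal_toReal hx]
  have hA_pow : A ^ (1 - 1 / p) = ENNReal.ofReal (a ^ (p - 1)) := by
    rw [ha, ENNReal.toReal_rpow, ← ENNReal.rpow_mul, ENNReal.ofReal_toReal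
      (ENNReal.rpow_ne_top_of_nonneg (by positivity [sub_pos.2 hp]) hA)]
    congr 1
    field_simp
  have hF_pow : F ^ (1 / p) = ENNReal.ofReal b :=
    (ENNReal.ofReal_toReal (ENNReal.rpow_ne_top_of_nonneg (by positivity) hF)).symm
  have ha0 : 0 ≤ a := ENNReal.toReal_nonneg
  have hb0 : 0 ≤ b := ENNReal.toReal_nonneg
  have hp1 : 0 ≤ p - 1 := (sub_pos.2 hp).le
  rw [hA_pow, hF_pow, hroot hA, hroot hF, ← ha, ← hb, ← ENNReal.ofReal_add (by positivity)
    (by positivity), ← ENNReal.ofReal_mul hp1, ← ENNReal.ofReal_mul hb0, ← ENNReal.ofReal_add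
    (by positivity) (by positivity), ← ENNReal.ofReal_mul hp0.le, ENNReal.ofReal_le_ofReal_iff
    (by positivity)] at hAF
  rw [hroot hA, hroot hF, ENNReal.ofReal_rpow_of_pos hc, ← ENNReal.ofReal_mul (by positivity),
    ← Real.mul_rpow hc.le hb0]
  exact ENNReal.ofReal_le_ofReal (Real.rpow_le_rpow ha0
    (le_mul_of_sharpPoly_eq_zero hp hc hc0 ha0 hb0 hAF) hp0.le)

theorem lintegral_intervalMax_rpow_le {p c : ℝ} (hp : 1 < p) (hc : 0 < c)
    (hc0 : sharpPoly p c = 0) {f : ℝ → ℝ≥0∞} (hf : Measurable f) :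
    ∫⁻ x, intervalMax f x ^ p ≤ ENNReal.ofReal c ^ p * ∫⁻ x, f x ^ p := by
  have hp0 : 0 < p := one_pos.trans hp
  by_cases hfp : ∫⁻ x, f x ^ p = ∞
  · rw [hfp, ENNReal.mul_top ((ENNReal.rpow_pos (ENNReal.ofReal_pos.2 hc)
      ENNReal.ofReal_ne_top).ne')]
    exact le_top
  refine lintegral_familyMax_univ_rpow_le hp0 RatInterval.measurableSet_toSet fun S => ?_
  refine le_ofReal_rpow_mul_of_sharpPoly_eq_zero hp hc hc0
    (lintegral_familyMax_rpow_ne_top hp.le RatInterval.measurableSet_toSet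
      RatInterval.volume_toSet_ne_zero RatInterval.volume_toSet_ne_top hfp S) hfp ?_
  have hmax := lintegral_familyMax_rpow_le_of_covering (μ := volume) (I := RatInterval.toSet) hp
    ENNReal.one_ne_top ENNReal.one_ne_top hf RatInterval.measurableSet_toSet
    RatInterval.volume_toSet_ne_zero RatInterval.volume_toSet_ne_top hfp (fun T t hT => by
      simpa only [one_mul, RatInterval.toSet] using mul_volume_biUnion_Ioo_add_le
        (fun i : RatInterval => (i.1.1 : ℝ)) (fun i => (i.1.2 : ℝ)) hf
        (fun i _ => setLIntegral_ne_top_of_rpow hp.le hfp i.volume_toSet_ne_top) hT) S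
  simpa only [one_mul] using hmax

/-- The open box whose sides are the given rational intervals. -/
def ratBox {n : ℕ} (i : Fin n → RatInterval) : Set (Fin n → ℝ) :=
  Set.univ.pi fun k => (i k).toSet

/-- The maximal function over the boxes with rational vertices. It dominates the strong maximal
function, and unlike it is a supremum over a countable family. -/
abbrev boxMax {n : ℕ} (f : (Fin n → ℝ) → ℝ≥0∞) : (Fin n → ℝ) → ℝ≥0∞ :=
  familyMax volume ratBox Set.univ f

theorem measurableSet_ratBox {n : ℕ} (i : Fin n → RatInterval) : MeasurableSet (ratBox i) :=
  MeasurableSet.univ_pi fun k => (i k).measurableSet_toSet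

theorem volume_ratBox {n : ℕ} (i : Fin n → RatInterval) :
    volume (ratBox i) = ∏ k, volume (i k).toSet := volume_pi_pi _

theorem volume_ratBox_ne_zero {n : ℕ} (i : Fin n → RatInterval) : volume (ratBox i) ≠ 0 := by
  rw [volume_ratBox, Finset.prod_ne_zero_iff]
  exact fun k _ => (i k).volume_toSet_ne_zero

theorem volume_ratBox_ne_top {n : ℕ} (i : Fin n → RatInterval) : volume (ratBox i) ≠ ∞ := by
  rw [volume_ratBox]
  exact ENNReal.prod_ne_top fun k _ => (i k).volume_toSet_ne_top

/-- The identification of `ℝ × ℝⁿ` with `ℝⁿ⁺¹` which puts the real coordinate first. -/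
def consEquiv (n : ℕ) : ℝ × (Fin n → ℝ) ≃ᵐ (Fin (n + 1) → ℝ) :=
  (MeasurableEquiv.piFinSuccAbove (fun _ => ℝ) 0).symm

theorem consEquiv_apply {n : ℕ} (z : ℝ × (Fin n → ℝ)) :
    consEquiv n z = Fin.cons z.1 z.2 := by
  ext k
  cases k using Fin.cases <;> simp [consEquiv, MeasurableEquiv.piFinSuccAbove]

theorem measurePreserving_consEquiv (n : ℕ) : MeasurePreserving (consEquiv n) :=
  (volume_preserving_piFinSuccAbove (fun _ : Fin (n + 1) => ℝ) 0).symm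

attribute [irreducible] consEquiv

theorem consEquiv_preimage_ratBox {n : ℕ} (i : Fin (n + 1) → RatInterval) :
    consEquiv n ⁻¹' ratBox i = (i 0).toSet ×ˢ ratBox (fun k => i k.succ) := by
  ext z
  simp [ratBox, consEquiv_apply, Fin.forall_fin_succ, Set.mem_pi]

/-- The maximal function over rational boxes in the last `n` of `n + 1` variables. -/
def tailBoxMax {n : ℕ} (f : (Fin (n + 1) → ℝ) → ℝ≥0∞) (z : ℝ × (Fin n → ℝ)) : ℝ≥0∞ :=
  boxMax (fun y' => f (consEquiv n (z.1, y'))) z.2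

theorem setLIntegral_ratBox_succ {n : ℕ} (i : Fin (n + 1) → RatInterval)
    {f : (Fin (n + 1) → ℝ) → ℝ≥0∞} (hf : Measurable f) :
    ∫⁻ y in ratBox i, f y =
      ∫⁻ y in (i 0).toSet, ∫⁻ y' in ratBox fun k => i k.succ, f (consEquiv n (y, y')) := by
  rw [← (measurePreserving_consEquiv n).setLIntegral_comp_preimage_emb
    (consEquiv n).measurableEmbedding, consEquiv_preimage_ratBox, Measure.volume_eq_prod,
    setLIntegral_prod]
  exact (hf.comp (consEquiv n).measurable).aemeasurable

theorem famAvg_ratBox_succ {n : ℕ} (i : Fin (n + 1) → RatInterval) {f : (Fin (n + 1) → ℝ) → ℝ≥0∞}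
    (hf : Measurable f) :
    famAvg volume ratBox f i = (volume (i 0).toSet)⁻¹ * ∫⁻ y in (i 0).toSet,
      famAvg volume ratBox (fun y' => f (consEquiv n (y, y'))) fun k => i k.succ := by
  simp only [famAvg]
  rw [setLIntegral_ratBox_succ i hf, volume_ratBox, Fin.prod_univ_succ, ← volume_ratBox,
    lintegral_const_mul' _ _ (ENNReal.inv_ne_top.2 (volume_ratBox_ne_zero _)),
    ENNReal.mul_inv (Or.inl (i 0).volume_toSet_ne_zero) (Or.inl (i 0).volume_toSet_ne_top),
    mul_assoc]

theorem boxMax_consEquiv_le {n : ℕ} {f : (Fin (n + 1) → ℝ) → ℝ≥0∞} (hf : Measurable f)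
    (z : ℝ × (Fin n → ℝ)) :
    boxMax f (consEquiv n z) ≤ intervalMax (fun y => tailBoxMax f (y, z.2)) z.1 := by
  refine iSup₂_le fun i _ => Set.indicator_apply_le' (fun hz => ?_) fun _ => zero_le
  have hz' : z ∈ consEquiv n ⁻¹' ratBox i := hz
  rw [consEquiv_preimage_ratBox] at hz'
  refine le_trans ?_ (le_iSup₂ (i 0) (Set.mem_univ _))
  rw [Set.indicator_of_mem hz'.1, famAvg_ratBox_succ i hf, famAvg]
  gcongr with y
  refine le_trans ?_ (le_iSup₂ (fun k => i k.succ) (Set.mem_univ _))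
  rw [Set.indicator_of_mem hz'.2]

theorem measurable_tailBoxMax {n : ℕ} {f : (Fin (n + 1) → ℝ) → ℝ≥0∞} (hf : Measurable f) :
    Measurable (tailBoxMax f) := by
  refine Measurable.biSup _ (Set.to_countable _) fun i _ => ?_
  have havg : Measurable fun y : ℝ => famAvg volume ratBox (fun y' => f (consEquiv n (y, y'))) i :=
    (Measurable.lintegral_prod_right' (f := fun z => f (consEquiv n z))
      (hf.comp (consEquiv n).measurable)).const_mul _
  exact (havg.comp measurable_fst).indicator (measurable_snd (measurableSet_ratBox i))

theorem boxMax_le_of_dim_zero (f : (Fin 0 → ℝ) → ℝ≥0∞) (x : Fin 0 → ℝ) : boxMax f x ≤ f x := by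
  refine iSup₂_le fun i _ => Set.indicator_apply_le' (fun _ => ?_) fun _ => zero_le
  have hvol : (volume : Measure (Fin 0 → ℝ)) = Measure.dirac x := Measure.pi_of_empty _ x
  have hbox : ratBox i = Set.univ := by ext; simp [ratBox]
  rw [famAvg, hbox, hvol]
  simp

theorem lintegral_eq_lintegral_consEquiv {n : ℕ} {g : (Fin (n + 1) → ℝ) → ℝ≥0∞}
    (hg : Measurable g) : ∫⁻ x, g x = ∫⁻ y, ∫⁻ x', g (consEquiv n (y, x')) := by
  have hgcons : Measurable fun z => g (consEquiv n z) := hg.comp (consEquiv n).measurable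
  rw [← (measurePreserving_consEquiv n).lintegral_comp_emb (consEquiv n).measurableEmbedding,
    Measure.volume_eq_prod, lintegral_prod _ hgcons.aemeasurable]

theorem lintegral_boxMax_rpow_succ_le {p : ℝ} (hp : 0 ≤ p) {C D : ℝ≥0∞} {n : ℕ}
    (hC : ∀ {g : ℝ → ℝ≥0∞}, Measurable g → ∫⁻ x, intervalMax g x ^ p ≤ C * ∫⁻ x, g x ^ p)
    (hD : ∀ {g : (Fin n → ℝ) → ℝ≥0∞}, Measurable g →
      ∫⁻ x, boxMax g x ^ p ≤ D * ∫⁻ x, g x ^ p)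
    {f : (Fin (n + 1) → ℝ) → ℝ≥0∞} (hf : Measurable f) :
    ∫⁻ x, boxMax f x ^ p ≤ C * D * ∫⁻ x, f x ^ p := by
  have hbox : Measurable fun x => boxMax f x ^ p :=
    (measurable_familyMax measurableSet_ratBox (Set.to_countable _) f).pow_const p
  have hboxcons : Measurable fun z => boxMax f (consEquiv n z) ^ p :=
    hbox.comp (consEquiv n).measurable
  have htail : Measurable fun z => tailBoxMax f z ^ p := (measurable_tailBoxMax hf).pow_const p
  have hfcons : Measurable fun z => f (consEquiv n z) := hf.comp (consEquiv n).measurable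
  rw [lintegral_eq_lintegral_consEquiv hbox, lintegral_eq_lintegral_consEquiv (hf.pow_const p),
    lintegral_lintegral_swap (f := fun y x' => boxMax f (consEquiv n (y, x')) ^ p)
      hboxcons.aemeasurable]
  calc ∫⁻ x', ∫⁻ x, boxMax f (consEquiv n (x, x')) ^ p
      ≤ ∫⁻ x', C * ∫⁻ y, tailBoxMax f (y, x') ^ p := by
        refine lintegral_mono fun x' => le_trans (lintegral_mono fun x => ?_)
          (hC ((measurable_tailBoxMax hf).comp measurable_prodMk_right))
        exact ENNReal.rpow_le_rpow (boxMax_consEquiv_le hf (x, x')) hp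
    _ = C * ∫⁻ y, ∫⁻ x', tailBoxMax f (y, x') ^ p := by
        rw [lintegral_const_mul _ htail.lintegral_prod_left', lintegral_lintegral_swap
          (f := fun y x' => tailBoxMax f (y, x') ^ p) htail.aemeasurable]
    _ ≤ C * ∫⁻ y, D * ∫⁻ x', f (consEquiv n (y, x')) ^ p := by
        gcongr with y
        exact hD (g := fun x' => f (consEquiv n (y, x'))) (hfcons.comp measurable_prodMk_left)
    _ = C * D * ∫⁻ y, ∫⁻ x', f (consEquiv n (y, x')) ^ p := by
        rw [lintegral_const_mul _ (hfcons.pow_const p).lintegral_prod_right', mul_assoc]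

theorem lintegral_boxMax_rpow_le {p : ℝ} (hp : 0 ≤ p) {C : ℝ≥0∞}
    (hC : ∀ {g : ℝ → ℝ≥0∞}, Measurable g → ∫⁻ x, intervalMax g x ^ p ≤ C * ∫⁻ x, g x ^ p)
    (n : ℕ) {f : (Fin n → ℝ) → ℝ≥0∞} (hf : Measurable f) :
    ∫⁻ x, boxMax f x ^ p ≤ C ^ n * ∫⁻ x, f x ^ p := by
  induction n with
  | zero =>
    rw [pow_zero, one_mul]
    exact lintegral_mono fun x => ENNReal.rpow_le_rpow (boxMax_le_of_dim_zero f x) hp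
  | succ n ih =>
    rw [pow_succ']
    exact lintegral_boxMax_rpow_succ_le hp hC (fun hg => ih hg) hf

theorem setLIntegral_Icc_le_of_rat_enclosure {n : ℕ} {a b x : Fin n → ℝ} {u v : Fin n → ℚ}
    (hu : ∀ i, (u i : ℝ) < a i) (hv : ∀ i, b i < v i) (hx : x ∈ Set.Icc a b)
    (f : (Fin n → ℝ) → ℝ≥0∞) :
    ∫⁻ y in Set.Icc a b, f y ≤ boxMax f x * ∏ i, ENNReal.ofReal ((v i : ℝ) - u i) := by
  have huv (i : Fin n) : u i < v i := by
    exact_mod_cast (hu i).trans_le ((hx.1 i).trans ((hx.2 i).trans (hv i).le))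
  let j : Fin n → RatInterval := fun i => ⟨(u i, v i), huv i⟩
  have hsub : Set.Icc a b ⊆ ratBox j := fun y hy i _ =>
    ⟨(hu i).trans_le (hy.1 i), (hy.2 i).trans_lt (hv i)⟩
  have havg : famAvg volume ratBox f j ≤ boxMax f x := by
    refine le_trans (le_of_eq ?_) (le_iSup₂ j (Set.mem_univ _))
    rw [Set.indicator_of_mem (hsub hx)]
  have hvol : volume (ratBox j) = ∏ i, ENNReal.ofReal ((v i : ℝ) - u i) := by
    simp only [volume_ratBox, RatInterval.volume_toSet, j]
  rw [famAvg, ENNReal.inv_mul_le_iff (volume_ratBox_ne_zero j) (volume_ratBox_ne_top j), hvol,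
    mul_comm] at havg
  exact (lintegral_mono_set hsub).trans havg

theorem strongMaximal_le_boxMax (n : ℕ) (f : (Fin n → ℝ) → ℝ) (x : Fin n → ℝ) :
    strongMaximal n f x ≤ boxMax (fun y => ‖f y‖ₑ) x := by
  refine iSup₂_le fun a b => iSup₂_le fun ha hb => ?_
  choose u _ hu hu_lim using fun i =>
    (Rat.denseRange_cast (𝕜 := ℝ)).exists_seq_strictMono_tendsto Rat.cast_mono (a i)
  choose v _ hv hv_lim using fun i =>
    (Rat.denseRange_cast (𝕜 := ℝ)).exists_seq_strictAnti_tendsto Rat.cast_mono (b i)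
  have hprod0 : ∏ i, ENNReal.ofReal (b i - a i) ≠ 0 :=
    Finset.prod_ne_zero_iff.2 fun i _ =>
      (ENNReal.ofReal_pos.2 (sub_pos.2 ((ha i).trans (hb i)))).ne'
  have hprod_top : ∏ i, ENNReal.ofReal (b i - a i) ≠ ∞ :=
    ENNReal.prod_ne_top fun i _ => ENNReal.ofReal_ne_top
  have hlim : Tendsto (fun k => boxMax (fun y => ‖f y‖ₑ) x *
      ∏ i, ENNReal.ofReal ((v i k : ℝ) - u i k)) atTop
      (𝓝 (boxMax (fun y => ‖f y‖ₑ) x * ∏ i, ENNReal.ofReal (b i - a i))) := by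
    refine ENNReal.Tendsto.const_mul ?_ (Or.inl hprod0)
    exact ENNReal.tendsto_finsetProd_of_ne_top _
      (fun i _ => ENNReal.tendsto_ofReal ((hv_lim i).sub (hu_lim i)))
      fun i _ => ENNReal.ofReal_ne_top
  rw [ENNReal.inv_mul_le_iff hprod0 hprod_top, mul_comm]
  exact ge_of_tendsto' hlim fun k => setLIntegral_Icc_le_of_rat_enclosure (fun i => hu i k)
    (fun i => hv i k) ⟨fun i => (ha i).le, fun i => (hb i).le⟩ _

theorem eLpNorm_ofReal_eq {X ε : Type*} [MeasurableSpace X] {μ : Measure X} [TopologicalSpace ε]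
    [ContinuousENorm ε] {p : ℝ} (hp : 0 < p) (f : X → ε) :
    eLpNorm f (ENNReal.ofReal p) μ = (∫⁻ x, ‖f x‖ₑ ^ p ∂μ) ^ (1 / p) := by
  rw [eLpNorm_eq_lintegral_rpow_enorm_toReal (by simpa using hp) ENNReal.ofReal_ne_top,
    ENNReal.toReal_ofReal hp.le]

theorem opNorm_le_of_familyMax {X : Type*} [MeasureSpace X] {p : ℝ} (hp : 0 < p) {ι : Type*}
    {I : ι → Set X} {T : (X → ℝ) → X → ℝ≥0∞}
    (hT : ∀ f x, T f x ≤ familyMax volume I Set.univ (fun y => ‖f y‖ₑ) x) {C : ℝ≥0∞}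
    (hC : ∀ {g : X → ℝ≥0∞}, Measurable g →
      ∫⁻ x, familyMax volume I Set.univ g x ^ p ≤ C ^ p * ∫⁻ x, g x ^ p) :
    opNorm p T ≤ C := by
  refine sInf_le fun f hf => ?_
  obtain ⟨g, hg, hfg⟩ := hf.1.aemeasurable.enorm
  have havg (i : ι) : famAvg volume I (fun y => ‖f y‖ₑ) i = famAvg volume I g i := by
    rw [famAvg, famAvg, lintegral_congr_ae (ae_restrict_of_ae hfg)]
  have hTg (x : X) : T f x ≤ familyMax volume I Set.univ g x :=
    (hT f x).trans_eq (by simp only [familyMax, havg])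
  have hf_eq : ∫⁻ x, ‖f x‖ₑ ^ p = ∫⁻ x, g x ^ p :=
    lintegral_congr_ae (hfg.mono fun x hx => by simp only [hx])
  rw [eLpNorm_ofReal_eq hp, eLpNorm_ofReal_eq hp, hf_eq]
  calc (∫⁻ x, ‖T f x‖ₑ ^ p) ^ (1 / p) ≤ (C ^ p * ∫⁻ x, g x ^ p) ^ (1 / p) := by
        refine ENNReal.rpow_le_rpow ((lintegral_mono fun x => ?_).trans (hC hg)) (by positivity)
        exact ENNReal.rpow_le_rpow (hTg x) hp.le
    _ = C * (∫⁻ x, g x ^ p) ^ (1 / p) := by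
        rw [ENNReal.mul_rpow_of_nonneg _ _ (by positivity), ← ENNReal.rpow_mul,
          mul_one_div_cancel hp.ne', ENNReal.rpow_one]

theorem opNorm_strongMaximal_le {p c : ℝ} (hp : 1 < p) (hc : 0 < c) (hc0 : sharpPoly p c = 0)
    (n : ℕ) : opNorm p (strongMaximal n) ≤ ENNReal.ofReal (c ^ n) := by
  have hp0 : 0 < p := one_pos.trans hp
  refine opNorm_le_of_familyMax hp0 (strongMaximal_le_boxMax n) fun hg => ?_
  have hpow : ENNReal.ofReal (c ^ n) ^ p = (ENNReal.ofReal c ^ p) ^ n := by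
    rw [ENNReal.ofReal_pow hc.le, ← ENNReal.rpow_natCast, ← ENNReal.rpow_mul, mul_comm (n : ℝ) p,
      ENNReal.rpow_mul, ENNReal.rpow_natCast]
  rw [hpow]
  exact lintegral_boxMax_rpow_le hp0.le (fun hg => lintegral_intervalMax_rpow_le hp hc hc0 hg) n hg

section OpNormLower

variable {X : Type*} [MeasureSpace X] {p : ℝ} {T : (X → ℝ) → X → ℝ≥0∞} {f : X → ℝ}

theorem eLpNorm_div_le_opNorm (hf : MemLp f (ENNReal.ofReal p) volume)
    (h0 : eLpNorm f (ENNReal.ofReal p) volume ≠ 0) :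
    eLpNorm (T f) (ENNReal.ofReal p) volume / eLpNorm f (ENNReal.ofReal p) volume ≤ opNorm p T := by
  refine le_sInf fun C hC => ?_
  rw [ENNReal.div_le_iff h0 hf.2.ne]
  exact hC f hf

theorem le_opNorm_of_pointwise (hp : 0 < p) (hf : MemLp f (ENNReal.ofReal p) volume)
    (h0 : eLpNorm f (ENNReal.ofReal p) volume ≠ 0) {K : ℝ≥0∞} (hK_top : K ≠ ∞)
    (hK : ∀ x, K * ‖f x‖ₑ ≤ T f x) : K ≤ opNorm p T := by
  refine le_trans ?_ (eLpNorm_div_le_opNorm hf h0)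
  rw [ENNReal.le_div_iff_mul_le (Or.inl h0) (Or.inl hf.2.ne), eLpNorm_ofReal_eq hp,
    eLpNorm_ofReal_eq hp]
  calc K * (∫⁻ x, ‖f x‖ₑ ^ p) ^ (1 / p) = (∫⁻ x, (K * ‖f x‖ₑ) ^ p) ^ (1 / p) := by
        simp only [ENNReal.mul_rpow_of_nonneg _ _ hp.le]
        rw [lintegral_const_mul' _ _ (ENNReal.rpow_ne_top_of_nonneg hp.le hK_top),
          ENNReal.mul_rpow_of_nonneg _ _ (by positivity), ← ENNReal.rpow_mul,
          mul_one_div_cancel hp.ne', ENNReal.rpow_one]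
    _ ≤ (∫⁻ x, ‖T f x‖ₑ ^ p) ^ (1 / p) := by
        gcongr with x
        exact hK x

end OpNormLower

theorem lintegral_pi_prod {n : ℕ} {E : Fin n → Type*} [∀ i, MeasurableSpace (E i)]
    {μ : ∀ i, Measure (E i)} [∀ i, SigmaFinite (μ i)] {f : ∀ i, E i → ℝ≥0∞}
    (hf : ∀ i, Measurable (f i)) :
    ∫⁻ x, ∏ i, f i (x i) ∂Measure.pi μ = ∏ i, ∫⁻ t, f i t ∂μ i := by
  induction n with
  | zero => simp
  | succ n ih =>
    have htail : Measurable fun y : ∀ i : Fin n, E i.succ => ∏ i : Fin n, f i.succ (y i) :=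
      Finset.measurable_fun_prod _ fun i _ => (hf i.succ).comp (measurable_pi_apply i)
    have hsplit := (measurePreserving_piFinSuccAbove μ 0).symm
    rw [← hsplit.lintegral_comp_emb (MeasurableEquiv.measurableEmbedding _), Fin.prod_univ_succ,
      ← ih fun i => hf i.succ, ← lintegral_prod_mul (hf 0).aemeasurable htail.aemeasurable]
    refine lintegral_congr fun z => ?_
    rw [Fin.prod_univ_succ]
    rfl

theorem lintegral_Ioc_rpow {α a : ℝ} (hα : 0 < α) (ha : 0 ≤ a) :
    ∫⁻ x in Set.Ioc 0 a, ENNReal.ofReal (|x| ^ (α - 1)) = ENNReal.ofReal (a ^ α / α) := by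
  have hint : IntegrableOn (fun x : ℝ => x ^ (α - 1)) (Set.Ioc 0 a) :=
    (intervalIntegrable_iff_integrableOn_Ioc_of_le ha).1
      (intervalIntegral.intervalIntegrable_rpow' (by linarith))
  calc ∫⁻ x in Set.Ioc 0 a, ENNReal.ofReal (|x| ^ (α - 1))
      = ∫⁻ x in Set.Ioc 0 a, ENNReal.ofReal (x ^ (α - 1)) :=
        setLIntegral_congr_fun measurableSet_Ioc fun x hx => by simp only [abs_of_pos hx.1]
    _ = ENNReal.ofReal (∫ x in (0)..a, x ^ (α - 1)) := by
        rw [intervalIntegral.integral_of_le ha, ofReal_integral_eq_lintegral_ofReal hint]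
        filter_upwards [ae_restrict_mem measurableSet_Ioc] with x hx
        exact Real.rpow_nonneg hx.1.le _
    _ = ENNReal.ofReal (a ^ α / α) := by
        rw [integral_rpow (Or.inl (by linarith))]
        simp [Real.zero_rpow hα.ne']

theorem setLIntegral_Ico_neg (b : ℝ) (g : ℝ → ℝ≥0∞) :
    ∫⁻ x in Set.Ico (-b) 0, g x = ∫⁻ x in Set.Ioc 0 b, g (-x) := by
  rw [← (Measure.measurePreserving_neg (volume : Measure ℝ)).setLIntegral_comp_preimage_emb
    (MeasurableEquiv.neg ℝ).measurableEmbedding]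
  simp

theorem lintegral_Icc_rpow_abs {α a b : ℝ} (hα : 0 < α) (ha : 0 ≤ a) (hb : 0 ≤ b) :
    ∫⁻ x in Set.Icc (-b) a, ENNReal.ofReal (|x| ^ (α - 1)) =
      ENNReal.ofReal ((a ^ α + b ^ α) / α) := by
  have hunion : Set.Icc (-b) a = Set.Ico (-b) 0 ∪ Set.Icc 0 a :=
    (Set.Ico_union_Icc_eq_Icc (neg_nonpos.2 hb) ha).symm
  have hdisj : Disjoint (Set.Ico (-b) 0) (Set.Icc 0 a) :=
    Set.disjoint_left.2 fun x hx hx' => hx.2.not_ge hx'.1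
  rw [hunion, lintegral_union measurableSet_Icc hdisj, setLIntegral_Ico_neg,
    ← setLIntegral_congr Ioc_ae_eq_Icc]
  simp only [abs_neg]
  rw [lintegral_Ioc_rpow hα hb, lintegral_Ioc_rpow hα ha, ← ENNReal.ofReal_add (by positivity)
    (by positivity), ← add_div, add_comm]

/-- The one-dimensional building block `|x| ^ β χ_{[-1, 1]}` of the extremizing functions for the
strong maximal operator. -/
def powFun (β x : ℝ) : ℝ := (Set.Icc (-1) 1).indicator (fun x => |x| ^ β) x

theorem measurable_powFun (β : ℝ) : Measurable (powFun β) :=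
  (measurable_id.abs.pow_const β).indicator measurableSet_Icc

theorem powFun_nonneg (β x : ℝ) : 0 ≤ powFun β x :=
  Set.indicator_nonneg (fun _ _ => Real.rpow_nonneg (abs_nonneg _) _) _

theorem enorm_powFun (β x : ℝ) :
    ‖powFun β x‖ₑ = (Set.Icc (-1) 1).indicator (fun x => ENNReal.ofReal (|x| ^ β)) x := by
  rw [Real.enorm_eq_ofReal (powFun_nonneg β x), powFun]
  by_cases hx : x ∈ Set.Icc (-1 : ℝ) 1
  · simp only [Set.indicator_of_mem hx]
  · simp only [Set.indicator_of_notMem hx, ENNReal.ofReal_zero]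

theorem lintegral_powFun_rpow {β p : ℝ} (hp : 0 < p) (hβ : 0 < β * p + 1) :
    ∫⁻ x, ‖powFun β x‖ₑ ^ p = ENNReal.ofReal (2 / (β * p + 1)) := by
  have hpow (x : ℝ) : ‖powFun β x‖ₑ ^ p = (Set.Icc (-1 : ℝ) 1).indicator
      (fun x => ENNReal.ofReal (|x| ^ (β * p + 1 - 1))) x := by
    rw [enorm_powFun]
    by_cases hx : x ∈ Set.Icc (-1 : ℝ) 1
    · rw [Set.indicator_of_mem hx, Set.indicator_of_mem hx, add_sub_cancel_right,
        Real.rpow_mul (abs_nonneg x), ENNReal.ofReal_rpow_of_nonneg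
        (Real.rpow_nonneg (abs_nonneg x) _) hp.le]
    · rw [Set.indicator_of_notMem hx, Set.indicator_of_notMem hx, ENNReal.zero_rpow_of_pos hp]
  simp_rw [hpow]
  rw [lintegral_indicator measurableSet_Icc, lintegral_Icc_rpow_abs hβ zero_le_one zero_le_one]
  norm_num

theorem le_lintegral_powFun {α u v a b : ℝ} (hα : 0 < α) (hu : 0 ≤ u) (hv : 0 ≤ v) (hu1 : u ≤ 1)
    (hv1 : v ≤ 1) (hav : a ≤ -v) (hub : u ≤ b) :
    ENNReal.ofReal ((u ^ α + v ^ α) / α) ≤ ∫⁻ y in Set.Icc a b, ‖powFun (α - 1) y‖ₑ := by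
  rw [← lintegral_Icc_rpow_abs hα hu hv]
  calc ∫⁻ y in Set.Icc (-v) u, ENNReal.ofReal (|y| ^ (α - 1))
      = ∫⁻ y in Set.Icc (-v) u, ‖powFun (α - 1) y‖ₑ := by
        refine setLIntegral_congr_fun measurableSet_Icc fun y hy => ?_
        rw [enorm_powFun, Set.indicator_of_mem]
        exact ⟨(neg_le_neg hv1).trans hy.1, hy.2.trans hu1⟩
    _ ≤ _ := lintegral_mono_set (Set.Icc_subset_Icc hav hub)

theorem mul_enorm_powFun_le_average {α s t u v a b x : ℝ} (hα : 0 < α) (hs : 0 < s) (ht : 0 < t)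
    (hx : 0 < |x|) (hu : 0 ≤ u) (hv : 0 ≤ v) (hu1 : u ≤ 1) (hv1 : v ≤ 1)
    (huv : u ^ α + v ^ α = |x| ^ α * (1 + s ^ α)) (hav : a ≤ -v) (hub : u ≤ b)
    (hab : b - a = |x| * (t + s)) :
    ENNReal.ofReal ((1 + s ^ α) / (α * (t + s))) * ‖powFun (α - 1) x‖ₑ ≤
      (ENNReal.ofReal (b - a))⁻¹ * ∫⁻ y in Set.Icc a b, ‖powFun (α - 1) y‖ₑ := by
  have hle : ‖powFun (α - 1) x‖ₑ ≤ ENNReal.ofReal (|x| ^ (α - 1)) := by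
    rw [enorm_powFun]
    exact Set.indicator_le_self _ _ x
  calc ENNReal.ofReal ((1 + s ^ α) / (α * (t + s))) * ‖powFun (α - 1) x‖ₑ
      ≤ ENNReal.ofReal ((1 + s ^ α) / (α * (t + s))) * ENNReal.ofReal (|x| ^ (α - 1)) := by gcongr
    _ = (ENNReal.ofReal (b - a))⁻¹ * ENNReal.ofReal ((u ^ α + v ^ α) / α) := by
        rw [huv, hab, ← ENNReal.ofReal_inv_of_pos (by positivity),
          ← ENNReal.ofReal_mul (by positivity), ← ENNReal.ofReal_mul (by positivity),
          Real.rpow_sub_one hx.ne']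
        congr 1
        field_simp
    _ ≤ _ := by
        gcongr
        exact le_lintegral_powFun hα hu hv hu1 hv1 hav hub

theorem exists_mul_enorm_powFun_le_average {α s t x : ℝ} (hα : 0 < α) (hs0 : 0 < s)
    (hs1 : s < 1) (ht : 1 < t) (hx0 : x ≠ 0) (hx1 : |x| ≤ 1) :
    ∃ a b : ℝ, a < x ∧ x < b ∧
      ENNReal.ofReal ((1 + s ^ α) / (α * (t + s))) * ‖powFun (α - 1) x‖ₑ ≤
        (ENNReal.ofReal (b - a))⁻¹ * ∫⁻ y in Set.Icc a b, ‖powFun (α - 1) y‖ₑ := by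
  have ht0 : 0 < t := one_pos.trans ht
  have hr : 0 < |x| := abs_pos.2 hx0
  have hsr : 0 < s * |x| := mul_pos hs0 hr
  have hsr1 : s * |x| ≤ 1 := mul_le_one₀ hs1.le hr.le hx1
  have hsr_pow : (s * |x|) ^ α = s ^ α * |x| ^ α := Real.mul_rpow hs0.le hr.le
  rcases lt_or_gt_of_ne hx0 with hneg | hpos
  · have habs : |x| = -x := abs_of_neg hneg
    refine ⟨t * x, -(s * x), by nlinarith, by nlinarith,
      mul_enorm_powFun_le_average hα hs0 ht0 hr hsr.le hr.le hsr1 hx1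
        (by rw [hsr_pow]; ring) ?_ ?_ ?_⟩ <;> rw [habs] <;> nlinarith
  · have habs : |x| = x := abs_of_pos hpos
    refine ⟨-(s * x), t * x, by nlinarith, by nlinarith,
      mul_enorm_powFun_le_average hα hs0 ht0 hr hr.le hsr.le hx1 hsr1
        (by rw [hsr_pow]; ring) ?_ ?_ ?_⟩ <;> rw [habs] <;> nlinarith

/-- The function `∏ |xᵢ| ^ β χ_{[-1, 1]ⁿ}(x)`, nearly extremal for the strong maximal operator when
`β` is slightly larger than `-1/p`. -/
def powProd (n : ℕ) (β : ℝ) (x : Fin n → ℝ) : ℝ := ∏ i, powFun β (x i)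

theorem measurable_powProd (n : ℕ) (β : ℝ) : Measurable (powProd n β) :=
  Finset.measurable_fun_prod _ fun i _ => (measurable_powFun _).comp (measurable_pi_apply i)

theorem enorm_powProd {n : ℕ} {β : ℝ} (x : Fin n → ℝ) :
    ‖powProd n β x‖ₑ = ∏ i, ‖powFun β (x i)‖ₑ := by
  rw [powProd, Real.enorm_eq_ofReal (Finset.prod_nonneg fun _ _ => powFun_nonneg β _),
    ENNReal.ofReal_prod_of_nonneg fun _ _ => powFun_nonneg β _]
  exact Finset.prod_congr rfl fun _ _ => (Real.enorm_eq_ofReal (powFun_nonneg β _)).symm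

theorem lintegral_powProd_rpow {n : ℕ} {β p : ℝ} (hp : 0 < p) (hβ : 0 < β * p + 1) :
    ∫⁻ x, ‖powProd n β x‖ₑ ^ p = ENNReal.ofReal (2 / (β * p + 1)) ^ n := by
  simp_rw [enorm_powProd, ← ENNReal.prod_rpow_of_nonneg hp.le]
  rw [volume_pi, lintegral_pi_prod fun _ => (measurable_powFun β).enorm.pow_const p]
  simp [lintegral_powFun_rpow hp hβ]

theorem setLIntegral_Icc_powProd {n : ℕ} {β : ℝ} (a b : Fin n → ℝ) :
    ∫⁻ y in Set.Icc a b, ‖powProd n β y‖ₑ =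
      ∏ i, ∫⁻ y in Set.Icc (a i) (b i), ‖powFun β y‖ₑ := by
  simp_rw [← Set.pi_univ_Icc, enorm_powProd]
  rw [volume_pi, Measure.restrict_pi_pi, lintegral_pi_prod fun _ => (measurable_powFun β).enorm]

theorem le_strongMaximal_powProd {n : ℕ} {α s t : ℝ} (hα : 0 < α) (hα1 : α < 1) (hs0 : 0 < s)
    (hs1 : s < 1) (ht : 1 < t) (x : Fin n → ℝ) :
    ENNReal.ofReal ((1 + s ^ α) / (α * (t + s))) ^ n * ‖powProd n (α - 1) x‖ₑ ≤
      strongMaximal n (powProd n (α - 1)) x := by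
  by_cases hx : powProd n (α - 1) x = 0
  · simp [hx]
  have hx_ne (i : Fin n) : powFun (α - 1) (x i) ≠ 0 :=
    Finset.prod_ne_zero_iff.1 hx i (Finset.mem_univ i)
  have hx1 (i : Fin n) : |x i| ≤ 1 :=
    have hmem : x i ∈ Set.Icc (-1 : ℝ) 1 := Set.mem_of_indicator_ne_zero (hx_ne i)
    abs_le.2 hmem
  have hx0 (i : Fin n) : x i ≠ 0 := fun h0 =>
    hx_ne i (by simp [powFun, h0, Real.zero_rpow (sub_neg.2 hα1).ne])
  choose a b ha hb hab using fun i =>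
    exists_mul_enorm_powFun_le_average hα hs0 hs1 ht (hx0 i) (hx1 i)
  calc ENNReal.ofReal ((1 + s ^ α) / (α * (t + s))) ^ n * ‖powProd n (α - 1) x‖ₑ
      = ∏ i, ENNReal.ofReal ((1 + s ^ α) / (α * (t + s))) * ‖powFun (α - 1) (x i)‖ₑ := by
        rw [Finset.prod_mul_distrib, enorm_powProd]
        simp
    _ ≤ ∏ i, (ENNReal.ofReal (b i - a i))⁻¹ *
          ∫⁻ y in Set.Icc (a i) (b i), ‖powFun (α - 1) y‖ₑ :=
        Finset.prod_le_prod' fun i _ => hab i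
    _ = (∏ i, ENNReal.ofReal (b i - a i))⁻¹ *
          ∫⁻ y in Set.Icc a b, ‖powProd n (α - 1) y‖ₑ := by
        rw [setLIntegral_Icc_powProd, Finset.prod_mul_distrib,
          ENNReal.prod_inv_distrib fun _ _ _ _ _ => Or.inr ENNReal.ofReal_ne_top]
    _ ≤ strongMaximal n (powProd n (α - 1)) x := by
        refine le_iSup₂_of_le a b ?_
        exact le_iSup₂_of_le (f := fun _ _ => _) ha hb le_rfl

/- At `α = 1 / p'` and `t = 1` the strict inequality reads `3 / 2 < 1 + (1 / 2) ^ α`; the parameters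
are then moved slightly, to make `powProd` belong to `Lᵖ`. -/
theorem exists_conj_lt_average_constant {p : ℝ} (hp : 1 < p) :
    ∃ α t : ℝ, 0 < α ∧ α < 1 ∧ 1 < t ∧ 0 < (α - 1) * p + 1 ∧
      conj p < (1 + (1 / 2 : ℝ) ^ α) / (α * (t + 1 / 2)) := by
  have hp1 : 0 < p - 1 := sub_pos.2 hp
  have hp0 : 0 < p := one_pos.trans hp
  set q : ℝ := (p - 1) / p with hq
  have hq0 : 0 < q := div_pos hp1 hp0
  have hq1 : q < 1 := (div_lt_one hp0).2 (sub_one_lt p)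
  let F : ℝ → ℝ := fun δ => (1 + (1 / 2 : ℝ) ^ (q + δ)) / ((q + δ) * (1 + δ + 1 / 2))
  have hF_lim : Tendsto F (𝓝[>] 0) (𝓝 (F 0)) := by
    refine ContinuousAt.continuousWithinAt (ContinuousAt.div ?_ (by fun_prop) (by positivity))
    exact continuousAt_const.add
      (continuousAt_const.rpow (by fun_prop) (Or.inl (by norm_num)))
  have hF0 : conj p < F 0 := by
    have hhalf : (1 / 2 : ℝ) < (1 / 2 : ℝ) ^ q := by
      simpa using Real.rpow_lt_rpow_of_exponent_gt (x := (1 / 2 : ℝ)) (by norm_num) (by norm_num)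
        hq1
    have hconj : conj p = 1 / q := by rw [hq, one_div_div, conj]
    simp only [F]
    rw [hconj, add_zero, add_zero, div_lt_div_iff₀ hq0 (by positivity)]
    nlinarith
  have hsmall : ∀ᶠ δ : ℝ in 𝓝[>] 0, δ < 1 - q :=
    (eventually_lt_nhds (sub_pos.2 hq1)).filter_mono nhdsWithin_le_nhds
  obtain ⟨δ, hFδ, hδ1, hδ0⟩ :=
    ((hF_lim.eventually_const_lt hF0).and (hsmall.and self_mem_nhdsWithin)).exists
  have hδ0 : 0 < δ := hδ0
  have hexp : (q + δ - 1) * p + 1 = δ * p := by rw [hq]; field_simp; ring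
  exact ⟨q + δ, 1 + δ, by linarith, by linarith, by linarith, hexp ▸ mul_pos hδ0 hp0, hFδ⟩

theorem lt_opNorm_strongMaximal {p : ℝ} (hp : 1 < p) {n : ℕ} (hn : n ≠ 0) :
    ENNReal.ofReal (conj p ^ n) < opNorm p (strongMaximal n) := by
  obtain ⟨α, t, hα, hα1, ht, hβ, hlt⟩ := exists_conj_lt_average_constant hp
  have hp0 : 0 < p := one_pos.trans hp
  have hpos : 0 < ENNReal.ofReal (2 / ((α - 1) * p + 1)) ^ n :=
    ENNReal.pow_pos (ENNReal.ofReal_pos.2 (by positivity)) n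
  have hnorm : eLpNorm (powProd n (α - 1)) (ENNReal.ofReal p) volume =
      (ENNReal.ofReal (2 / ((α - 1) * p + 1)) ^ n) ^ (1 / p) := by
    rw [eLpNorm_ofReal_eq hp0, lintegral_powProd_rpow hp0 hβ]
  have hmem : MemLp (powProd n (α - 1)) (ENNReal.ofReal p) volume := by
    refine ⟨(measurable_powProd n _).aestronglyMeasurable, ?_⟩
    rw [hnorm]
    exact ENNReal.rpow_lt_top_of_nonneg (by positivity) (by finiteness)
  have hne : eLpNorm (powProd n (α - 1)) (ENNReal.ofReal p) volume ≠ 0 := by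
    rw [hnorm]
    exact (ENNReal.rpow_pos hpos (by finiteness)).ne'
  rw [ENNReal.ofReal_pow (conj_pos hp).le]
  calc ENNReal.ofReal (conj p) ^ n
      < ENNReal.ofReal ((1 + (1 / 2 : ℝ) ^ α) / (α * (t + 1 / 2))) ^ n :=
        ENNReal.pow_lt_pow_left hn
          ((ENNReal.ofReal_lt_ofReal_iff ((conj_pos hp).trans hlt)).2 hlt)
    _ ≤ opNorm p (strongMaximal n) := le_opNorm_of_pointwise hp0 hmem hne (by finiteness)
        (le_strongMaximal_powProd hα hα1 one_half_pos one_half_lt_one ht)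

/-! ### Maximal functions over balls: the upper bound -/

section BallUpper

variable {E : Type*} [NormedAddCommGroup E] [NormedSpace ℝ E] [FiniteDimensional ℝ E]
  [MeasurableSpace E] {μ : Measure E} [μ.IsAddHaarMeasure]

/-- The closed balls with centers in a dense sequence and positive rational radii: a countable
family that suffices for the uncentered maximal function. -/
def ratBall (E : Type*) [NormedAddCommGroup E] [NormedSpace ℝ E] [FiniteDimensional ℝ E]
    (i : ℕ × {q : ℚ // 0 < q}) : Set E :=
  Metric.closedBall (TopologicalSpace.denseSeq E i.1) i.2.1

theorem ratBall_radius_pos (i : ℕ × {q : ℚ // 0 < q}) : (0 : ℝ) < i.2.1 := by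
  exact_mod_cast i.2.2

theorem measure_ratBall_ne_zero (i : ℕ × {q : ℚ // 0 < q}) : μ (ratBall E i) ≠ 0 :=
  (Metric.measure_closedBall_pos μ _ (ratBall_radius_pos i)).ne'

theorem measure_ratBall_ne_top (i : ℕ × {q : ℚ // 0 < q}) : μ (ratBall E i) ≠ ∞ :=
  measure_closedBall_lt_top.ne

variable [BorelSpace E]

theorem measurableSet_ratBall (i : ℕ × {q : ℚ // 0 < q}) : MeasurableSet (ratBall E i) :=
  Metric.isClosed_closedBall.measurableSet

theorem measure_closedBall_mul_eq (z : E) {a r : ℝ} (ha : 0 ≤ a) (hr : 0 ≤ r) :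
    μ (Metric.closedBall z (a * r)) =
      ENNReal.ofReal a ^ Module.finrank ℝ E * μ (Metric.closedBall z r) := by
  rw [Measure.addHaar_closedBall_mul _ _ ha hr, Measure.addHaar_closedBall_center _ z r,
    ENNReal.ofReal_pow ha]

theorem mul_measure_biUnion_closedBall_le {ι : Type*} {c : ι → E} {r : ι → ℝ} {T : Finset ι}
    {f : E → ℝ≥0∞} {t : ℝ≥0∞} (hr : ∀ i ∈ T, 0 ≤ r i)
    (hT : ∀ i ∈ T, t * μ (Metric.closedBall (c i) (r i)) ≤
      ∫⁻ y in Metric.closedBall (c i) (r i), f y ∂μ) :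
    t * μ (⋃ i ∈ T, Metric.closedBall (c i) (r i)) ≤
      5 ^ Module.finrank ℝ E * ∫⁻ x in ⋃ i ∈ T, Metric.closedBall (c i) (r i), f x ∂μ := by
  obtain ⟨u, huT, hdisj, hcov⟩ := Vitali.exists_disjoint_subfamily_covering_enlargement_closedBall
    (T : Set ι) c r (∑ i ∈ T, r i) (fun i hi => Finset.single_le_sum hr hi) 5 (by norm_num)
  obtain ⟨u, rfl⟩ := (T.finite_toSet.subset huT).exists_finset_coe
  replace huT : u ⊆ T := Finset.coe_subset.1 huT
  have hsub : ⋃ i ∈ T, Metric.closedBall (c i) (r i) ⊆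
      ⋃ i ∈ u, Metric.closedBall (c i) (5 * r i) := by
    refine Set.iUnion₂_subset fun i hi => ?_
    obtain ⟨j, hj, hij⟩ := hcov i hi
    exact hij.trans (Set.subset_biUnion_of_mem
      (u := fun i => Metric.closedBall (c i) (5 * r i)) hj)
  calc t * μ (⋃ i ∈ T, Metric.closedBall (c i) (r i))
      ≤ t * ∑ i ∈ u, μ (Metric.closedBall (c i) (5 * r i)) := by
        gcongr
        exact (measure_mono hsub).trans (measure_biUnion_finset_le _ _)
    _ = 5 ^ Module.finrank ℝ E * ∑ i ∈ u, t * μ (Metric.closedBall (c i) (r i)) := by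
        rw [Finset.sum_congr rfl fun i hi =>
          measure_closedBall_mul_eq (c i) (by norm_num : (0 : ℝ) ≤ 5) (hr i (huT hi)),
          ← Finset.mul_sum, ← Finset.mul_sum, ENNReal.ofReal_ofNat, mul_left_comm]
    _ ≤ 5 ^ Module.finrank ℝ E * ∑ i ∈ u, ∫⁻ y in Metric.closedBall (c i) (r i), f y ∂μ := by
        gcongr with i hi
        exact hT i (huT hi)
    _ = 5 ^ Module.finrank ℝ E * ∫⁻ y in ⋃ i ∈ u, Metric.closedBall (c i) (r i), f y ∂μ := by
        rw [lintegral_biUnion_finset (t := fun i => Metric.closedBall (c i) (r i)) hdisj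
          fun i _ => Metric.isClosed_closedBall.measurableSet]
    _ ≤ 5 ^ Module.finrank ℝ E * ∫⁻ x in ⋃ i ∈ T, Metric.closedBall (c i) (r i), f x ∂μ := by
        exact mul_le_mul_right (lintegral_mono_set (Set.biUnion_subset_biUnion_left huT)) _

theorem setLIntegral_closedBall_le_of_rat_radius {x z : E} {r : ℝ} {q : ℚ} (hr : 0 ≤ r)
    (hrq : r < q) (hx : x ∈ Metric.closedBall z r) (f : E → ℝ≥0∞) :
    ∫⁻ y in Metric.closedBall z r, f y ∂μ ≤
      familyMax μ (ratBall E) Set.univ f x * μ (Metric.closedBall z q) := by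
  obtain ⟨m, hm⟩ := (TopologicalSpace.denseRange_denseSeq E).exists_dist_lt z (sub_pos.2 hrq)
  let j : ℕ × {q : ℚ // 0 < q} := (m, ⟨q, by exact_mod_cast hr.trans_lt hrq⟩)
  have hsub : Metric.closedBall z r ⊆ ratBall E j :=
    Metric.closedBall_subset_closedBall' (by simp only [j]; linarith)
  have havg : famAvg μ (ratBall E) f j ≤ familyMax μ (ratBall E) Set.univ f x := by
    refine le_trans (le_of_eq ?_) (le_iSup₂ j (Set.mem_univ _))
    rw [Set.indicator_of_mem (hsub hx)]
  have hvol : μ (ratBall E j) = μ (Metric.closedBall z q) := by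
    rw [ratBall, Measure.addHaar_closedBall_center, Measure.addHaar_closedBall_center _ z]
  rw [famAvg, ENNReal.inv_mul_le_iff (measure_ratBall_ne_zero j) (measure_ratBall_ne_top j), hvol,
    mul_comm] at havg
  exact (lintegral_mono_set hsub).trans havg

theorem ballMaximal_le_familyMax (n : ℕ) (f : EuclideanSpace ℝ (Fin n) → ℝ)
    (x : EuclideanSpace ℝ (Fin n)) :
    ballMaximal n f x ≤ familyMax volume (ratBall _) Set.univ (fun y => ‖f y‖ₑ) x := by
  refine iSup₂_le fun z r => iSup₂_le fun hr hx => ?_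
  obtain ⟨q, _, hq, hq_lim⟩ :=
    (Rat.denseRange_cast (𝕜 := ℝ)).exists_seq_strictAnti_tendsto Rat.cast_mono r
  have hball0 : volume (Metric.closedBall z r) ≠ 0 :=
    (Metric.measure_closedBall_pos volume z hr).ne'
  have hvol (s : ℝ) (hs : 0 < s) : volume (Metric.closedBall z s) =
      ENNReal.ofReal (s ^ n) * volume (Metric.ball (0 : EuclideanSpace ℝ (Fin n)) 1) := by
    rw [Measure.addHaar_closedBall _ _ hs.le, finrank_euclideanSpace_fin]
  have hvol_lim : Tendsto (fun k => volume (Metric.closedBall z (q k : ℝ))) atTop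
      (𝓝 (volume (Metric.closedBall z r))) := by
    rw [hvol r hr, funext fun k => hvol (q k) (hr.trans (hq k))]
    exact ENNReal.Tendsto.mul_const (ENNReal.tendsto_ofReal (hq_lim.pow n))
      (Or.inr measure_ball_lt_top.ne)
  rw [ENNReal.inv_mul_le_iff hball0 measure_closedBall_lt_top.ne, mul_comm]
  exact ge_of_tendsto' (ENNReal.Tendsto.const_mul hvol_lim (Or.inl hball0)) fun k =>
    setLIntegral_closedBall_le_of_rat_radius hr.le (hq k) hx _

/- Divide by `A ^ (1 - 1 / p)`, which is why `A` has to be finite. -/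
theorem le_rpow_mul_of_mul_le_mul_rpow {p : ℝ} (hp : 1 < p) {A F K : ℝ≥0∞} (hA : A ≠ ∞)
    (h : ENNReal.ofReal (p - 1) * A ≤
      ENNReal.ofReal p * (K * (F ^ (1 / p) * A ^ (1 - 1 / p)))) :
    A ≤ (ENNReal.ofReal (conj p) * K) ^ p * F := by
  have hp0 : 0 < p := one_pos.trans hp
  have hp1 : 0 < p - 1 := sub_pos.2 hp
  rcases eq_or_ne A 0 with rfl | hA0
  · exact zero_le
  have hB0 : A ^ (1 - 1 / p) ≠ 0 := by
    rw [ne_eq, ENNReal.rpow_eq_zero_iff]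
    tauto
  have hB_top : A ^ (1 - 1 / p) ≠ ∞ :=
    ENNReal.rpow_ne_top_of_nonneg (sub_nonneg.2 ((div_le_one hp0).2 hp.le)) hA
  have hA_split : A = A ^ (1 / p) * A ^ (1 - 1 / p) := by
    rw [← ENNReal.rpow_add _ _ hA0 hA, add_sub_cancel, ENNReal.rpow_one]
  have hp_split : ENNReal.ofReal p = ENNReal.ofReal (p - 1) * ENNReal.ofReal (conj p) := by
    rw [← ENNReal.ofReal_mul hp1.le, conj, mul_div_cancel₀ _ hp1.ne']
  have hroot : A ^ (1 / p) ≤ ENNReal.ofReal (conj p) * K * F ^ (1 / p) := by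
    rw [← ENNReal.mul_le_mul_iff_left hB0 hB_top, ← hA_split,
      ← ENNReal.mul_le_mul_iff_right (ENNReal.ofReal_pos.2 hp1).ne' ENNReal.ofReal_ne_top]
    refine h.trans_eq ?_
    rw [hp_split]
    ring
  calc A = (A ^ (1 / p)) ^ p := by rw [one_div, ENNReal.rpow_inv_rpow hp0.ne']
    _ ≤ (ENNReal.ofReal (conj p) * K * F ^ (1 / p)) ^ p := ENNReal.rpow_le_rpow hroot hp0.le
    _ = (ENNReal.ofReal (conj p) * K) ^ p * F := by
        rw [ENNReal.mul_rpow_of_nonneg _ _ hp0.le, one_div, ENNReal.rpow_inv_rpow hp0.ne']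

theorem lintegral_familyMax_ratBall_rpow_le {p : ℝ} (hp : 1 < p) {f : E → ℝ≥0∞}
    (hf : Measurable f) :
    ∫⁻ x, familyMax μ (ratBall E) Set.univ f x ^ p ∂μ ≤
      (ENNReal.ofReal (conj p) * 5 ^ Module.finrank ℝ E) ^ p * ∫⁻ x, f x ^ p ∂μ := by
  have hp0 : 0 < p := one_pos.trans hp
  by_cases hF : ∫⁻ x, f x ^ p ∂μ = ∞
  · have hC : (ENNReal.ofReal (conj p) * 5 ^ Module.finrank ℝ E) ^ p ≠ 0 := by
      rw [ne_eq, ENNReal.rpow_eq_zero_iff_of_pos hp0]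
      exact mul_ne_zero (ENNReal.ofReal_pos.2 (conj_pos hp)).ne' (pow_ne_zero _ (by norm_num))
    rw [hF, ENNReal.mul_top hC]
    exact le_top
  refine lintegral_familyMax_univ_rpow_le hp0 measurableSet_ratBall fun S =>
    le_rpow_mul_of_mul_le_mul_rpow hp (lintegral_familyMax_rpow_ne_top hp.le measurableSet_ratBall
      measure_ratBall_ne_zero measure_ratBall_ne_top hF S) ?_
  simpa only [zero_mul, add_zero] using lintegral_familyMax_rpow_le_of_covering hp
    (K := 5 ^ Module.finrank ℝ E) (K' := 0) (by finiteness) ENNReal.zero_ne_top hf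
    measurableSet_ratBall measure_ratBall_ne_zero measure_ratBall_ne_top hF (fun T t hT => by
      simpa only [zero_mul, add_zero, ratBall] using
        mul_measure_biUnion_closedBall_le (fun i _ => (ratBall_radius_pos i).le) hT) S

theorem opNorm_ballMaximal_le {p : ℝ} (hp : 1 < p) (n : ℕ) :
    opNorm p (ballMaximal n) ≤ ENNReal.ofReal (conj p * 5 ^ n) := by
  refine opNorm_le_of_familyMax (one_pos.trans hp) (ballMaximal_le_familyMax n) fun hg => ?_
  have hC : ENNReal.ofReal (conj p * 5 ^ n) =
      ENNReal.ofReal (conj p) * 5 ^ Module.finrank ℝ (EuclideanSpace ℝ (Fin n)) := by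
    rw [ENNReal.ofReal_mul (conj_pos hp).le, ENNReal.ofReal_pow (by norm_num),
      ENNReal.ofReal_ofNat, finrank_euclideanSpace_fin]
  rw [hC]
  exact lintegral_familyMax_ratBall_rpow_le hp hg

end BallUpper

/-! ### Polar coordinates -/

section Polar

variable {E : Type*} [NormedAddCommGroup E] [NormedSpace ℝ E] [MeasurableSpace E] [BorelSpace E]
  [FiniteDimensional ℝ E] [Nontrivial E] (μ : Measure E) [μ.IsAddHaarMeasure]

theorem lintegral_volumeIoiPow (n : ℕ) {g : ℝ → ℝ≥0∞} (hg : Measurable g) :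
    ∫⁻ r : Set.Ioi (0 : ℝ), g r ∂(Measure.volumeIoiPow n) =
      ∫⁻ r in Set.Ioi (0 : ℝ), g r * ENNReal.ofReal (r ^ n) := by
  rw [Measure.volumeIoiPow, lintegral_withDensity_eq_lintegral_mul _ (by fun_prop)
    (g := fun r : Set.Ioi (0 : ℝ) => g r) (hg.comp measurable_subtype_coe)]
  simp only [Pi.mul_apply]
  rw [lintegral_subtype_comap measurableSet_Ioi fun r : ℝ => ENNReal.ofReal (r ^ n) * g r]
  simp_rw [mul_comm]

theorem lintegral_eq_lintegral_polar {F : E → ℝ≥0∞} (hF : Measurable F) :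
    ∫⁻ x, F x ∂μ = ∫⁻ θ : Metric.sphere (0 : E) 1, (∫⁻ r in Set.Ioi (0 : ℝ),
      F (r • (θ : E)) * ENNReal.ofReal (r ^ (Module.finrank ℝ E - 1))) ∂μ.toSphere := by
  have hmeas : Measurable fun z : Metric.sphere (0 : E) 1 × Set.Ioi (0 : ℝ) =>
      F ((z.2 : ℝ) • (z.1 : E)) :=
    hF.comp ((measurable_subtype_coe.comp measurable_snd).smul
      (measurable_subtype_coe.comp measurable_fst))
  calc ∫⁻ x, F x ∂μ = ∫⁻ x : ({0}ᶜ : Set E), F x ∂(μ.comap (↑)) := by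
        rw [lintegral_subtype_comap (measurableSet_singleton _).compl, restrict_compl_singleton]
    _ = ∫⁻ z, F ((z.2 : ℝ) • (z.1 : E))
          ∂(μ.toSphere.prod (Measure.volumeIoiPow (Module.finrank ℝ E - 1))) := by
        rw [← μ.measurePreserving_homeomorphUnitSphereProd.lintegral_comp_emb
          (Homeomorph.measurableEmbedding _)]
        refine lintegral_congr fun x => ?_
        rw [← homeomorphUnitSphereProd_symm_apply_coe, Homeomorph.symm_apply_apply]
    _ = _ := by
        rw [lintegral_prod _ hmeas.aemeasurable]
        exact lintegral_congr fun θ => lintegral_volumeIoiPow _ (g := fun r => F (r • (θ : E)))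
          (hF.comp (measurable_id.smul_const _))

theorem lintegral_fun_norm {g : ℝ → ℝ≥0∞} (hg : Measurable g) :
    ∫⁻ x, g ‖x‖ ∂μ = μ.toSphere Set.univ *
      ∫⁻ r in Set.Ioi (0 : ℝ), g r * ENNReal.ofReal (r ^ (Module.finrank ℝ E - 1)) := by
  rw [lintegral_eq_lintegral_polar μ (F := fun x => g ‖x‖) (hg.comp measurable_norm), mul_comm,
    ← lintegral_const]
  refine lintegral_congr fun θ => setLIntegral_congr_fun measurableSet_Ioi fun r hr => ?_
  simp only [norm_smul, norm_eq_of_mem_sphere, mul_one, Real.norm_of_nonneg (Set.mem_Ioi.1 hr).le]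

end Polar

/-! ### The average of a power of the norm over a ball through the origin -/

section HalfBall

theorem lintegral_Ioi_rpow_mul_exp {q : ℝ} (hq : -1 < q) :
    ∫⁻ r in Set.Ioi (0 : ℝ), ENNReal.ofReal (r ^ q * Real.exp (-r ^ 2)) =
      ENNReal.ofReal (1 / 2 * Real.Gamma ((q + 1) / 2)) := by
  have hval := integral_rpow_mul_exp_neg_rpow (p := 2) (by norm_num) hq
  have hint := integrableOn_rpow_mul_exp_neg_rpow hq (p := 2) (by norm_num)
  simp only [Real.rpow_two] at hval hint
  rw [← hval, ofReal_integral_eq_lintegral_ofReal hint]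
  filter_upwards [ae_restrict_mem measurableSet_Ioi] with r hr
  have hr : 0 < r := hr
  positivity

theorem lintegral_posPart_rpow_mul_exp {a : ℝ} (ha : 0 < a) :
    ∫⁻ t : ℝ, ENNReal.ofReal (max t 0 ^ a * Real.exp (-t ^ 2)) =
      ENNReal.ofReal (1 / 2 * Real.Gamma ((a + 1) / 2)) := by
  rw [← lintegral_Ioi_rpow_mul_exp (by linarith), ← lintegral_indicator measurableSet_Ioi]
  refine lintegral_congr fun t => ?_
  by_cases ht : 0 < t
  · rw [Set.indicator_of_mem (Set.mem_Ioi.2 ht), max_eq_left ht.le]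
  · rw [Set.indicator_of_notMem (by exact ht), max_eq_right (not_lt.1 ht), Real.zero_rpow ha.ne',
      zero_mul, ENNReal.ofReal_zero]

theorem lintegral_exp_neg_sq :
    ∫⁻ t : ℝ, ENNReal.ofReal (Real.exp (-t ^ 2)) = ENNReal.ofReal √Real.pi := by
  have hval := integral_gaussian 1
  have hint := integrable_exp_neg_mul_sq one_pos
  simp only [neg_mul, one_mul, div_one] at hval hint
  rw [← hval, ofReal_integral_eq_lintegral_ofReal hint]
  exact Eventually.of_forall fun t => (Real.exp_pos _).le

theorem lintegral_euclideanSpace_prod {n : ℕ} {f : Fin n → ℝ → ℝ≥0∞}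
    (hf : ∀ i, Measurable (f i)) :
    ∫⁻ y : EuclideanSpace ℝ (Fin n), ∏ i, f i (y i) = ∏ i, ∫⁻ t, f i t := by
  rw [← lintegral_pi_prod hf, ← volume_pi]
  exact (PiLp.volume_preserving_ofLp (Fin n)).lintegral_comp_emb
    (MeasurableEquiv.toLp 2 (Fin n → ℝ)).symm.measurableEmbedding fun z => ∏ i, f i (z i)

theorem exp_neg_norm_sq_eq_prod {n : ℕ} (y : EuclideanSpace ℝ (Fin n)) :
    Real.exp (-‖y‖ ^ 2) = ∏ i, Real.exp (-y i ^ 2) := by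
  rw [← Real.exp_sum, EuclideanSpace.norm_sq_eq, Finset.sum_neg_distrib]
  simp only [Real.norm_eq_abs, sq_abs]

variable {m : ℕ}

theorem lintegral_coord_posPart_rpow_mul_exp {a : ℝ} (ha : 0 < a) :
    ∫⁻ y : EuclideanSpace ℝ (Fin (m + 1)),
      ENNReal.ofReal (max (y 0) 0 ^ a * Real.exp (-‖y‖ ^ 2)) =
      ENNReal.ofReal (1 / 2 * Real.Gamma ((a + 1) / 2)) * ENNReal.ofReal √Real.pi ^ m := by
  let f : Fin (m + 1) → ℝ → ℝ≥0∞ := Fin.cons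
    (fun t => ENNReal.ofReal (max t 0 ^ a * Real.exp (-t ^ 2)))
    (fun _ t => ENNReal.ofReal (Real.exp (-t ^ 2)))
  have hf (i : Fin (m + 1)) : Measurable (f i) := by
    refine Fin.cases ?_ (fun j => ?_) i
    · simp only [f, Fin.cons_zero]
      fun_prop
    · simp only [f, Fin.cons_succ]
      fun_prop
  have hprod (y : EuclideanSpace ℝ (Fin (m + 1))) :
      ENNReal.ofReal (max (y 0) 0 ^ a * Real.exp (-‖y‖ ^ 2)) = ∏ i, f i (y i) := by
    rw [exp_neg_norm_sq_eq_prod, Fin.prod_univ_succ, Fin.prod_univ_succ, ← mul_assoc,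
      ENNReal.ofReal_mul (by positivity),
      ENNReal.ofReal_prod_of_nonneg fun i _ => (Real.exp_pos _).le]
    simp only [f, Fin.cons_zero, Fin.cons_succ]
  simp_rw [hprod, lintegral_euclideanSpace_prod hf, Fin.prod_univ_succ, f, Fin.cons_zero,
    Fin.cons_succ, lintegral_posPart_rpow_mul_exp ha, lintegral_exp_neg_sq, Finset.prod_const,
    Finset.card_univ, Fintype.card_fin]

theorem lintegral_ray_posPart_rpow_mul_exp {a : ℝ} (ha : 0 < a)
    (θ : Metric.sphere (0 : EuclideanSpace ℝ (Fin (m + 1))) 1) :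
    ∫⁻ r in Set.Ioi (0 : ℝ), ENNReal.ofReal
        (max ((r • (θ : EuclideanSpace ℝ (Fin (m + 1)))) 0) 0 ^ a *
          Real.exp (-‖r • (θ : EuclideanSpace ℝ (Fin (m + 1)))‖ ^ 2)) * ENNReal.ofReal (r ^ m) =
      ENNReal.ofReal (max ((θ : EuclideanSpace ℝ (Fin (m + 1))) 0) 0 ^ a) *
        ENNReal.ofReal (1 / 2 * Real.Gamma ((a + (m + 1)) / 2)) := by
  have hq : -1 < a + m := by
    have : (0 : ℝ) ≤ m := m.cast_nonneg
    linarith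
  rw [← add_assoc, ← lintegral_Ioi_rpow_mul_exp hq,
    ← lintegral_const_mul' _ _ ENNReal.ofReal_ne_top]
  refine setLIntegral_congr_fun measurableSet_Ioi fun r hr => ?_
  have hr : 0 < r := hr
  simp only [norm_smul, norm_eq_of_mem_sphere, mul_one, Real.norm_of_nonneg hr.le, PiLp.smul_apply,
    smul_eq_mul]
  have hmax : max (r * (θ : EuclideanSpace ℝ (Fin (m + 1))) 0) 0 =
      r * max ((θ : EuclideanSpace ℝ (Fin (m + 1))) 0) 0 := by
    rw [mul_max_of_nonneg _ _ hr.le, mul_zero]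
  rw [← ENNReal.ofReal_mul (by positivity), ← ENNReal.ofReal_mul (by positivity), hmax,
    Real.mul_rpow hr.le (le_max_right _ _), Real.rpow_add hr, Real.rpow_natCast]
  congr 1
  ring

/- Integrate `max (y 0) 0 ^ a * exp (-‖y‖ ^ 2)` in Cartesian and in polar coordinates. -/
theorem lintegral_sphere_posPart_rpow {a : ℝ} (ha : 0 < a) :
    ∫⁻ θ : Metric.sphere (0 : EuclideanSpace ℝ (Fin (m + 1))) 1,
      ENNReal.ofReal (max ((θ : EuclideanSpace ℝ (Fin (m + 1))) 0) 0 ^ a)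
        ∂(volume : Measure (EuclideanSpace ℝ (Fin (m + 1)))).toSphere =
      ENNReal.ofReal (√Real.pi ^ m * Real.Gamma ((a + 1) / 2) /
        Real.Gamma ((a + (m + 1)) / 2)) := by
  have _ : 0 < Real.Gamma ((a + (m + 1)) / 2) := Real.Gamma_pos_of_pos (by positivity)
  have _ : 0 < Real.Gamma ((a + 1) / 2) := Real.Gamma_pos_of_pos (by positivity)
  have hmeas : Measurable fun y : EuclideanSpace ℝ (Fin (m + 1)) =>
      ENNReal.ofReal (max (y 0) 0 ^ a * Real.exp (-‖y‖ ^ 2)) := by fun_prop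
  have hpolar := lintegral_eq_lintegral_polar volume hmeas
  simp_rw [finrank_euclideanSpace_fin, Nat.add_sub_cancel,
    lintegral_ray_posPart_rpow_mul_exp ha] at hpolar
  rw [lintegral_coord_posPart_rpow_mul_exp ha,
    lintegral_mul_const' _ _ ENNReal.ofReal_ne_top] at hpolar
  have hne : ENNReal.ofReal (1 / 2 * Real.Gamma ((a + (m + 1)) / 2)) ≠ 0 :=
    (ENNReal.ofReal_pos.2 (by positivity)).ne'
  rw [← ENNReal.mul_left_inj hne ENNReal.ofReal_ne_top, ← hpolar,
    ← ENNReal.ofReal_pow (by positivity), ← ENNReal.ofReal_mul (by positivity),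
    ← ENNReal.ofReal_mul (by positivity)]
  congr 1
  field_simp

/- In polar coordinates around one of its points, a ball of radius `1 / 2` is `r ≤ ⟪θ, e⟫`
(Thales). -/
theorem smul_mem_closedBall_half_iff {E : Type*} [NormedAddCommGroup E] [InnerProductSpace ℝ E]
    {e θ : E} (he : ‖e‖ = 1) (hθ : ‖θ‖ = 1) {r : ℝ} (hr : 0 < r) :
    r • θ ∈ Metric.closedBall ((1 / 2 : ℝ) • e) (1 / 2) ↔ r ≤ max (inner ℝ θ e) 0 := by
  have hsq : ‖r • θ - (1 / 2 : ℝ) • e‖ ^ 2 = r * r - r * inner ℝ θ e + (1 / 2) ^ 2 := by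
    rw [norm_sub_sq_real, norm_smul, norm_smul, he, hθ, real_inner_smul_left,
      real_inner_smul_right, Real.norm_of_nonneg hr.le, Real.norm_of_nonneg one_half_pos.le]
    ring
  rw [mem_closedBall_iff_norm, ← pow_le_pow_iff_left₀ (norm_nonneg _) one_half_pos.le two_ne_zero,
    hsq, add_le_iff_nonpos_left, sub_nonpos, mul_le_mul_iff_right₀ hr, le_max_iff,
    or_iff_left hr.not_ge]

/-- The first vector of the standard basis, our base point on the unit sphere. -/
def axis (m : ℕ) : EuclideanSpace ℝ (Fin (m + 1)) := EuclideanSpace.single 0 1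

theorem norm_axis : ‖axis m‖ = 1 := by simp [axis]

theorem inner_axis (y : EuclideanSpace ℝ (Fin (m + 1))) : inner ℝ y (axis m) = y 0 := by
  simp [axis, EuclideanSpace.inner_single_right]

theorem lintegral_closedBall_half_axis {a : ℝ} (ha : 0 < a) :
    ∫⁻ y in Metric.closedBall ((1 / 2 : ℝ) • axis m) (1 / 2),
      ENNReal.ofReal (‖y‖ ^ (a - (m + 1))) =
      ENNReal.ofReal (1 / a * (√Real.pi ^ m * Real.Gamma ((a + 1) / 2) /
        Real.Gamma ((a + (m + 1)) / 2))) := by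
  have hball := Metric.isClosed_closedBall.measurableSet
    (s := Metric.closedBall ((1 / 2 : ℝ) • axis m) (1 / 2))
  have hmeas : Measurable ((Metric.closedBall ((1 / 2 : ℝ) • axis m) (1 / 2)).indicator
      fun y => ENNReal.ofReal (‖y‖ ^ (a - (m + 1)))) :=
    (measurable_norm.pow_const _).ennreal_ofReal.indicator hball
  rw [← lintegral_indicator hball, lintegral_eq_lintegral_polar _ hmeas,
    ENNReal.ofReal_mul (by positivity), ← lintegral_sphere_posPart_rpow ha,
    ← lintegral_const_mul' _ _ ENNReal.ofReal_ne_top]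
  refine lintegral_congr fun θ => ?_
  set c := max ((θ : EuclideanSpace ℝ (Fin (m + 1))) 0) 0
  have hc0 : 0 ≤ c := le_max_right _ _
  have hmem {r : ℝ} (hr : 0 < r) : r • (θ : EuclideanSpace ℝ (Fin (m + 1))) ∈
      Metric.closedBall ((1 / 2 : ℝ) • axis m) (1 / 2) ↔ r ≤ c := by
    rw [smul_mem_closedBall_half_iff norm_axis (norm_eq_of_mem_sphere θ) hr, inner_axis]
  rw [← ENNReal.ofReal_mul (by positivity), one_div_mul_eq_div, ← lintegral_Ioc_rpow ha hc0,
    ← Set.inter_eq_left.2 (Set.Ioc_subset_Ioi_self : Set.Ioc 0 c ⊆ Set.Ioi 0),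
    ← setLIntegral_indicator measurableSet_Ioc]
  refine setLIntegral_congr_fun measurableSet_Ioi fun r hr => ?_
  have hr : 0 < r := hr
  by_cases hrc : r ≤ c
  · rw [Set.indicator_of_mem ((hmem hr).2 hrc), Set.indicator_of_mem (Set.mem_Ioc.2 ⟨hr, hrc⟩),
      finrank_euclideanSpace_fin, Nat.add_sub_cancel, norm_smul, norm_eq_of_mem_sphere, mul_one,
      Real.norm_of_nonneg hr.le, ← ENNReal.ofReal_mul (by positivity), abs_of_pos hr,
      ← Real.rpow_natCast, ← Real.rpow_add hr]
    congr 2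
    ring
  · rw [Set.indicator_of_notMem (mt (hmem hr).1 hrc),
      Set.indicator_of_notMem (fun h : r ∈ Set.Ioc 0 c => hrc h.2), zero_mul]

theorem average_closedBall_half_axis {p : ℝ} (hp : 1 < p) (hm : 1 ≤ m) :
    (volume (Metric.closedBall ((1 / 2 : ℝ) • axis m) (1 / 2)))⁻¹ *
      ∫⁻ y in Metric.closedBall ((1 / 2 : ℝ) • axis m) (1 / 2),
        ENNReal.ofReal (‖y‖ ^ (-(((m + 1 : ℕ) : ℝ) / p))) =
      ENNReal.ofReal (betaBound p (m + 1)) := by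
  have hc := conj_pos hp
  have ha : 0 < ((m : ℝ) + 1) / conj p := by positivity
  have hexp : -(((m + 1 : ℕ) : ℝ) / p) = ((m : ℝ) + 1) / conj p - (m + 1) := by
    rw [neg_div_eq_div_conj_sub (one_pos.trans hp).ne', Nat.cast_add_one]
  have _ : 0 < Real.Gamma (((m : ℝ) + 1) / 2) := Real.Gamma_pos_of_pos (by positivity)
  have _ : 0 < Real.Gamma ((((m : ℝ) + 1) / conj p + 1) / 2) :=
    Real.Gamma_pos_of_pos (by positivity)
  have _ : 0 < Real.Gamma ((((m : ℝ) + 1) / conj p + (m + 1)) / 2) :=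
    Real.Gamma_pos_of_pos (by positivity)
  have harg_num : ((m : ℝ) + 1) / 2 * (1 / conj p) + 1 / 2 =
      (((m : ℝ) + 1) / conj p + 1) / 2 := by field_simp
  have harg_den : ((m : ℝ) + 1) / 2 * (1 / conj p + 1) =
      (((m : ℝ) + 1) / conj p + (m + 1)) / 2 := by field_simp
  rw [hexp, lintegral_closedBall_half_axis ha, EuclideanSpace.volume_closedBall, Fintype.card_fin,
    betaBound_eq_Gamma hp (by omega)]
  push_cast
  rw [Real.Gamma_add_one (by positivity), ← ENNReal.ofReal_pow (by positivity),
    ← ENNReal.ofReal_mul (by positivity), ← ENNReal.ofReal_inv_of_pos (by positivity),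
    ← ENNReal.ofReal_mul (by positivity), harg_num, harg_den, pow_succ √Real.pi,
    pow_succ (1 / 2 : ℝ), one_div_pow]
  congr 1
  have _ : 0 < √Real.pi := Real.sqrt_pos.2 Real.pi_pos
  field_simp

end HalfBall

/-! ### Symmetries of the maximal function over balls -/

section Symmetry

variable {n : ℕ}

theorem le_ballMaximal (f : EuclideanSpace ℝ (Fin n) → ℝ) {x z : EuclideanSpace ℝ (Fin n)} {r : ℝ}
    (hr : 0 < r) (hx : x ∈ Metric.closedBall z r) :
    (volume (Metric.closedBall z r))⁻¹ * ∫⁻ y in Metric.closedBall z r, ‖f y‖ₑ ≤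
      ballMaximal n f x :=
  le_iSup₂_of_le z r (le_iSup₂_of_le hr hx le_rfl)

theorem ballMaximal_mono {f g : EuclideanSpace ℝ (Fin n) → ℝ} (h : ∀ y, ‖f y‖ₑ ≤ ‖g y‖ₑ)
    (x : EuclideanSpace ℝ (Fin n)) : ballMaximal n f x ≤ ballMaximal n g x :=
  iSup₂_mono fun _ _ => iSup₂_mono fun _ _ => mul_le_mul_right (lintegral_mono h) _

theorem ballMaximal_const_mul (k : ℝ) (f : EuclideanSpace ℝ (Fin n) → ℝ)
    (x : EuclideanSpace ℝ (Fin n)) :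
    ballMaximal n (fun y => k * f y) x = ‖k‖ₑ * ballMaximal n f x := by
  simp only [ballMaximal, ENNReal.mul_iSup, enorm_mul]
  refine iSup_congr fun z => iSup_congr fun r => iSup_congr fun _ => iSup_congr fun _ => ?_
  rw [lintegral_const_mul' _ _ enorm_ne_top, mul_left_comm]

theorem ballMaximal_le_of_forall_enorm_le {f : EuclideanSpace ℝ (Fin n) → ℝ} {C : ℝ≥0∞}
    (h : ∀ y, ‖f y‖ₑ ≤ C) (x : EuclideanSpace ℝ (Fin n)) : ballMaximal n f x ≤ C := by
  refine iSup₂_le fun z r => iSup₂_le fun hr _ => ?_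
  rw [ENNReal.inv_mul_le_iff (Metric.measure_closedBall_pos volume z hr).ne'
    measure_closedBall_lt_top.ne, mul_comm, ← setLIntegral_const]
  exact lintegral_mono h

theorem ballMaximal_comp_isometry_le
    (U : EuclideanSpace ℝ (Fin n) ≃ₗᵢ[ℝ] EuclideanSpace ℝ (Fin n))
    (f : EuclideanSpace ℝ (Fin n) → ℝ) (x : EuclideanSpace ℝ (Fin n)) :
    ballMaximal n (fun y => f (U y)) x ≤ ballMaximal n f (U x) := by
  refine iSup₂_le fun z r => iSup₂_le fun hr hx => ?_
  have hint : ∫⁻ y in Metric.closedBall z r, ‖f (U y)‖ₑ =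
      ∫⁻ y in Metric.closedBall (U z) r, ‖f y‖ₑ := by
    rw [← U.measurePreserving.setLIntegral_comp_preimage_emb U.toHomeomorph.measurableEmbedding
      (fun y => ‖f y‖ₑ), U.preimage_closedBall, U.symm_apply_apply]
  rw [hint, Measure.addHaar_closedBall_center, ← Measure.addHaar_closedBall_center _ (U z)]
  exact le_ballMaximal f hr (by simpa using hx)

theorem ballMaximal_eq_of_norm_eq {f : EuclideanSpace ℝ (Fin n) → ℝ}
    (hf : ∀ y z, ‖y‖ = ‖z‖ → f y = f z) {x x' : EuclideanSpace ℝ (Fin n)} (h : ‖x‖ = ‖x'‖) :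
    ballMaximal n f x = ballMaximal n f x' := by
  have hle {u v : EuclideanSpace ℝ (Fin n)} (huv : ‖u‖ = ‖v‖) :
      ballMaximal n f u ≤ ballMaximal n f v := by
    let U := Submodule.reflection (ℝ ∙ (u - v))ᗮ
    have hfU : (fun y => f (U y)) = f := funext fun y => hf _ _ (U.norm_map y)
    calc ballMaximal n f u = ballMaximal n (fun y => f (U y)) u := by rw [hfU]
      _ ≤ ballMaximal n f (U u) := ballMaximal_comp_isometry_le U f u
      _ = ballMaximal n f v := by rw [Submodule.reflection_sub huv]
  exact le_antisymm (hle h) (hle h.symm)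

theorem preimage_smul_closedBall_smul {E : Type*} [SeminormedAddCommGroup E] [NormedSpace ℝ E]
    {c : ℝ} (hc : 0 < c) (z : E) (r : ℝ) :
    (fun y => c • y) ⁻¹' Metric.closedBall (c • z) (c * r) = Metric.closedBall z r := by
  ext y
  simp only [Set.mem_preimage, Metric.mem_closedBall, dist_smul₀, Real.norm_of_nonneg hc.le]
  exact mul_le_mul_iff_right₀ hc

theorem setLIntegral_preimage_smul {E : Type*} [NormedAddCommGroup E] [NormedSpace ℝ E]
    [FiniteDimensional ℝ E] [MeasurableSpace E] [BorelSpace E] (μ : Measure E)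
    [μ.IsAddHaarMeasure] {c : ℝ} (hc : c ≠ 0) (f : E → ℝ≥0∞) (s : Set E) :
    ∫⁻ y in (fun y => c • y) ⁻¹' s, f (c • y) ∂μ =
      ENNReal.ofReal |(c ^ Module.finrank ℝ E)⁻¹| * ∫⁻ y in s, f y ∂μ := by
  have hemb : MeasurableEmbedding fun y : E => c • y :=
    (Homeomorph.smulOfNeZero c hc).measurableEmbedding
  rw [← hemb.lintegral_map, ← hemb.restrict_map, Measure.map_addHaar_smul μ hc,
    Measure.restrict_smul, lintegral_smul_measure, smul_eq_mul]

theorem ballMaximal_comp_smul_le {c : ℝ} (hc : 0 < c) (f : EuclideanSpace ℝ (Fin n) → ℝ)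
    (x : EuclideanSpace ℝ (Fin n)) :
    ballMaximal n (fun y => f (c • y)) x ≤ ballMaximal n f (c • x) := by
  refine iSup₂_le fun z r => iSup₂_le fun hr hx => ?_
  set k := ENNReal.ofReal |(c ^ Module.finrank ℝ (EuclideanSpace ℝ (Fin n)))⁻¹| with hk
  have hk_ne : k ≠ 0 := (ENNReal.ofReal_pos.2 (by positivity)).ne'
  have hvol : volume (Metric.closedBall z r) = k * volume (Metric.closedBall (c • z) (c * r)) := by
    rw [← preimage_smul_closedBall_smul hc, Measure.addHaar_preimage_smul _ hc.ne']
  have hint : ∫⁻ y in Metric.closedBall z r, ‖f (c • y)‖ₑ =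
      k * ∫⁻ y in Metric.closedBall (c • z) (c * r), ‖f y‖ₑ := by
    rw [← preimage_smul_closedBall_smul hc,
      setLIntegral_preimage_smul volume hc.ne' fun y => ‖f y‖ₑ]
  rw [← preimage_smul_closedBall_smul hc] at hx
  rw [hint, hvol, ENNReal.mul_inv (Or.inl hk_ne) (Or.inl ENNReal.ofReal_ne_top),
    mul_mul_mul_comm, ENNReal.inv_mul_cancel hk_ne ENNReal.ofReal_ne_top, one_mul]
  exact le_ballMaximal f (mul_pos hc hr) hx

theorem ballMaximal_comp_smul {c : ℝ} (hc : 0 < c) (f : EuclideanSpace ℝ (Fin n) → ℝ)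
    (x : EuclideanSpace ℝ (Fin n)) :
    ballMaximal n (fun y => f (c • y)) x = ballMaximal n f (c • x) := by
  refine le_antisymm (ballMaximal_comp_smul_le hc f x) ?_
  have hle := ballMaximal_comp_smul_le (inv_pos.2 hc) (fun y => f (c • y)) (c • x)
  simpa only [smul_inv_smul₀ hc.ne', inv_smul_smul₀ hc.ne'] using hle

theorem ballMaximal_eq_ballMaximal_axis {m : ℕ} {f : EuclideanSpace ℝ (Fin (m + 1)) → ℝ}
    (hf : ∀ y z, ‖y‖ = ‖z‖ → f y = f z) {x : EuclideanSpace ℝ (Fin (m + 1))} (hx : x ≠ 0) :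
    ballMaximal (m + 1) f x = ballMaximal (m + 1) (fun y => f (‖x‖ • y)) (axis m) := by
  rw [ballMaximal_comp_smul (norm_pos_iff.2 hx)]
  exact ballMaximal_eq_of_norm_eq hf (by rw [norm_smul, norm_axis, mul_one, norm_norm])

end Symmetry

/-! ### The homogeneous function and its truncations -/

section TestFunction

variable {n : ℕ} {p : ℝ}

/-- The homogeneous function `|x| ^ (-n / p)` on `ℝⁿ`, which just fails to be in `Lᵖ` at `0` and at
`∞`; its truncations are the functions `testFun`. -/
def normPow (n : ℕ) (p : ℝ) (x : EuclideanSpace ℝ (Fin n)) : ℝ := ‖x‖ ^ (-((n : ℝ) / p))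

theorem testFun_eq_indicator (ε N : ℝ) :
    testFun n p ε N = (norm ⁻¹' Set.Icc ε N).indicator (normPow n p) := by
  ext x
  by_cases hx : ‖x‖ ∈ Set.Icc ε N
  · rw [Set.indicator_of_mem (by exact hx), testFun, Set.indicator_of_mem hx, normPow, Pi.one_apply,
      mul_one]
  · rw [Set.indicator_of_notMem (by exact hx), testFun, Set.indicator_of_notMem hx, mul_zero]

theorem enorm_normPow (x : EuclideanSpace ℝ (Fin n)) :
    ‖normPow n p x‖ₑ = ENNReal.ofReal (‖x‖ ^ (-((n : ℝ) / p))) :=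
  Real.enorm_eq_ofReal (Real.rpow_nonneg (norm_nonneg x) _)

theorem enorm_testFun (ε N : ℝ) (x : EuclideanSpace ℝ (Fin n)) :
    ‖testFun n p ε N x‖ₑ = (norm ⁻¹' Set.Icc ε N).indicator (fun y => ‖normPow n p y‖ₑ) x := by
  rw [testFun_eq_indicator, enorm_indicator_eq_indicator_enorm]

theorem enorm_testFun_le (ε N : ℝ) (x : EuclideanSpace ℝ (Fin n)) :
    ‖testFun n p ε N x‖ₑ ≤ ‖normPow n p x‖ₑ := by
  rw [testFun_eq_indicator]
  exact enorm_indicator_le_enorm_self _ _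

theorem enorm_testFun_mono {ε ε' N N' : ℝ} (hε : ε' ≤ ε) (hN : N ≤ N')
    (x : EuclideanSpace ℝ (Fin n)) : ‖testFun n p ε N x‖ₑ ≤ ‖testFun n p ε' N' x‖ₑ := by
  rw [enorm_testFun, enorm_testFun]
  exact Set.indicator_le_indicator_of_subset (Set.preimage_mono (Set.Icc_subset_Icc hε hN))
    (fun _ => zero_le) x

theorem measurable_normPow : Measurable (normPow n p) := measurable_norm.pow_const _

theorem measurable_testFun (ε N : ℝ) : Measurable (testFun n p ε N) := by
  rw [testFun_eq_indicator]
  exact measurable_normPow.indicator (measurable_norm measurableSet_Icc)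

theorem normPow_smul {r : ℝ} (hr : 0 ≤ r) (y : EuclideanSpace ℝ (Fin n)) :
    normPow n p (r • y) = r ^ (-((n : ℝ) / p)) * normPow n p y := by
  rw [normPow, normPow, norm_smul, Real.norm_of_nonneg hr, Real.mul_rpow hr (norm_nonneg y)]

theorem testFun_smul {r : ℝ} (hr : 0 < r) (ε N : ℝ) (y : EuclideanSpace ℝ (Fin n)) :
    testFun n p ε N (r • y) = r ^ (-((n : ℝ) / p)) * testFun n p (ε / r) (N / r) y := by
  have hmem : r • y ∈ norm ⁻¹' Set.Icc ε N ↔ y ∈ norm ⁻¹' Set.Icc (ε / r) (N / r) := by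
    rw [Set.mem_preimage, Set.mem_preimage, Set.mem_Icc, Set.mem_Icc, div_le_iff₀' hr,
      le_div_iff₀' hr, norm_smul, Real.norm_of_nonneg hr.le]
  simp only [testFun_eq_indicator]
  by_cases hy : y ∈ norm ⁻¹' Set.Icc (ε / r) (N / r)
  · rw [Set.indicator_of_mem (hmem.2 hy), Set.indicator_of_mem hy, normPow_smul hr.le]
  · rw [Set.indicator_of_notMem (mt hmem.1 hy), Set.indicator_of_notMem hy, mul_zero]

theorem ballMaximal_normPow {m : ℕ} {x : EuclideanSpace ℝ (Fin (m + 1))} (hx : x ≠ 0) :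
    ballMaximal (m + 1) (normPow (m + 1) p) x =
      ‖normPow (m + 1) p x‖ₑ * ballMaximal (m + 1) (normPow (m + 1) p) (axis m) := by
  rw [ballMaximal_eq_ballMaximal_axis (fun y z h => by simp only [normPow, h]) hx,
    ← ballMaximal_const_mul]
  simp_rw [normPow_smul (norm_nonneg x)]
  rfl

theorem ballMaximal_testFun (ε N : ℝ) {m : ℕ} {x : EuclideanSpace ℝ (Fin (m + 1))} (hx : x ≠ 0) :
    ballMaximal (m + 1) (testFun (m + 1) p ε N) x = ‖normPow (m + 1) p x‖ₑ *
      ballMaximal (m + 1) (testFun (m + 1) p (ε / ‖x‖) (N / ‖x‖)) (axis m) := by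
  rw [ballMaximal_eq_ballMaximal_axis (fun y z h => by simp only [testFun, h]) hx,
    ← ballMaximal_const_mul]
  simp_rw [testFun_smul (norm_pos_iff.2 hx)]
  rfl

/- The origin needs separate treatment: there `normPow` vanishes, because `0 ^ (-n / p) = 0`. -/
theorem eventually_testFun_inv_eq_normPow (hn : n ≠ 0) (hp : p ≠ 0)
    (y : EuclideanSpace ℝ (Fin n)) :
    ∀ᶠ R in atTop, testFun n p R⁻¹ R y = normPow n p y := by
  obtain rfl | hy := eq_or_ne y 0
  · have hexp : -((n : ℝ) / p) ≠ 0 := neg_ne_zero.2 (div_ne_zero (Nat.cast_ne_zero.2 hn) hp)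
    refine Eventually.of_forall fun R => ?_
    rw [testFun, normPow, norm_zero, Real.zero_rpow hexp, zero_mul]
  · filter_upwards [eventually_ge_atTop ‖y‖, eventually_ge_atTop ‖y‖⁻¹] with R hle hinv
    rw [testFun_eq_indicator, Set.indicator_of_mem]
    exact ⟨inv_le_of_inv_le₀ (norm_pos_iff.2 hy) hinv, hle⟩

theorem tendsto_setLIntegral_testFun (hn : n ≠ 0) (hp : p ≠ 0)
    (s : Set (EuclideanSpace ℝ (Fin n))) :
    Tendsto (fun k : ℕ => ∫⁻ y in s, ‖testFun n p ((k : ℝ) + 1)⁻¹ (k + 1) y‖ₑ) atTop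
      (𝓝 (∫⁻ y in s, ‖normPow n p y‖ₑ)) := by
  have hmono (y : EuclideanSpace ℝ (Fin n)) :
      Monotone fun k : ℕ => ‖testFun n p ((k : ℝ) + 1)⁻¹ (k + 1) y‖ₑ := fun k l hkl => by
    have hkl : (k : ℝ) + 1 ≤ l + 1 := by gcongr
    exact enorm_testFun_mono (inv_anti₀ (by positivity) hkl) hkl y
  have hatTop : Tendsto (fun k : ℕ => (k : ℝ) + 1) atTop atTop :=
    tendsto_atTop_add_const_right _ _ tendsto_natCast_atTop_atTop
  refine lintegral_tendsto_of_tendsto_of_monotone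
    (fun k => (measurable_testFun _ _).enorm.aemeasurable) (Eventually.of_forall hmono)
    (Eventually.of_forall fun y => tendsto_const_nhds.congr' ?_)
  filter_upwards [hatTop.eventually (eventually_testFun_inv_eq_normPow hn hp y)] with k hk
  rw [hk]

theorem exists_lt_ballMaximal_testFun (hn : n ≠ 0) (hp : p ≠ 0) {ℓ : ℝ≥0∞}
    {x : EuclideanSpace ℝ (Fin n)} (h : ℓ < ballMaximal n (normPow n p) x) :
    ∃ R : ℝ, 1 ≤ R ∧ ℓ < ballMaximal n (testFun n p R⁻¹ R) x := by
  simp only [ballMaximal, lt_iSup_iff] at h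
  obtain ⟨z, r, hr, hx, h⟩ := h
  have hlim := ENNReal.Tendsto.const_mul (a := (volume (Metric.closedBall z r))⁻¹)
    (tendsto_setLIntegral_testFun hn hp (Metric.closedBall z r))
    (Or.inr (ENNReal.inv_ne_top.2 (Metric.measure_closedBall_pos volume z hr).ne'))
  obtain ⟨k, hk⟩ := (hlim.eventually_const_lt h).exists
  exact ⟨k + 1, by simp, hk.trans_le (le_ballMaximal _ hr hx)⟩

end TestFunction

/-! ### Integrals of powers of the norm -/

section NormPower

variable {m : ℕ}

theorem ofReal_sphereArea (m : ℕ) : ENNReal.ofReal (sphereArea m) =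
    (volume : Measure (EuclideanSpace ℝ (Fin (m + 1)))).toSphere Set.univ :=
  ofReal_measureReal

theorem sphereArea_pos (m : ℕ) : 0 < sphereArea m :=
  ENNReal.toReal_pos (Measure.measure_univ_ne_zero.2 (Measure.toSphere_ne_zero _))
    (measure_ne_top _ _)

theorem lintegral_preimage_norm_rpow {S : Set ℝ} (hS : MeasurableSet S) (hS_pos : S ⊆ Set.Ioi 0)
    (a : ℝ) :
    ∫⁻ x : EuclideanSpace ℝ (Fin (m + 1)) in norm ⁻¹' S, ENNReal.ofReal (‖x‖ ^ (a - (m + 1))) =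
      ENNReal.ofReal (sphereArea m) * ∫⁻ r in S, ENNReal.ofReal (r ^ (a - 1)) := by
  have hmeas : Measurable (S.indicator fun r : ℝ => ENNReal.ofReal (r ^ (a - (m + 1)))) :=
    (measurable_id.pow_const _).ennreal_ofReal.indicator hS
  calc ∫⁻ x : EuclideanSpace ℝ (Fin (m + 1)) in norm ⁻¹' S, ENNReal.ofReal (‖x‖ ^ (a - (m + 1)))
      = ∫⁻ x : EuclideanSpace ℝ (Fin (m + 1)),
          S.indicator (fun r : ℝ => ENNReal.ofReal (r ^ (a - (m + 1)))) ‖x‖ := by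
        rw [← lintegral_indicator (measurable_norm hS)]
        rfl
    _ = ENNReal.ofReal (sphereArea m) * ∫⁻ r in Set.Ioi 0,
          S.indicator (fun r : ℝ => ENNReal.ofReal (r ^ (a - 1))) r := by
        rw [lintegral_fun_norm volume hmeas, ofReal_sphereArea, finrank_euclideanSpace_fin,
          Nat.add_sub_cancel]
        congr 1
        refine setLIntegral_congr_fun measurableSet_Ioi fun r hr => ?_
        have hr : 0 < r := hr
        classical
        simp only [Set.indicator_apply, ite_mul, zero_mul]
        rw [← ENNReal.ofReal_mul (by positivity), ← Real.rpow_natCast, ← Real.rpow_add hr]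
        ring_nf
    _ = ENNReal.ofReal (sphereArea m) * ∫⁻ r in S, ENNReal.ofReal (r ^ (a - 1)) := by
        rw [setLIntegral_indicator hS, Set.inter_eq_left.2 hS_pos]

theorem lintegral_preimage_norm_Icc {a b : ℝ} (ha : 0 < a) (hb : 0 < b) :
    ∫⁻ x : EuclideanSpace ℝ (Fin (m + 1)) in norm ⁻¹' Set.Icc a b,
      ENNReal.ofReal (‖x‖ ^ (-((m : ℝ) + 1))) =
      ENNReal.ofReal (sphereArea m * Real.log (b / a)) := by
  obtain hba | hab := lt_or_ge b a
  · rw [Set.Icc_eq_empty_of_lt hba, Set.preimage_empty, Measure.restrict_empty,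
      lintegral_zero_measure, ENNReal.ofReal_of_nonpos]
    exact mul_nonpos_of_nonneg_of_nonpos (sphereArea_pos m).le
      (Real.log_nonpos (div_pos hb ha).le ((div_le_one ha).2 hba.le))
  · have hint : IntegrableOn (fun r : ℝ => r⁻¹) (Set.Icc a b) :=
      (continuousOn_inv₀.mono fun r hr => (ha.trans_le hr.1).ne').integrableOn_Icc
    rw [← zero_sub, lintegral_preimage_norm_rpow measurableSet_Icc fun r hr => ha.trans_le hr.1,
      ENNReal.ofReal_mul (sphereArea_pos m).le, ← integral_inv_of_pos ha hb,
      intervalIntegral.integral_of_le hab, ← integral_Icc_eq_integral_Ioc]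
    simp_rw [zero_sub, Real.rpow_neg_one]
    rw [ofReal_integral_eq_lintegral_ofReal hint]
    filter_upwards [ae_restrict_mem measurableSet_Icc] with r hr
    exact inv_nonneg.2 (ha.trans_le hr.1).le

theorem lintegral_preimage_norm_Ioc_rpow {a R : ℝ} (ha : 0 < a) (hR : 0 ≤ R) :
    ∫⁻ x : EuclideanSpace ℝ (Fin (m + 1)) in norm ⁻¹' Set.Ioc 0 R,
      ENNReal.ofReal (‖x‖ ^ (a - (m + 1))) = ENNReal.ofReal (sphereArea m * (R ^ a / a)) := by
  rw [lintegral_preimage_norm_rpow measurableSet_Ioc fun r hr => hr.1,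
    ENNReal.ofReal_mul (sphereArea_pos m).le, ← lintegral_Ioc_rpow ha hR]
  congr 1
  exact setLIntegral_congr_fun measurableSet_Ioc fun r hr => by rw [abs_of_pos hr.1]

theorem lintegral_preimage_norm_Ioi_rpow {b R : ℝ} (hb : 0 < b) (hR : 0 < R) :
    ∫⁻ x : EuclideanSpace ℝ (Fin (m + 1)) in norm ⁻¹' Set.Ioi R,
      ENNReal.ofReal (‖x‖ ^ (-b - (m + 1))) = ENNReal.ofReal (sphereArea m * (R ^ (-b) / b)) := by
  have hlt : -b - 1 < -1 := by linarith
  have hval := integral_Ioi_rpow_of_lt hlt hR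
  rw [sub_add_cancel, neg_div_neg_eq] at hval
  rw [lintegral_preimage_norm_rpow measurableSet_Ioi fun r hr => hR.trans hr,
    ENNReal.ofReal_mul (sphereArea_pos m).le, ← hval,
    ofReal_integral_eq_lintegral_ofReal (integrableOn_Ioi_rpow_of_lt hlt hR)]
  filter_upwards [ae_restrict_mem measurableSet_Ioi] with r hr
  exact Real.rpow_nonneg (hR.trans hr).le _

variable {p : ℝ}

theorem enorm_normPow_eq_conj (hp : p ≠ 0) (x : EuclideanSpace ℝ (Fin (m + 1))) :
    ‖normPow (m + 1) p x‖ₑ = ENNReal.ofReal (‖x‖ ^ (((m : ℝ) + 1) / conj p - (m + 1))) := by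
  rw [enorm_normPow, neg_div_eq_div_conj_sub hp, Nat.cast_add_one]

theorem enorm_normPow_rpow (hp : 0 < p) (x : EuclideanSpace ℝ (Fin (m + 1))) :
    ‖normPow (m + 1) p x‖ₑ ^ p = ENNReal.ofReal (‖x‖ ^ (-((m : ℝ) + 1))) := by
  rw [enorm_normPow, ENNReal.ofReal_rpow_of_nonneg (by positivity) hp.le,
    ← Real.rpow_mul (norm_nonneg x), neg_mul, div_mul_cancel₀ _ hp.ne', Nat.cast_add_one]

theorem lintegral_testFun_rpow (hp : 0 < p) {ε N : ℝ} (hε : 0 < ε) (hN : 0 < N) :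
    ∫⁻ x, ‖testFun (m + 1) p ε N x‖ₑ ^ p = ENNReal.ofReal (sphereArea m * Real.log (N / ε)) := by
  rw [← lintegral_preimage_norm_Icc hε hN,
    ← lintegral_indicator (measurable_norm measurableSet_Icc)]
  refine lintegral_congr fun x => ?_
  classical
  simp only [enorm_testFun, Set.indicator_apply]
  split_ifs
  · rw [enorm_normPow_rpow hp]
  · rw [ENNReal.zero_rpow_of_pos hp]

theorem lintegral_testFun_le (hp : 1 < p) {ε N : ℝ} (hε : 0 < ε) (hN : 0 ≤ N) :
    ∫⁻ x, ‖testFun (m + 1) p ε N x‖ₑ ≤ ENNReal.ofReal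
      (sphereArea m * (N ^ (((m : ℝ) + 1) / conj p) / (((m : ℝ) + 1) / conj p))) := by
  have hc := conj_pos hp
  rw [← lintegral_preimage_norm_Ioc_rpow (by positivity) hN,
    ← lintegral_indicator (measurable_norm measurableSet_Ioc)]
  refine lintegral_mono fun x => ?_
  simp only [← enorm_normPow_eq_conj (one_pos.trans hp).ne', enorm_testFun]
  have hsub : Set.Icc ε N ⊆ Set.Ioc 0 N := fun r hr => ⟨hε.trans_le hr.1, hr.2⟩
  exact Set.indicator_le_indicator_of_subset (Set.preimage_mono hsub) (fun _ => zero_le) x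

theorem memLp_testFun (hp : 0 < p) {ε N : ℝ} (hε : 0 < ε) (hN : 0 < N) :
    MemLp (testFun (m + 1) p ε N) (ENNReal.ofReal p) volume := by
  refine ⟨(measurable_testFun ε N).aestronglyMeasurable, ?_⟩
  rw [eLpNorm_ofReal_eq hp, lintegral_testFun_rpow hp hε hN]
  exact ENNReal.rpow_lt_top_of_nonneg (by positivity) ENNReal.ofReal_ne_top

theorem eLpNorm_testFun_ne_zero (hp : 0 < p) {ε N : ℝ} (hε : 0 < ε) (hN : ε < N) :
    eLpNorm (testFun (m + 1) p ε N) (ENNReal.ofReal p) volume ≠ 0 := by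
  have hlog : 0 < sphereArea m * Real.log (N / ε) :=
    mul_pos (sphereArea_pos m) (Real.log_pos ((one_lt_div hε).2 hN))
  rw [eLpNorm_ofReal_eq hp, lintegral_testFun_rpow hp hε (hε.trans hN)]
  exact (ENNReal.rpow_pos (ENNReal.ofReal_pos.2 hlog) ENNReal.ofReal_ne_top).ne'

end NormPower

/-! ### The limit of the quotients of norms -/

section Limit

theorem ballMaximal_le_of_eq_zero {n : ℕ} {f : EuclideanSpace ℝ (Fin n) → ℝ} {N : ℝ}
    (hf : ∀ y, N < ‖y‖ → f y = 0) {x : EuclideanSpace ℝ (Fin n)} (hx : 2 * N ≤ ‖x‖) :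
    ballMaximal n f x ≤ (volume (Metric.closedBall x (‖x‖ / 4)))⁻¹ * ∫⁻ y, ‖f y‖ₑ := by
  refine iSup₂_le fun z r => iSup₂_le fun _ hxz => ?_
  by_cases hmeet : ∃ y ∈ Metric.closedBall z r, ‖y‖ ≤ N
  · obtain ⟨y, hyz, hyN⟩ := hmeet
    have hrad : ‖x‖ / 4 ≤ r := by
      have hdist : ‖x - y‖ ≤ r + r := by
        rw [← dist_eq_norm]
        exact (dist_triangle_right x y z).trans (add_le_add hxz hyz)
      linarith [norm_sub_norm_le x y]
    rw [Measure.addHaar_closedBall_center volume x, ← Measure.addHaar_closedBall_center volume z]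
    gcongr
    exact Measure.restrict_le_self
  · push Not at hmeet
    have hzero : ∫⁻ y in Metric.closedBall z r, ‖f y‖ₑ = 0 :=
      setLIntegral_eq_zero Metric.isClosed_closedBall.measurableSet fun y hy => by
        rw [hf y (hmeet y hy), enorm_zero, Pi.zero_apply]
    rw [hzero, mul_zero]
    exact zero_le

variable {m : ℕ} {p : ℝ}

theorem volume_closedBall_eq_sphereArea (z : EuclideanSpace ℝ (Fin (m + 1))) {r : ℝ}
    (hr : 0 ≤ r) :
    volume (Metric.closedBall z r) = ENNReal.ofReal (sphereArea m / (m + 1) * r ^ (m + 1)) := by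
  have hm : (0 : ℝ) < m + 1 := by positivity
  have hunit : volume (Metric.ball (0 : EuclideanSpace ℝ (Fin (m + 1))) 1) =
      ENNReal.ofReal (sphereArea m / (m + 1)) := by
    rw [ENNReal.ofReal_div_of_pos hm, ofReal_sphereArea, Measure.toSphere_apply_univ,
      finrank_euclideanSpace_fin, ENNReal.eq_div_iff (ENNReal.ofReal_pos.2 hm).ne'
      ENNReal.ofReal_ne_top, ← Nat.cast_add_one, ENNReal.ofReal_natCast]
  rw [Measure.addHaar_closedBall _ _ hr, hunit, finrank_euclideanSpace_fin, mul_comm,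
    ENNReal.ofReal_mul (div_nonneg (sphereArea_pos m).le hm.le)]

theorem ballMaximal_testFun_le_of_two_mul_le (hp : 1 < p) {ε N : ℝ} (hε : 0 < ε) (hN : 0 < N)
    {x : EuclideanSpace ℝ (Fin (m + 1))} (hx : 2 * N ≤ ‖x‖) :
    ballMaximal (m + 1) (testFun (m + 1) p ε N) x ≤ ENNReal.ofReal
      (4 ^ (m + 1) * conj p * (N ^ (((m : ℝ) + 1) / conj p) * ‖x‖ ^ (-((m : ℝ) + 1)))) := by
  have hc := conj_pos hp
  have hσ := sphereArea_pos m
  have hx_pos : 0 < ‖x‖ := by linarith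
  have hsupp (y : EuclideanSpace ℝ (Fin (m + 1))) (hy : N < ‖y‖) :
      testFun (m + 1) p ε N y = 0 := by
    rw [testFun_eq_indicator]
    exact Set.indicator_of_notMem (fun hmem => hy.not_ge hmem.2) _
  refine (ballMaximal_le_of_eq_zero hsupp hx).trans
    ((mul_le_mul_right (lintegral_testFun_le hp hε hN.le) _).trans_eq ?_)
  rw [volume_closedBall_eq_sphereArea _ (by positivity),
    ← ENNReal.ofReal_inv_of_pos (by positivity), ← ENNReal.ofReal_mul (by positivity),
    Real.rpow_neg hx_pos.le, ← Nat.cast_add_one, Real.rpow_natCast, Nat.cast_add_one]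
  congr 1
  field_simp
  rw [← mul_pow, div_mul_cancel₀ _ four_ne_zero]

theorem lintegral_ballMaximal_testFun_near_le (hp : 0 < p) {ε N : ℝ} (hε : 0 < ε) :
    ∫⁻ x in Metric.closedBall 0 ε, ballMaximal (m + 1) (testFun (m + 1) p ε N) x ^ p ≤
      ENNReal.ofReal (sphereArea m / (m + 1)) := by
  have hbound (y : EuclideanSpace ℝ (Fin (m + 1))) : ‖testFun (m + 1) p ε N y‖ₑ ≤
      ENNReal.ofReal (ε ^ (-(((m + 1 : ℕ) : ℝ) / p))) := by
    rw [enorm_testFun]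
    refine Set.indicator_apply_le' (fun hy => ?_) fun _ => zero_le
    rw [enorm_normPow]
    exact ENNReal.ofReal_le_ofReal
      (Real.rpow_le_rpow_of_nonpos hε hy.1 (neg_nonpos.2 (by positivity)))
  have hcancel : (ε ^ (-(((m + 1 : ℕ) : ℝ) / p))) ^ p * (sphereArea m / (m + 1) * ε ^ (m + 1)) =
      sphereArea m / (m + 1) := by
    rw [← Real.rpow_mul hε.le, neg_mul, div_mul_cancel₀ _ hp.ne', Real.rpow_neg hε.le,
      Real.rpow_natCast]
    field_simp
  calc ∫⁻ x in Metric.closedBall 0 ε, ballMaximal (m + 1) (testFun (m + 1) p ε N) x ^ p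
      ≤ ∫⁻ _ in Metric.closedBall (0 : EuclideanSpace ℝ (Fin (m + 1))) ε,
          ENNReal.ofReal (ε ^ (-(((m + 1 : ℕ) : ℝ) / p))) ^ p :=
        lintegral_mono fun x =>
          ENNReal.rpow_le_rpow (ballMaximal_le_of_forall_enorm_le hbound x) hp.le
    _ = ENNReal.ofReal (sphereArea m / (m + 1)) := by
        rw [setLIntegral_const, volume_closedBall_eq_sphereArea _ hε.le,
          ENNReal.ofReal_rpow_of_nonneg (by positivity) hp.le,
          ← ENNReal.ofReal_mul (by positivity), hcancel]

theorem lintegral_ballMaximal_testFun_mid_le (hp : 0 < p) {ε N : ℝ} (hε : 0 < ε) (hN : 0 < N) :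
    ∫⁻ x in norm ⁻¹' Set.Icc ε (2 * N), ballMaximal (m + 1) (testFun (m + 1) p ε N) x ^ p ≤
      ballMaximal (m + 1) (normPow (m + 1) p) (axis m) ^ p *
        ENNReal.ofReal (sphereArea m * (Real.log (N / ε) + Real.log 2)) := by
  have hlog : Real.log (2 * N / ε) = Real.log (N / ε) + Real.log 2 := by
    rw [mul_div_assoc, Real.log_mul two_ne_zero (div_pos hN hε).ne', add_comm]
  rw [← hlog, ← lintegral_preimage_norm_Icc hε (by positivity),
    ← lintegral_const_mul _ (measurable_norm.pow_const _).ennreal_ofReal]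
  refine setLIntegral_mono' (measurable_norm measurableSet_Icc) fun x hx => ?_
  rw [← enorm_normPow_rpow hp, ← ENNReal.mul_rpow_of_nonneg _ _ hp.le, mul_comm,
    ← ballMaximal_normPow (norm_pos_iff.1 (hε.trans_le hx.1))]
  exact ENNReal.rpow_le_rpow (ballMaximal_mono (enorm_testFun_le ε N) x) hp.le

theorem lintegral_ballMaximal_testFun_far_le (hp : 1 < p) {ε N : ℝ} (hε : 0 < ε) (hN : 0 < N) :
    ∫⁻ x in norm ⁻¹' Set.Ioi (2 * N), ballMaximal (m + 1) (testFun (m + 1) p ε N) x ^ p ≤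
      ENNReal.ofReal ((4 ^ (m + 1) * conj p) ^ p *
        (sphereArea m * (2 ^ (-(((m : ℝ) + 1) * (p - 1))) / (((m : ℝ) + 1) * (p - 1))))) := by
  have hp_pos : 0 < p := one_pos.trans hp
  have hc := conj_pos hp
  set b := ((m : ℝ) + 1) * (p - 1) with hb
  have hb_pos : 0 < b := mul_pos (by positivity) (sub_pos.2 hp)
  have hexp : ((m : ℝ) + 1) / conj p * p = b := by
    rw [div_eq_mul_one_div, one_div_conj hp_pos.ne', hb]
    field_simp
  have hpow {x : EuclideanSpace ℝ (Fin (m + 1))} :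
      (4 ^ (m + 1) * conj p * (N ^ (((m : ℝ) + 1) / conj p) * ‖x‖ ^ (-((m : ℝ) + 1)))) ^ p =
        (4 ^ (m + 1) * conj p) ^ p * N ^ b * ‖x‖ ^ (-b - (m + 1)) := by
    rw [Real.mul_rpow (x := 4 ^ (m + 1) * conj p) (by positivity) (by positivity),
      Real.mul_rpow (x := N ^ _) (by positivity) (by positivity),
      ← Real.rpow_mul hN.le, ← Real.rpow_mul (norm_nonneg x), hexp, mul_assoc]
    congr 3
    rw [hb]
    ring
  have hscale : N ^ b * (2 * N) ^ (-b) = 2 ^ (-b) := by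
    rw [Real.mul_rpow two_pos.le hN.le, mul_left_comm, ← Real.rpow_add hN, add_neg_cancel,
      Real.rpow_zero, mul_one]
  calc ∫⁻ x in norm ⁻¹' Set.Ioi (2 * N), ballMaximal (m + 1) (testFun (m + 1) p ε N) x ^ p
      ≤ ∫⁻ x : EuclideanSpace ℝ (Fin (m + 1)) in norm ⁻¹' Set.Ioi (2 * N),
          ENNReal.ofReal ((4 ^ (m + 1) * conj p) ^ p * N ^ b) *
            ENNReal.ofReal (‖x‖ ^ (-b - (m + 1))) := by
        refine setLIntegral_mono' (measurable_norm measurableSet_Ioi) fun x hx => ?_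
        rw [← ENNReal.ofReal_mul (by positivity), ← hpow,
          ← ENNReal.ofReal_rpow_of_nonneg (by positivity) hp_pos.le]
        exact ENNReal.rpow_le_rpow
          (ballMaximal_testFun_le_of_two_mul_le hp hε hN (Set.mem_Ioi.1 hx).le) hp_pos.le
    _ = _ := by
        rw [lintegral_const_mul' _ _ ENNReal.ofReal_ne_top,
          lintegral_preimage_norm_Ioi_rpow hb_pos (by positivity),
          ← ENNReal.ofReal_mul (by positivity), ← hscale]
        ring_nf

theorem exists_lintegral_ballMaximal_testFun_le (m : ℕ) (hp : 1 < p) :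
    ∃ C : ℝ≥0∞, C ≠ ∞ ∧ ∀ ε N : ℝ, 0 < ε → 0 < N →
      ∫⁻ x, ballMaximal (m + 1) (testFun (m + 1) p ε N) x ^ p ≤
        ballMaximal (m + 1) (normPow (m + 1) p) (axis m) ^ p *
          ENNReal.ofReal (sphereArea m * (Real.log (N / ε) + Real.log 2)) + C := by
  have hp_pos : 0 < p := one_pos.trans hp
  refine ⟨ENNReal.ofReal (sphereArea m / (m + 1)) + ENNReal.ofReal ((4 ^ (m + 1) * conj p) ^ p *
      (sphereArea m * (2 ^ (-(((m : ℝ) + 1) * (p - 1))) / (((m : ℝ) + 1) * (p - 1))))),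
    ENNReal.add_ne_top.2 ⟨ENNReal.ofReal_ne_top, ENNReal.ofReal_ne_top⟩,
    fun ε N hε hN => ?_⟩
  have hcover : (Set.univ : Set (EuclideanSpace ℝ (Fin (m + 1)))) ⊆
      norm ⁻¹' Set.Icc ε (2 * N) ∪ (Metric.closedBall 0 ε ∪ norm ⁻¹' Set.Ioi (2 * N)) := by
    intro x _
    obtain hnear | hε' := le_or_gt ‖x‖ ε
    · exact Or.inr (Or.inl (mem_closedBall_zero_iff.2 hnear))
    · obtain hmid | hfar := le_or_gt ‖x‖ (2 * N)
      · exact Or.inl ⟨hε'.le, hmid⟩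
      · exact Or.inr (Or.inr hfar)
  rw [← setLIntegral_univ]
  refine (lintegral_mono_set hcover).trans ((lintegral_union_le _ _ _).trans ?_)
  exact add_le_add (lintegral_ballMaximal_testFun_mid_le hp_pos hε hN)
    ((lintegral_union_le _ _ _).trans (add_le_add (lintegral_ballMaximal_testFun_near_le hp_pos hε)
      (lintegral_ballMaximal_testFun_far_le hp hε hN)))

/- On the annulus `ε R ≤ |x| ≤ N / R`, the rescaled truncation `[ε / |x|, N / |x|]` contains
`[R⁻¹, R]`. -/
theorem le_lintegral_ballMaximal_testFun (hp : 0 < p) {R ε N : ℝ} (hR : 0 < R) (hε : 0 < ε)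
    (hN : 0 < N) :
    ballMaximal (m + 1) (testFun (m + 1) p R⁻¹ R) (axis m) ^ p *
        ENNReal.ofReal (sphereArea m * (Real.log (N / ε) - 2 * Real.log R)) ≤
      ∫⁻ x, ballMaximal (m + 1) (testFun (m + 1) p ε N) x ^ p := by
  have hlog : Real.log (N / R / (ε * R)) = Real.log (N / ε) - 2 * Real.log R := by
    rw [div_div, mul_left_comm, ← div_div, Real.log_div (by positivity) (by positivity),
      Real.log_mul hR.ne' hR.ne', two_mul]
  rw [← hlog, ← lintegral_preimage_norm_Icc (mul_pos hε hR) (div_pos hN hR),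
    ← lintegral_const_mul _ (measurable_norm.pow_const _).ennreal_ofReal]
  refine (setLIntegral_mono' (measurable_norm measurableSet_Icc) fun x hx => ?_).trans
    (setLIntegral_le_lintegral _ _)
  have hx_pos : 0 < ‖x‖ := (mul_pos hε hR).trans_le hx.1
  rw [ballMaximal_testFun _ _ (norm_pos_iff.1 hx_pos), ENNReal.mul_rpow_of_nonneg _ _ hp.le,
    enorm_normPow_rpow hp, mul_comm]
  gcongr
  refine ballMaximal_mono (fun y => enorm_testFun_mono ?_ ?_ y) _
  · rw [div_le_iff₀ hx_pos, le_inv_mul_iff₀ hR, mul_comm]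
    exact hx.1
  · rw [le_div_iff₀ hx_pos, mul_comm]
    exact (le_div_iff₀ hR).1 hx.2

theorem tendsto_div_of_mul_sub_le_of_le_mul_add {α : Type*} {l : Filter α} {A D : α → ℝ≥0∞}
    {L : ℝ≥0∞} (hD : Tendsto D l (𝓝 ∞)) (hD_ne_top : ∀ᶠ q in l, D q ≠ ∞)
    (hlower : ∀ ℓ < L, ∃ K ≠ ∞, ∀ᶠ q in l, ℓ * (D q - K) ≤ A q)
    (hupper : ∃ K ≠ ∞, ∃ C ≠ ∞, ∀ᶠ q in l, A q ≤ L * (D q + K) + C) :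
    Tendsto (fun q => A q / D q) l (𝓝 L) := by
  have hD_ne_zero : ∀ᶠ q in l, D q ≠ 0 := hD.eventually_ne ENNReal.top_ne_zero
  have hsmall {K : ℝ≥0∞} (hK : K ≠ ∞) : Tendsto (fun q => K / D q) l (𝓝 0) := by
    simpa only [ENNReal.div_top] using ENNReal.Tendsto.const_div hD (Or.inr hK)
  refine tendsto_order.2 ⟨fun ℓ hℓ => ?_, fun u hu => ?_⟩
  · obtain ⟨ℓ', hℓℓ', hℓ'⟩ := exists_between hℓ
    obtain ⟨K, hK, hle⟩ := hlower ℓ' hℓ'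
    have hlim : Tendsto (fun q => ℓ' * (1 - K / D q)) l (𝓝 (ℓ' * (1 - 0))) :=
      ENNReal.Tendsto.const_mul
        (ENNReal.Tendsto.sub tendsto_const_nhds (hsmall hK) (Or.inl ENNReal.one_ne_top))
        (Or.inl (by simp))
    rw [tsub_zero, mul_one] at hlim
    filter_upwards [hlim.eventually_const_lt hℓℓ', hD_ne_top, hD_ne_zero, hle]
      with q hq htop hzero hqle
    refine hq.trans_le ((le_of_eq ?_).trans (ENNReal.div_le_div_right hqle _))
    rw [mul_div_assoc, ENNReal.sub_div fun _ _ => hzero, ENNReal.div_self hzero htop]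
  · obtain ⟨K, hK, C, hC, hle⟩ := hupper
    have hlim : Tendsto (fun q => L * (1 + K / D q) + C / D q) l (𝓝 (L * (1 + 0) + 0)) :=
      (ENNReal.Tendsto.const_mul (tendsto_const_nhds.add (hsmall hK)) (Or.inl (by simp))).add
        (hsmall hC)
    rw [add_zero, add_zero, mul_one] at hlim
    filter_upwards [hlim.eventually_lt_const hu, hD_ne_top, hD_ne_zero, hle]
      with q hq htop hzero hqle
    refine ((ENNReal.div_le_div_right hqle _).trans (le_of_eq ?_)).trans_lt hq
    rw [ENNReal.add_div, mul_div_assoc, ENNReal.add_div, ENNReal.div_self hzero htop]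

theorem tendsto_log_div_atTop :
    Tendsto (fun q : ℝ × ℝ => Real.log (q.2 / q.1)) (𝓝[>] 0 ×ˢ atTop) atTop := by
  have hinv : Tendsto (fun q : ℝ × ℝ => q.1⁻¹) (𝓝[>] (0 : ℝ) ×ˢ (atTop : Filter ℝ)) atTop :=
    tendsto_inv_nhdsGT_zero.comp tendsto_fst
  exact Real.tendsto_log_atTop.comp (tendsto_snd.atTop_mul_atTop₀ hinv)

theorem eventually_pos_and_lt : ∀ᶠ q : ℝ × ℝ in 𝓝[>] 0 ×ˢ atTop, 0 < q.1 ∧ q.1 < q.2 := by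
  filter_upwards [tendsto_fst.eventually (Ioo_mem_nhdsGT one_pos),
    tendsto_snd.eventually (eventually_gt_atTop 1)] with q hε hN
  exact ⟨hε.1, hε.2.trans hN⟩

theorem tendsto_lintegral_ballMaximal_testFun_div (m : ℕ) (hp : 1 < p) :
    Tendsto (fun q : ℝ × ℝ => (∫⁻ x, ballMaximal (m + 1) (testFun (m + 1) p q.1 q.2) x ^ p) /
        ENNReal.ofReal (sphereArea m * Real.log (q.2 / q.1)))
      (𝓝[>] 0 ×ˢ atTop) (𝓝 (ballMaximal (m + 1) (normPow (m + 1) p) (axis m) ^ p)) := by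
  have hp_pos : 0 < p := one_pos.trans hp
  have hσ := sphereArea_pos m
  refine tendsto_div_of_mul_sub_le_of_le_mul_add
    (ENNReal.tendsto_ofReal_atTop.comp (tendsto_log_div_atTop.const_mul_atTop hσ))
    (Eventually.of_forall fun _ => ENNReal.ofReal_ne_top) (fun ℓ hℓ => ?_) ?_
  · obtain ⟨R, hR, hlt⟩ := exists_lt_ballMaximal_testFun m.succ_ne_zero hp_pos.ne'
      ((ENNReal.rpow_inv_lt_iff hp_pos).2 hℓ)
    refine ⟨ENNReal.ofReal (sphereArea m * (2 * Real.log R)), ENNReal.ofReal_ne_top, ?_⟩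
    filter_upwards [eventually_pos_and_lt] with q hq
    rw [← ENNReal.ofReal_sub _ (mul_nonneg hσ.le (mul_nonneg two_pos.le (Real.log_nonneg hR))),
      ← mul_sub]
    refine le_trans ?_ (le_lintegral_ballMaximal_testFun hp_pos (one_pos.trans_le hR) hq.1
      (hq.1.trans hq.2))
    gcongr
    exact ((ENNReal.rpow_inv_lt_iff hp_pos).1 hlt).le
  · obtain ⟨C, hC, hle⟩ := exists_lintegral_ballMaximal_testFun_le m hp
    refine ⟨ENNReal.ofReal (sphereArea m * Real.log 2), ENNReal.ofReal_ne_top, C, hC, ?_⟩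
    filter_upwards [eventually_pos_and_lt] with q hq
    have hlog : 0 ≤ Real.log (q.2 / q.1) := Real.log_nonneg ((one_le_div hq.1).2 hq.2.le)
    rw [← ENNReal.ofReal_add (by positivity) (by positivity), ← mul_add]
    exact hle q.1 q.2 hq.1 (hq.1.trans hq.2)

theorem tendsto_eLpNorm_ballMaximal_testFun_div (m : ℕ) (hp : 1 < p) :
    Tendsto (fun q : ℝ × ℝ =>
        eLpNorm (ballMaximal (m + 1) (testFun (m + 1) p q.1 q.2)) (ENNReal.ofReal p) volume /
        eLpNorm (testFun (m + 1) p q.1 q.2) (ENNReal.ofReal p) volume)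
      (𝓝[>] 0 ×ˢ atTop) (𝓝 (ballMaximal (m + 1) (normPow (m + 1) p) (axis m))) := by
  have hp_pos : 0 < p := one_pos.trans hp
  have hroot := (tendsto_lintegral_ballMaximal_testFun_div m hp).ennrpow_const (1 / p)
  rw [← ENNReal.rpow_mul, mul_one_div_cancel hp_pos.ne', ENNReal.rpow_one] at hroot
  refine hroot.congr' ?_
  filter_upwards [eventually_pos_and_lt] with q hq
  rw [eLpNorm_ofReal_eq hp_pos, eLpNorm_ofReal_eq hp_pos,
    lintegral_testFun_rpow hp_pos hq.1 (hq.1.trans hq.2),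
    ENNReal.div_rpow_of_nonneg _ _ (by positivity)]
  rfl

theorem betaBound_le_ballMaximal_normPow (hp : 1 < p) (hm : 1 ≤ m) :
    ENNReal.ofReal (betaBound p (m + 1)) ≤
      ballMaximal (m + 1) (normPow (m + 1) p) (axis m) := by
  rw [← average_closedBall_half_axis hp hm]
  simp_rw [← enorm_normPow]
  refine le_ballMaximal _ one_half_pos ?_
  have hsub : axis m - (1 / 2 : ℝ) • axis m = (1 / 2 : ℝ) • axis m := by module
  rw [mem_closedBall_iff_norm, hsub, norm_smul, norm_axis, mul_one,
    Real.norm_of_nonneg one_half_pos.le]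

theorem betaBound_le_opNorm (hp : 1 < p) {n : ℕ} (hn : 2 ≤ n) :
    ENNReal.ofReal (betaBound p n) ≤ opNorm p (ballMaximal n) := by
  obtain ⟨m, rfl⟩ := Nat.exists_eq_add_of_le' (one_le_two.trans hn)
  refine (betaBound_le_ballMaximal_normPow hp (by omega)).trans
    (le_of_tendsto (tendsto_eLpNorm_ballMaximal_testFun_div m hp) ?_)
  filter_upwards [eventually_pos_and_lt] with q hq
  exact eLpNorm_div_le_opNorm (memLp_testFun (one_pos.trans hp) hq.1 (hq.1.trans hq.2))
    (eLpNorm_testFun_ne_zero (one_pos.trans hp) hq.1 hq.2)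

end Limit

/-! ### Exponential growth -/

section Growth

variable {p : ℝ}

theorem growsExponentially_opNorm_ballMaximal (hp : 1 < p) :
    GrowsExponentially fun n => opNorm p (ballMaximal n) := by
  have hg := one_lt_growthBase hp
  have hc := conj_pos hp
  set A := conj p * √((1 + 1 / conj p) / 2) with hA
  have hA_pos : 0 < A := by positivity
  refine ⟨√(growthBase p), A / 2, 5, conj p, by rwa [Real.lt_sqrt zero_le_one, one_pow],
    half_pos hA_pos, ?_⟩
  filter_upwards [(betaBound_isEquivalent hp).isLittleO.bound one_half_pos, eventually_ge_atTop 2]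
    with n hbound hn
  refine ⟨(ENNReal.ofReal_le_ofReal ?_).trans (betaBound_le_opNorm hp hn),
    opNorm_ballMaximal_le hp n⟩
  have hpow : growthBase p ^ ((n : ℝ) / 2) = √(growthBase p) ^ n := by
    rw [Real.sqrt_eq_rpow, ← Real.rpow_natCast, ← Real.rpow_mul (by linarith),
      one_div_mul_eq_div]
  rw [Pi.sub_apply, hpow, ← hA, Real.norm_of_nonneg (by positivity : 0 ≤ A * √(growthBase p) ^ n),
    Real.norm_eq_abs] at hbound
  linarith [neg_abs_le (betaBound p n - A * √(growthBase p) ^ n)]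

theorem opNorm_strongMaximal_lt (hp : 1 < p) {n : ℕ} (hn : n ≠ 0) :
    opNorm p (strongMaximal n) < ENNReal.ofReal ((2 * conj p) ^ n) := by
  obtain ⟨c, hc, hlow, hupp⟩ := exists_sharpPoly_eq_zero hp
  have hc_pos : 0 < c := (conj_pos hp).trans hlow
  exact (opNorm_strongMaximal_le hp hc_pos hc n).trans_lt
    ((ENNReal.ofReal_lt_ofReal_iff (pow_pos (hc_pos.trans hupp) n)).2
      (pow_lt_pow_left₀ hupp hc_pos.le hn))

theorem growsExponentially_opNorm_strongMaximal (hp : 1 < p) :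
    GrowsExponentially fun n => opNorm p (strongMaximal n) := by
  refine ⟨conj p, 1, 2 * conj p, 1, one_lt_conj hp, one_pos, ?_⟩
  filter_upwards [eventually_ne_atTop 0] with n hn
  rw [one_mul, one_mul]
  exact ⟨(lt_opNorm_strongMaximal hp hn).le, (opNorm_strongMaximal_lt hp hn).le⟩

end Growth

end UncenteredMaximal

end

theorem mainTheorem3 (p : ℝ) (hp : 1 < p) :
    -- the operator norm of the ball maximal function on `Lᵖ(ℝⁿ)` grows exponentially
    UncenteredMaximal.GrowsExponentially
      (fun n => UncenteredMaximal.opNorm p (UncenteredMaximal.ballMaximal n)) ∧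
    -- the test functions lie in `Lᵖ`, are not zero there, and the ratio of norms has a limit,
    -- as `ε → 0` and `N → ∞`, that is at least the explicit expression
    (∀ n : ℕ, 2 ≤ n →
      (∀ ε N : ℝ, 0 < ε → ε < N →
        MemLp (UncenteredMaximal.testFun n p ε N) (ENNReal.ofReal p) volume ∧
        eLpNorm (UncenteredMaximal.testFun n p ε N) (ENNReal.ofReal p) volume ≠ 0) ∧
      ∃ L : ℝ≥0∞,
        Tendsto (fun q : ℝ × ℝ =>
            eLpNorm (UncenteredMaximal.ballMaximal n (UncenteredMaximal.testFun n p q.1 q.2))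
              (ENNReal.ofReal p) volume /
            eLpNorm (UncenteredMaximal.testFun n p q.1 q.2) (ENNReal.ofReal p) volume)
          (𝓝[>] 0 ×ˢ atTop) (𝓝 L) ∧
        ENNReal.ofReal (UncenteredMaximal.betaBound p n) ≤ L) ∧
    -- hence the operator norm is at least that expression
    (∀ n : ℕ, 2 ≤ n → ENNReal.ofReal (UncenteredMaximal.betaBound p n) ≤
      UncenteredMaximal.opNorm p (UncenteredMaximal.ballMaximal n)) ∧
    -- the expression as an integral
    (∀ n : ℕ, 2 ≤ n → UncenteredMaximal.betaBound p n =
      2 ^ n * UncenteredMaximal.conj p *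
        (UncenteredMaximal.sphereArea (n - 2) / UncenteredMaximal.sphereArea (n - 1)) *
        ∫ s in (0 : ℝ)..1, s ^ ((n : ℝ) / UncenteredMaximal.conj p) *
          (1 - s ^ 2) ^ (((n : ℝ) - 3) / 2)) ∧
    -- its asymptotics as `n → ∞`
    (UncenteredMaximal.betaBound p ~[atTop] fun n : ℕ =>
      UncenteredMaximal.conj p * √((1 + 1 / UncenteredMaximal.conj p) / 2) *
        UncenteredMaximal.growthBase p ^ ((n : ℝ) / 2)) ∧
    1 < UncenteredMaximal.growthBase p ∧
    -- the unique positive solution `c` of `(p - 1) x^p - p x^{p-1} - 1 = 0`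
    (∃ c : ℝ, (0 < c ∧ (p - 1) * c ^ p - p * c ^ (p - 1) - 1 = 0) ∧
      (∀ x : ℝ, 0 < x → (p - 1) * x ^ p - p * x ^ (p - 1) - 1 = 0 → x = c) ∧
      p / (p - 1) < c ∧ c < 2 * p / (p - 1)) ∧
    -- exponential growth for the strong maximal function
    (∀ n : ℕ, 1 ≤ n →
      ENNReal.ofReal ((p / (p - 1)) ^ n) <
        UncenteredMaximal.opNorm p (UncenteredMaximal.strongMaximal n) ∧
      UncenteredMaximal.opNorm p (UncenteredMaximal.strongMaximal n) <
        ENNReal.ofReal ((2 * p / (p - 1)) ^ n)) ∧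
    UncenteredMaximal.GrowsExponentially
      (fun n => UncenteredMaximal.opNorm p (UncenteredMaximal.strongMaximal n)) := by
  refine ⟨UncenteredMaximal.growsExponentially_opNorm_ballMaximal hp, fun n hn => ?_,
    fun n hn => UncenteredMaximal.betaBound_le_opNorm hp hn,
    fun n hn => UncenteredMaximal.betaBound_eq_integral hp hn,
    UncenteredMaximal.betaBound_isEquivalent hp, UncenteredMaximal.one_lt_growthBase hp, ?_,
    fun n hn => ⟨UncenteredMaximal.lt_opNorm_strongMaximal hp (by omega), ?_⟩,
    UncenteredMaximal.growsExponentially_opNorm_strongMaximal hp⟩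
  · have hp_pos : 0 < p := one_pos.trans hp
    obtain ⟨m, rfl⟩ := Nat.exists_eq_add_of_le' (one_le_two.trans hn)
    exact ⟨fun ε N hε hN => ⟨UncenteredMaximal.memLp_testFun hp_pos hε (hε.trans hN),
        UncenteredMaximal.eLpNorm_testFun_ne_zero hp_pos hε hN⟩, _,
      UncenteredMaximal.tendsto_eLpNorm_ballMaximal_testFun_div m hp,
      UncenteredMaximal.betaBound_le_ballMaximal_normPow hp (by omega)⟩
  · obtain ⟨c, hc, hlow, hupp⟩ := UncenteredMaximal.exists_sharpPoly_eq_zero hp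
    have hc_pos : 0 < c := (UncenteredMaximal.conj_pos hp).trans hlow
    exact ⟨c, ⟨hc_pos, hc⟩,
      fun x hx hx0 => UncenteredMaximal.eq_of_sharpPoly_eq_zero hp hx hc_pos hx0 hc, hlow,
      hupp.trans_eq (mul_div_assoc 2 p (p - 1)).symm⟩
  · rw [mul_div_assoc]
    exact UncenteredMaximal.opNorm_strongMaximal_lt hp (by omega)
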